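/- Let $M\subset\mathbb{R}^2$ be a bounded domain (open and connected). Let $\mathcal{A}(M)$ be the family of non-empty open sets $\Omega\subset M$ with piecewise smooth boundary, meaning that $\partial\Omega$ is a finite union of regular $C^\infty$ arcs (parametrized by $[0,1]$, end points included) which meet themselves and each other only at end points. For $\Omega\in\mathcal{A}(M)$ put $$\eta^\partial(\Omega)=\frac{|\partial\Omega\cap M|}{|\partial\Omega\cap\partial M|}\in[0,\infty],$$ where $|\cdot|$ denotes length (one-dimensional Hausdorff measure) and $\eta^\partial(\Omega)=\infty$ if $\partial\Omega\cap\partial M$ is empty or has length zero. The $k$-th Escobar constant of $M$ is $$I_k(M)=\inf_{(\Omega_1,\dots,\Omega_k)}\ \max_{1\le j\le k}\eta^\partial(\Omega_j),$$ the infimum being over all $k$-tuples of mutually disjoint members of $\mathcal{A}(M)$. Let $n\ge 3$. A Euclidean $n$-gon is the bounded domain enclosed by a simple closed polygon with $n$ vertices (not necessarily convex). Let $D_n$ be the open regular $n$-gon centred at the origin with vertices on the unit circle, and $\mathbb{D}$ the open unit disk. Then for every Euclidean $n$-gon $M$ and every integer $k\ge n$, $$I_k(M)\le I_k(D_n)\le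 I_k(\mathbb{D}).$$ -/

import Mathlib

open Set MeasureTheory
open scoped ENNReal ContDiff

/-- `Ω` has piecewise smooth boundary: its topological boundary is the union of finitely many
regular `C^∞` arcs, parametrized by `[0,1]`, which meet themselves and each other only at
end points (an arc may be closed up, `γ 0 = γ 1`). -/
def HasPiecewiseSmoothBoundary (Ω : Set ℂ) : Prop :=
  ∃ (m : ℕ) (γ : Fin m → ℝ → ℂ),
    (∀ i, ContDiffOn ℝ ∞ (γ i) (Icc 0 1)) ∧
    (∀ i, ∀ t ∈ Icc (0 : ℝ) 1, derivWithin (γ i) (Icc 0 1) t ≠ 0) ∧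
    (∀ i j, ∀ s ∈ Icc (0 : ℝ) 1, ∀ t ∈ Icc (0 : ℝ) 1, γ i s = γ j t →
      (i = j ∧ s = t) ∨ ((s = 0 ∨ s = 1) ∧ (t = 0 ∨ t = 1))) ∧
    frontier Ω = ⋃ i, γ i '' Icc 0 1

/-- The family `𝒜(M)` of nonempty open subsets of the (open) planar domain `M` with piecewise
smooth boundary. The Euclidean plane is `ℂ`. -/
def escobarSets (M : Set ℂ) : Set (Set ℂ) :=
  {Ω | Ω ⊆ M ∧ Ω.Nonempty ∧ IsOpen Ω ∧ HasPiecewiseSmoothBoundary Ω}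

/-- The interior boundary `Σ° = ∂Ω ∩ M`. -/
def interiorBoundary (M Ω : Set ℂ) : Set ℂ := frontier Ω ∩ M

/-- The exterior boundary `Σ^∂ = ∂Ω ∩ ∂M`. -/
def exteriorBoundary (M Ω : Set ℂ) : Set ℂ := frontier Ω ∩ frontier M

open Classical in
/-- The isoperimetric ratio `η^∂(Ω) = |Σ°| / |Σ^∂|`, with value `∞` if `Σ^∂ = ∅`. Length is
one-dimensional Hausdorff measure. (If `Σ^∂ ≠ ∅` has length zero and `Σ°` has positive length,
the quotient in `[0,∞]` is `∞` as well.) -/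
noncomputable def escobarRatio (M Ω : Set ℂ) : ℝ≥0∞ :=
  if exteriorBoundary M Ω = ∅ then ∞
  else μH[1] (interiorBoundary M Ω) / μH[1] (exteriorBoundary M Ω)

/-- The `k`-th Escobar constant: the infimum, over all `k`-tuples of mutually disjoint members of
`𝒜(M)`, of the largest isoperimetric ratio. -/
noncomputable def escobarConstant (k : ℕ) (M : Set ℂ) : ℝ≥0∞ :=
  ⨅ (Ω : Fin k → Set ℂ) (_ : ∀ j, Ω j ∈ escobarSets M)
    (_ : Pairwise fun i j => Disjoint (Ω i) (Ω j)), ⨆ j, escobarRatio M (Ω j)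

/-- A polygon is simple if its vertices are distinct and two different edges meet at most in
common end points. -/
def IsSimplePolygon {n : ℕ} (P : Polygon ℂ n) : Prop :=
  Function.Injective P.vertices ∧
    ∀ i j, i ≠ j → ∀ z, z ∈ P.edgeSet ℝ i → z ∈ P.edgeSet ℝ j →
      (z = P i ∨ z = P (finRotate n i)) ∧ (z = P j ∨ z = P (finRotate n j))

/-- `M` is a Euclidean `n`-gon: the bounded domain enclosed by a simple closed polygon with `n`
vertices. (A bounded connected open set whose boundary is the polygonal curve is the bounded
component of the complement of that curve.) -/
def IsEuclideanNGon (n : ℕ) (M : Set ℂ) : Prop :=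
  IsOpen M ∧ IsConnected M ∧ Bornology.IsBounded M ∧
    ∃ P : Polygon ℂ n, IsSimplePolygon P ∧ frontier M = P.boundary ℝ

/-- The (open) regular `n`-gon `D_n` centred at the origin with vertices on the unit circle. -/
noncomputable def regularNGon (n : ℕ) : Set ℂ :=
  interior (convexHull ℝ
    (range fun j : Fin n => Complex.exp (2 * (Real.pi : ℂ) * Complex.I * (j : ℂ) / (n : ℂ))))

/-- The open unit disk. -/
def unitDisk : Set ℂ := Metric.ball 0 1

/-! The number `cos (π / n)` separates the constants. Every `n`-gon satisfies `I_k ≤ cos (π / n)`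
for all `k` (`escobarConstant_le_cos`), while `D_n` and the disk satisfy `I_k ≥ cos (π / n)` for `k
≥ n`. As `D_n` is itself an `n`-gon, both inequalities follow.

Upper bound. Every direction has an extremal vertex, so one of the `n` vertices is extremal for a
set of directions of measure at least `2π / n`. If `α` is the angle between the edges there, this
set has measure at most `π - α`, so `α ≤ π - 2π / n`. Near that vertex `M` is a convex sector of
angle `α` (`sector_subset`). Lines orthogonal to the bisector, at distances in geometric progression
with ratio `ε`, cut it into disjoint similar trapezoids, as many as desired, of ratio at most `(1 +
ε) / (1 - ε) * sin (α / 2)`. Let `ε → 0` (`escobarConstant_le_of_sector`).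

Lower bound. Parametrize `∂M` by `[0, n]` with constant speed `L`. Disjoint domains occupy almost
disjoint parameter sets, so for `k ≥ n` one of them, `Ω`, has exterior parameter set `E` of measure
at most one. A calibration bounds its interior boundary: take `f` on the boundary with slope about
`K = L cos (π / n)` on `E` and a constant negative slope off `E` that closes it up. Because `|E| ≤
1`, `f` varies by at most `K` times the circular distance truncated at one. The chord-arc condition
bounds this by the chord, so `f` extends to a 1-Lipschitz function `u` of the plane. As `du`
integrates to zero over `∂Ω`, the interior boundary is at least as long as `∫ du` over the exterior
boundary, which is `K |E|`, and the exterior boundary has length at most `L |E|`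
(`mul_volume_extParam_le`, `ofReal_le_escobarConstant`).

Green's formula for such `Ω` comes from slicing by parallel lines: the fundamental theorem of
calculus on almost every line, and the area formula to return to the arcs. Exterior terms are
evaluated exactly because `M` lies to the left of its tangents; interior terms only need an absolute
bound. -/

open Filter Topology ComplexConjugate

/-! ### Area formula on the line and the length of plane curves -/

/-- A measurable set covered by neighbourhoods is a countable disjoint union of measurable
pieces, each contained in one of the neighbourhoods. -/
lemma exists_measurable_partition {A : Set ℝ} (hA : MeasurableSet A) (V : ℝ → Set ℝ)
    (hV : ∀ x ∈ A, V x ∈ 𝓝 x) :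
    ∃ B : ℕ → Set ℝ, (∀ k, MeasurableSet (B k)) ∧ Pairwise (Function.onFun Disjoint B) ∧
      ⋃ k, B k = A ∧ ∀ k, (B k).Nonempty → ∃ x ∈ A, B k ⊆ V x := by
  rcases A.eq_empty_or_nonempty with rfl | hne
  · exact ⟨fun _ => ∅, by simp, fun i j _ => by simp [Function.onFun], by simp, by simp⟩
  obtain ⟨t, htA, htc, ht⟩ := TopologicalSpace.countable_cover_nhdsWithin
    (f := fun x => interior (V x)) (s := A)
    fun x hx => mem_nhdsWithin_of_mem_nhds (interior_mem_nhds.2 (hV x hx))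
  have htne : t.Nonempty := by
    rcases t.eq_empty_or_nonempty with rfl | h
    · obtain ⟨x, hx⟩ := hne
      simpa using ht hx
    · exact h
  obtain ⟨e, rfl⟩ := htc.exists_eq_range htne
  refine ⟨fun k => A ∩ disjointed (fun k => interior (V (e k))) k, fun k => ?_, ?_, ?_, ?_⟩
  · exact hA.inter (MeasurableSet.disjointed (fun k => isOpen_interior.measurableSet) k)
  · intro i j hij
    exact ((disjoint_disjointed _ hij).mono inter_subset_right inter_subset_right)
  · rw [← inter_iUnion, iUnion_disjointed, inter_eq_left]
    simpa using ht
  · intro k _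
    refine ⟨e k, htA ⟨k, rfl⟩, ?_⟩
    exact inter_subset_right.trans ((disjointed_subset _ _).trans interior_subset)

/-- The sum of `g` over the points of `A` on the level set `{h = y}`. -/
noncomputable def fiberSum (A : Set ℝ) (h : ℝ → ℝ) (g : ℝ → ℝ≥0∞) (y : ℝ) : ℝ≥0∞ :=
  ∑' t : ℝ, (A ∩ h ⁻¹' {y}).indicator g t

lemma fiberSum_iUnion {B : ℕ → Set ℝ} (hB : Pairwise (Function.onFun Disjoint B)) (h : ℝ → ℝ)
    (g : ℝ → ℝ≥0∞) (y : ℝ) : fiberSum (⋃ k, B k) h g y = ∑' k, fiberSum (B k) h g y := by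
  unfold fiberSum
  rw [ENNReal.tsum_comm]
  congr 1 with t
  rw [iUnion_inter]
  by_cases ht : t ∈ ⋃ k, B k ∩ h ⁻¹' {y}
  · rw [indicator_of_mem ht]
    obtain ⟨k, hk⟩ := mem_iUnion.1 ht
    rw [tsum_eq_single k, indicator_of_mem hk]
    intro j hj
    refine indicator_of_notMem ?_ _
    intro hjt
    exact (hB hj).le_bot ⟨hjt.1, hk.1⟩
  · rw [indicator_of_notMem ht]
    symm
    rw [ENNReal.tsum_eq_zero]
    intro k
    exact indicator_of_notMem (fun hk => ht (mem_iUnion.2 ⟨k, hk⟩)) _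

/-- Each level set meets `B` in at most one point, so the fibre sum is `g` transported to the image
`h '' B`, and the integral is a change of variables. -/
lemma fiberSum_of_injOn {B : Set ℝ} (hB : MeasurableSet B) {h h' : ℝ → ℝ}
    (hd : ∀ t ∈ B, HasDerivAt h (h' t) t) (hinj : InjOn h B) {g : ℝ → ℝ≥0∞} (hg : Measurable g) :
    Measurable (fiberSum B h g) ∧
      ∫⁻ y, fiberSum B h g y = ∫⁻ t in B, ENNReal.ofReal |h' t| * g t := by
  have hc : ContinuousOn h B := fun t ht => (hd t ht).continuousAt.continuousWithinAt
  have hme := hc.measurableEmbedding hB hinj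
  set G : ℝ → ℝ≥0∞ := Function.extend (B.domRestrict h) (fun t : B => g t) 0 with hG
  have hGm : Measurable G := hme.measurable_extend (hg.comp measurable_subtype_coe) measurable_const
  have hGB : ∀ t ∈ B, G (h t) = g t := fun t ht =>
    hme.injective.extend_apply (fun t : B => g t) 0 ⟨t, ht⟩
  have key : fiberSum B h g = (h '' B).indicator G := by
    ext y
    by_cases hy : y ∈ h '' B
    · rw [indicator_of_mem hy]
      obtain ⟨t, ht, rfl⟩ := hy
      rw [hGB t ht, fiberSum, tsum_eq_single t,
        indicator_of_mem (show t ∈ B ∩ h ⁻¹' {h t} from ⟨ht, rfl⟩)]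
      intro s hs
      exact indicator_of_notMem (fun hs' => hs (hinj hs'.1 ht hs'.2)) _
    · rw [indicator_of_notMem hy, fiberSum, ENNReal.tsum_eq_zero]
      intro t
      exact indicator_of_notMem (fun ht => hy ⟨t, ht.1, ht.2⟩) _
  have him : MeasurableSet (h '' B) := hB.image_of_continuousOn_injOn hc hinj
  refine ⟨key ▸ hGm.indicator him, ?_⟩
  rw [key, lintegral_indicator him,
    lintegral_image_eq_lintegral_abs_deriv_mul hB (fun t ht => (hd t ht).hasDerivWithinAt) hinj]
  exact setLIntegral_congr_fun hB fun t ht => by simp only [hGB t ht]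

/-- The image of the critical set of a differentiable function is a null set. -/
lemma volume_image_critical {A : Set ℝ} {h h' : ℝ → ℝ} (hd : ∀ t ∈ A, HasDerivAt h (h' t) t)
    (h0 : ∀ t ∈ A, h' t = 0) : volume (h '' A) = 0 := by
  refine addHaar_image_eq_zero_of_det_fderivWithin_eq_zero (f' := fun t =>
    ContinuousLinearMap.toSpanSingleton ℝ (h' t)) volume
    (fun t ht => (hd t ht).hasFDerivAt.hasFDerivWithinAt) ?_
  intro t ht
  rw [h0 t ht]
  simp

/-- **Area formula** for `C¹` functions of one variable. -/
theorem lintegral_fiberSum {A U : Set ℝ} (hA : MeasurableSet A) (hU : IsOpen U) (hAU : A ⊆ U)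
    {h h' : ℝ → ℝ} (hd : ∀ t ∈ U, HasDerivAt h (h' t) t) (hc : ContinuousOn h' U)
    {g : ℝ → ℝ≥0∞} (hg : Measurable g) :
    AEMeasurable (fiberSum A h g) ∧
      ∫⁻ y, fiberSum A h g y = ∫⁻ t in A, ENNReal.ofReal |h' t| * g t := by
  -- On `A₁` the derivative does not vanish and `h` is locally injective by the inverse function
  -- theorem. The critical remainder has null image on the left and weight `|h'| = 0` on the right.
  have hW : IsOpen (U ∩ h' ⁻¹' {0}ᶜ) := hc.isOpen_inter_preimage hU isOpen_compl_singleton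
  set A₁ := A ∩ (U ∩ h' ⁻¹' {0}ᶜ) with hA₁
  have hA₁m : MeasurableSet A₁ := hA.inter hW.measurableSet
  have hdiff : A \ A₁ ⊆ {t | t ∈ U ∧ h' t = 0} := fun t ht =>
    ⟨hAU ht.1, by_contra fun h0 => ht.2 ⟨ht.1, hAU ht.1, h0⟩⟩
  have hnull : volume (h '' (A \ A₁)) = 0 :=
    volume_image_critical (fun t ht => hd t (hAU ht.1)) fun t ht => (hdiff ht).2
  have hloc : ∀ x ∈ A₁, ∃ V ∈ 𝓝 x, InjOn h V := by
    intro x hx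
    have hst : HasStrictDerivAt h (h' x) x :=
      hasStrictDerivAt_of_hasDerivAt_of_continuousAt
        (by filter_upwards [hU.mem_nhds hx.2.1] with t ht using hd t ht)
        (hc.continuousAt (hU.mem_nhds hx.2.1))
    have hne : h' x ≠ 0 := hx.2.2
    have h1 := hst.hasStrictFDerivAt_equiv hne
    exact ⟨_, HasStrictFDerivAt.eventually_left_inverse h1, fun a ha b hb hab => by
      rw [← show _ = a from ha, ← show _ = b from hb, hab]⟩
  choose! V hV hVinj using hloc
  obtain ⟨B, hBm, hBd, hBU, hBV⟩ := exists_measurable_partition hA₁m V hV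
  have hBA : ∀ k, B k ⊆ A₁ := fun k => hBU ▸ subset_iUnion B k
  have hBinj : ∀ k, InjOn h (B k) := by
    intro k
    rcases (B k).eq_empty_or_nonempty with h0 | h0
    · rw [h0]; exact injOn_empty h
    · obtain ⟨x, hx, hxV⟩ := hBV k h0
      exact (hVinj x hx).mono hxV
  have hk := fun k => fiberSum_of_injOn (hBm k) (fun t ht => hd t ((hBA k ht).2.1)) (hBinj k) hg
  have hae : fiberSum A h g =ᵐ[volume] fun y => ∑' k, fiberSum (B k) h g y := by
    have : ∀ᵐ y, y ∉ h '' (A \ A₁) := measure_eq_zero_iff_ae_notMem.1 hnull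
    filter_upwards [this] with y hy
    rw [← fiberSum_iUnion hBd, hBU]
    unfold fiberSum
    congr 1 with t
    have : t ∈ A ∩ h ⁻¹' {y} ↔ t ∈ A₁ ∩ h ⁻¹' {y} := by
      refine ⟨fun ht => ⟨by_contra fun h1 => hy ⟨t, ⟨ht.1, h1⟩, ht.2⟩, ht.2⟩,
        fun ht => ⟨ht.1.1, ht.2⟩⟩
    classical
    simp only [indicator_apply, this]
  refine ⟨⟨_, Measurable.tsum fun k => (hk k).1, hae⟩, ?_⟩
  rw [lintegral_congr_ae hae, lintegral_tsum fun k => (hk k).1.aemeasurable]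
  simp_rw [(hk _).2]
  rw [← lintegral_iUnion hBm hBd, hBU, ← lintegral_inter_add_sdiff _ A hA₁m]
  have h1 : A ∩ A₁ = A₁ := inter_eq_right.2 inter_subset_left
  rw [h1]
  have h2 : ∫⁻ t in A \ A₁, ENNReal.ofReal |h' t| * g t = 0 := by
    rw [setLIntegral_congr_fun (g := fun _ => 0) (hA.diff hA₁m) fun t ht => by simp [(hdiff ht).2]]
    simp
  rw [h2, add_zero]

lemma fiberSum_eq_sum {A : Set ℝ} {h : ℝ → ℝ} {y : ℝ} {S : Finset ℝ}
    (hS : (S : Set ℝ) = A ∩ h ⁻¹' {y}) (g : ℝ → ℝ≥0∞) : fiberSum A h g y = ∑ t ∈ S, g t := by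
  rw [fiberSum, ← hS, tsum_eq_sum (s := S)]
  · exact Finset.sum_congr rfl fun t ht => indicator_of_mem (Finset.mem_coe.2 ht) _
  · intro t ht
    exact indicator_of_notMem (by simpa using ht) _

/-- Almost every level set of a `C¹` function with integrable derivative is finite. -/
lemma ae_finite_fiber {A U : Set ℝ} (hA : MeasurableSet A) (hU : IsOpen U) (hAU : A ⊆ U)
    {h h' : ℝ → ℝ} (hd : ∀ t ∈ U, HasDerivAt h (h' t) t) (hc : ContinuousOn h' U)
    (hfin : ∫⁻ t in A, ENNReal.ofReal |h' t| ≠ ⊤) : ∀ᵐ y, (A ∩ h ⁻¹' {y}).Finite := by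
  -- With `g = 1` the fibre sum counts the points of the level set; a finite integral makes it
  -- finite almost everywhere.
  have h1 := lintegral_fiberSum hA hU hAU hd hc (g := fun _ => 1) measurable_const
  have h2 := ae_lt_top' h1.1 (by simpa [h1.2] using hfin)
  filter_upwards [h2] with y hy
  refine (ENNReal.finite_const_le_of_tsum_ne_top hy.ne one_ne_zero).subset fun t ht => ?_
  simp [indicator_of_mem ht]

/-- Signed area formula. -/
theorem integral_fiberSum_sub {A U : Set ℝ} (hA : MeasurableSet A) (hU : IsOpen U) (hAU : A ⊆ U)
    {h h' : ℝ → ℝ} (hd : ∀ t ∈ U, HasDerivAt h (h' t) t) (hc : ContinuousOn h' U)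
    {k : ℝ → ℝ} (hk : Measurable k) (hint : IntegrableOn (fun t => |h' t| * k t) A) :
    Integrable (fun y => (fiberSum A h (fun t => ENNReal.ofReal (k t)) y).toReal -
        (fiberSum A h (fun t => ENNReal.ofReal (-k t)) y).toReal) ∧
      ∫ y, ((fiberSum A h (fun t => ENNReal.ofReal (k t)) y).toReal -
        (fiberSum A h (fun t => ENNReal.ofReal (-k t)) y).toReal) = ∫ t in A, |h' t| * k t := by
  -- `ENNReal.ofReal` truncates at zero, so the two densities are the positive and negative parts of
  -- `k`.
  have h1 := lintegral_fiberSum hA hU hAU hd hc (g := fun t => ENNReal.ofReal (k t))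
    hk.ennreal_ofReal
  have h2 := lintegral_fiberSum hA hU hAU hd hc (g := fun t => ENNReal.ofReal (-k t))
    hk.neg.ennreal_ofReal
  simp_rw [← ENNReal.ofReal_mul (abs_nonneg _)] at h1 h2
  have f1 : ∫⁻ t in A, ENNReal.ofReal (|h' t| * k t) ≠ ⊤ := hint.lintegral_lt_top.ne
  have f2 : ∫⁻ t in A, ENNReal.ofReal (|h' t| * -k t) ≠ ⊤ := by
    have := hint.neg.lintegral_lt_top.ne
    simpa [mul_neg] using this
  have i1 := integrable_toReal_of_lintegral_ne_top h1.1 (h1.2 ▸ f1)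
  have i2 := integrable_toReal_of_lintegral_ne_top h2.1 (h2.2 ▸ f2)
  refine ⟨i1.sub i2, ?_⟩
  rw [integral_sub i1 i2, integral_toReal h1.1 (ae_lt_top' h1.1 (h1.2 ▸ f1)),
    integral_toReal h2.1 (ae_lt_top' h2.1 (h2.2 ▸ f2)), h1.2, h2.2,
    integral_eq_lintegral_pos_part_sub_lintegral_neg_part hint]
  simp_rw [mul_neg]

/-- The length of an injective `C¹` curve is at most the Hausdorff measure of its image. -/
theorem lintegral_norm_deriv_le_hausdorff {A U : Set ℝ} (hA : MeasurableSet A) (hU : IsOpen U)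
    (hAU : A ⊆ U) (hfin : volume A ≠ ⊤) {γ γ' : ℝ → ℂ} (hd : ∀ t ∈ U, HasDerivAt γ (γ' t) t)
    (hc : ContinuousOn γ' U) (hinj : InjOn γ A) :
    ∫⁻ t in A, ‖γ' t‖ₑ ≤ μH[1] (γ '' A) := by
  have hcont : ContinuousOn γ U := fun t ht => (hd t ht).continuousAt.continuousWithinAt
  -- Cut `A` into pieces on which `γ'` is within `ε` of its value at some `x`. If `‖γ' x‖ > ε`, then
  -- `γ` is expanding there by at least `‖γ' x‖ - ε`; otherwise the piece has length at most `2ε`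
  -- times its measure. Either way the error is `2ε` per unit of parameter.
  have main : ∀ ε : ℝ, 0 < ε → ∫⁻ t in A, ‖γ' t‖ₑ ≤ μH[1] (γ '' A) + ENNReal.ofReal (2 * ε) *
      volume A := by
    intro ε hε
    have hloc : ∀ x ∈ A, ∃ r > 0, Metric.ball x r ⊆ U ∧ ∀ t ∈ Metric.ball x r,
        ‖γ' t - γ' x‖ ≤ ε := by
      intro x hx
      have h1 := hU.mem_nhds (hAU hx)
      have h2 : ∀ᶠ t in 𝓝 x, dist (γ' t) (γ' x) < ε :=
        (hc.continuousAt h1) (Metric.ball_mem_nhds _ hε)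
      obtain ⟨r, hr, hball⟩ := Metric.eventually_nhds_iff_ball.1 (h2.and h1)
      exact ⟨r, hr, fun t ht => (hball t ht).2, fun t ht => by
        simpa [dist_eq_norm] using (hball t ht).1.le⟩
    choose! r hr hrU hrε using hloc
    obtain ⟨B, hBm, hBd, hBA, hBV⟩ := exists_measurable_partition hA
      (fun x => Metric.ball x (r x)) fun x hx => Metric.ball_mem_nhds _ (hr x hx)
    have hBA' : ∀ k, B k ⊆ A := fun k => hBA ▸ subset_iUnion B k
    have hpiece : ∀ k, ∫⁻ t in B k, ‖γ' t‖ₑ ≤ μH[1] (γ '' B k) + ENNReal.ofReal (2 * ε) *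
        volume (B k) := by
      intro k
      rcases (B k).eq_empty_or_nonempty with h0 | h0
      · simp [h0]
      obtain ⟨x, hx, hxV⟩ := hBV k h0
      have hup : ∫⁻ t in B k, ‖γ' t‖ₑ ≤ ENNReal.ofReal (‖γ' x‖ + ε) * volume (B k) := by
        rw [← setLIntegral_const]
        refine setLIntegral_mono measurable_const fun t ht => ?_
        rw [← ofReal_norm]
        refine ENNReal.ofReal_le_ofReal ?_
        have := hrε x hx t (hxV ht)
        have h2 := norm_le_norm_add_norm_sub (γ' x) (γ' t)
        rw [norm_sub_rev] at h2
        linarith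
      rcases le_or_gt ‖γ' x‖ ε with hsmall | hbig
      · refine hup.trans (le_add_left ?_)
        gcongr
        linarith
      have hlow : ENNReal.ofReal (‖γ' x‖ - ε) * volume (B k) ≤ μH[1] (γ '' B k) := by
        have hpos : 0 < ‖γ' x‖ - ε := by linarith
        have hanti : AntilipschitzWith (Real.toNNReal (‖γ' x‖ - ε))⁻¹ ((B k).domRestrict γ) := by
          refine AntilipschitzWith.of_le_mul_dist fun s t => ?_
          -- Mean value inequality for `γ` minus its linear part at `x`, whose derivative is at most
          -- `ε`.
          have hcv := (convex_ball x (r x)).norm_image_sub_le_of_norm_hasDerivWithin_le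
            (f := fun s => γ s - (s : ℂ) * γ' x) (f' := fun s => γ' s - γ' x) (C := ε)
            (fun s hs => ?_) (fun s hs => hrε x hx s hs) (hxV t.2) (hxV s.2)
          · simp only [NNReal.coe_inv, Real.coe_toNNReal _ hpos.le, domRestrict_apply]
            rw [inv_mul_eq_div, le_div_iff₀ hpos, dist_eq_norm (γ s) (γ t),
              show dist s t = ‖(s : ℝ) - (t : ℝ)‖ from rfl]
            have h3 : ‖((s : ℝ) - (t : ℝ) : ℝ)‖ * ‖γ' x‖ ≤ ‖γ s - γ t‖ + ε * ‖(s : ℝ) - (t : ℝ)‖ := by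
              have h4 : ((((s : ℝ) - (t : ℝ) : ℝ) : ℂ)) * γ' x = (γ s - γ t) -
                  ((γ s - (s : ℝ) * γ' x) - (γ t - (t : ℝ) * γ' x)) := by
                push_cast; ring
              have h5 : ‖((s : ℝ) - (t : ℝ) : ℝ)‖ = ‖((((s : ℝ) - (t : ℝ) : ℝ) : ℂ))‖ :=
              (Complex.norm_real _).symm
              rw [h5, ← norm_mul, h4]
              refine (norm_sub_le _ _).trans ?_
              rw [← h5]
              gcongr
            nlinarith
          · have h7 := (hd s (hrU x hx hs)).sub (((hasDerivAt_id s).ofReal_comp).mul_const (γ' x))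
            rw [Complex.ofReal_one, one_mul] at h7
            exact h7.hasDerivWithinAt
        have h8 := hanti.le_hausdorffMeasure_image zero_le_one univ
        rw [image_univ, range_domRestrict, ENNReal.rpow_one] at h8
        have h9 : μH[1] (univ : Set (B k)) = volume (B k) := by
          have := (isometry_subtype_coe (s := B k)).hausdorffMeasure_image (d := 1)
            (Or.inl zero_le_one) univ
          rw [← this, image_univ, Subtype.range_coe, hausdorffMeasure_real]
        rw [h9] at h8
        calc _ ≤ ENNReal.ofReal (‖γ' x‖ - ε) * (((Real.toNNReal (‖γ' x‖ - ε))⁻¹ : NNReal) *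
                μH[1] (γ '' B k)) := by gcongr
          _ = μH[1] (γ '' B k) := by
            rw [← mul_assoc, ENNReal.ofReal, ← ENNReal.coe_mul, mul_inv_cancel₀, ENNReal.coe_one,
              one_mul]
            simpa using hpos
      calc _ ≤ _ := hup
        _ = ENNReal.ofReal (‖γ' x‖ - ε) * volume (B k) + ENNReal.ofReal (2 * ε) *
            volume (B k) := by
          rw [← add_mul, ← ENNReal.ofReal_add (by linarith) (by linarith)]
          congr 2; ring
        _ ≤ _ := by gcongr
    have him : γ '' A = ⋃ k, γ '' B k := by rw [← image_iUnion, hBA]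
    have hBc : ∀ k, ContinuousOn γ (B k) := fun k => hcont.mono ((hBA' k).trans hAU)
    calc ∫⁻ t in A, ‖γ' t‖ₑ = ∑' k, ∫⁻ t in B k, ‖γ' t‖ₑ := by
          rw [← lintegral_iUnion hBm hBd, hBA]
      _ ≤ ∑' k, (μH[1] (γ '' B k) + ENNReal.ofReal (2 * ε) * volume (B k)) :=
          ENNReal.tsum_le_tsum hpiece
      _ = _ := by
        rw [ENNReal.tsum_add, ENNReal.tsum_mul_left, ← measure_iUnion hBd hBm, hBA, him,
          measure_iUnion]
        · intro i j hij
          exact (hBd hij).image hinj (hBA' i) (hBA' j)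
        · intro k
          exact (hBm k).image_of_continuousOn_injOn (hBc k) (hinj.mono (hBA' k))
  refine le_of_tendsto_of_tendsto (b := 𝓝[>] (0:ℝ)) tendsto_const_nhds (g := fun ε => μH[1] (γ '' A) +
    ENNReal.ofReal (2 * ε) * volume A) ?_ (by filter_upwards [self_mem_nhdsWithin] with ε hε using main ε hε)
  have h1 : Tendsto (fun ε : ℝ => ENNReal.ofReal (2 * ε)) (𝓝[>] 0) (𝓝 0) := by
    have : Tendsto (fun ε : ℝ => ENNReal.ofReal (2 * ε)) (𝓝 0) (𝓝 (ENNReal.ofReal (2 * 0))) :=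
      (ENNReal.continuous_ofReal.comp (continuous_const.mul continuous_id)).tendsto 0
    simpa using this.mono_left nhdsWithin_le_nhds
  have h2 := ENNReal.Tendsto.mul_const h1 (Or.inr hfin) (b := volume A)
  simpa using h2.const_add (μH[1] (γ '' A))

/-! ### Arc systems and the two sides of an arc -/

/-- The linear isomorphism `(a, b) ↦ a d₁ + b d₂` for `ℝ`-independent `d₁, d₂`. -/
noncomputable def coordEquiv (d₁ d₂ : ℂ) (h : (conj d₁ * d₂).im ≠ 0) : (ℝ × ℝ) ≃L[ℝ] ℂ :=
  (LinearEquiv.ofBijective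
    ((LinearMap.fst ℝ ℝ ℝ).smulRight d₁ + (LinearMap.snd ℝ ℝ ℝ).smulRight d₂) (by
      have hinj : Function.Injective
          ((LinearMap.fst ℝ ℝ ℝ).smulRight d₁ + (LinearMap.snd ℝ ℝ ℝ).smulRight d₂) := by
        rw [← LinearMap.ker_eq_bot, LinearMap.ker_eq_bot']
        rintro ⟨a, b⟩ hab
        have hab' : a * d₁ + b * d₂ = 0 := by simpa using hab
        -- `(conj d * z).im` is the determinant of `d` and `z`: pairing with `d₁` eliminates `a`,
        -- pairing with `d₂` eliminates `b`.
        have h1 : b * (conj d₁ * d₂).im = 0 := by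
          have := congrArg (fun z => (conj d₁ * z).im) hab'
          simp only [Complex.mul_im, Complex.add_re, Complex.add_im, Complex.conj_re,
            Complex.conj_im, Complex.mul_re, Complex.ofReal_re, Complex.ofReal_im,
            Complex.zero_re, Complex.zero_im] at this ⊢
          linarith
        have h2 : a * (conj d₁ * d₂).im = 0 := by
          have := congrArg (fun z => (conj d₂ * z).im) hab'
          simp only [Complex.mul_im, Complex.add_re, Complex.add_im, Complex.conj_re,
            Complex.conj_im, Complex.mul_re, Complex.ofReal_re, Complex.ofReal_im,
            Complex.zero_re, Complex.zero_im] at this ⊢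
          linarith
        rw [Prod.mk_eq_zero]
        exact ⟨(mul_eq_zero.1 h2).resolve_right h, (mul_eq_zero.1 h1).resolve_right h⟩
      refine ⟨hinj, (LinearMap.injective_iff_surjective_of_finrank_eq_finrank ?_).1 hinj⟩
      simp [Complex.finrank_real_complex])).toContinuousLinearEquiv

lemma coordEquiv_apply {d₁ d₂ : ℂ} (h : (conj d₁ * d₂).im ≠ 0) (q : ℝ × ℝ) :
    coordEquiv d₁ d₂ h q = q.1 * d₁ + q.2 * d₂ := by
  change ((LinearMap.fst ℝ ℝ ℝ).smulRight d₁ + (LinearMap.snd ℝ ℝ ℝ).smulRight d₂) q = _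
  simp

/-- Away from its boundary the space splits into the disjoint open sets `Ω` and `(closure Ω)ᶜ`. This
is the basic tool below for sides of arcs, slices, rays and corners. -/
lemma IsPreconnected.subset_or_disjoint_of_frontier {X : Type*} [TopologicalSpace X]
    {S Ω : Set X} (hS : IsPreconnected S) (hΩ : IsOpen Ω) (h : ∀ x ∈ S, x ∉ frontier Ω) :
    S ⊆ Ω ∨ Disjoint S Ω := by
  have hsub : S ⊆ Ω ∪ (closure Ω)ᶜ := fun x hx => by
    by_cases hxc : x ∈ closure Ω
    · exact Or.inl (by_contra fun hxo => h x hx (hΩ.frontier_eq ▸ ⟨hxc, hxo⟩))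
    · exact Or.inr hxc
  rcases hS.subset_or_subset hΩ isClosed_closure.isOpen_compl
    (disjoint_compl_right.mono_left subset_closure) hsub with h1 | h1
  · exact Or.inl h1
  · exact Or.inr (disjoint_compl_left.mono h1 subset_closure)

/-- A finite family of regular smooth arcs, meeting only at end points, whose union is the
boundary of `Ω`. -/
structure IsArcSystem (Ω : Set ℂ) {m : ℕ} (γ : Fin m → ℝ → ℂ) : Prop where
  smooth : ∀ i, ContDiffOn ℝ ∞ (γ i) (Icc 0 1)
  regular : ∀ i, ∀ t ∈ Icc (0 : ℝ) 1, derivWithin (γ i) (Icc 0 1) t ≠ 0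
  meet : ∀ i j, ∀ s ∈ Icc (0 : ℝ) 1, ∀ t ∈ Icc (0 : ℝ) 1, γ i s = γ j t →
      (i = j ∧ s = t) ∨ ((s = 0 ∨ s = 1) ∧ (t = 0 ∨ t = 1))
  frontier_eq : frontier Ω = ⋃ i, γ i '' Icc 0 1

namespace IsArcSystem

variable {Ω : Set ℂ} {m : ℕ} {γ : Fin m → ℝ → ℂ}

lemma contDiffAt (h : IsArcSystem Ω γ) (i : Fin m) {t : ℝ} (ht : t ∈ Ioo (0 : ℝ) 1) :
    ContDiffAt ℝ ∞ (γ i) t :=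
  (h.smooth i).contDiffAt (Icc_mem_nhds ht.1 ht.2)

lemma hasDerivAt (h : IsArcSystem Ω γ) (i : Fin m) {t : ℝ} (ht : t ∈ Ioo (0 : ℝ) 1) :
    HasDerivAt (γ i) (deriv (γ i) t) t :=
  ((h.contDiffAt i ht).differentiableAt (by simp)).hasDerivAt

lemma deriv_ne_zero (h : IsArcSystem Ω γ) (i : Fin m) {t : ℝ} (ht : t ∈ Ioo (0 : ℝ) 1) :
    deriv (γ i) t ≠ 0 := by
  have := h.regular i t (Ioo_subset_Icc_self ht)
  rwa [derivWithin_of_mem_nhds (Icc_mem_nhds ht.1 ht.2)] at this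

lemma continuousOn_deriv (h : IsArcSystem Ω γ) (i : Fin m) :
    ContinuousOn (deriv (γ i)) (Ioo 0 1) :=
  ((h.smooth i).mono Ioo_subset_Icc_self).continuousOn_deriv_of_isOpen isOpen_Ioo (by simp)

lemma mem_frontier (h : IsArcSystem Ω γ) (i : Fin m) {t : ℝ} (ht : t ∈ Icc (0 : ℝ) 1) :
    γ i t ∈ frontier Ω := by
  rw [h.frontier_eq]
  exact mem_iUnion.2 ⟨i, t, ht, rfl⟩

lemma eq_of_interior (h : IsArcSystem Ω γ) {i j : Fin m} {s t : ℝ} (hs : s ∈ Ioo (0 : ℝ) 1)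
    (ht : t ∈ Icc (0 : ℝ) 1) (hst : γ i s = γ j t) : i = j ∧ s = t := by
  rcases h.meet i j s (Ioo_subset_Icc_self hs) t ht hst with h1 | ⟨h1 | h1, -⟩
  · exact h1
  · exact absurd h1 hs.1.ne'
  · exact absurd h1 hs.2.ne

/-- The set of all end points of the arcs. -/
def endpoints (γ : Fin m → ℝ → ℂ) : Set ℂ := ⋃ i, {γ i 0, γ i 1}

lemma finite_endpoints (γ : Fin m → ℝ → ℂ) : (endpoints γ).Finite :=
  finite_iUnion fun _ => (finite_singleton _).insert _

lemma exists_interior (h : IsArcSystem Ω γ) {z : ℂ} (hz : z ∈ frontier Ω)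
    (hz' : z ∉ endpoints γ) : ∃ i, ∃ t ∈ Ioo (0 : ℝ) 1, γ i t = z := by
  rw [h.frontier_eq] at hz
  obtain ⟨i, t, ht, rfl⟩ := mem_iUnion.1 hz
  refine ⟨i, t, ⟨ht.1.lt_of_ne ?_, ht.2.lt_of_ne ?_⟩, rfl⟩ <;> rintro rfl <;>
    exact hz' (mem_iUnion.2 ⟨i, by simp⟩)

/-- Next to an interior point of an arc, at least one of the two sides belongs to `Ω`. -/
theorem side (h : IsArcSystem Ω γ) (hΩ : IsOpen Ω) {i : Fin m} {t₀ : ℝ}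
    (ht₀ : t₀ ∈ Ioo (0 : ℝ) 1) {w : ℂ} (hw : (conj (deriv (γ i) t₀) * w).im ≠ 0) :
    (∀ᶠ η : ℝ in 𝓝[>] 0, γ i t₀ + η * w ∈ Ω) ∨ (∀ᶠ η : ℝ in 𝓝[>] 0, γ i t₀ - η * w ∈ Ω) := by
  -- Straighten the arc: since `w` is transversal, `Ψ` is a local diffeomorphism at `(t₀, 0)` which
  -- carries the axis `q.2 = 0` to the arc.
  set Ψ : ℝ × ℝ → ℂ := fun q => γ i q.1 + q.2 * w with hΨ
  have hst : HasStrictFDerivAt Ψ (coordEquiv _ _ hw : ℝ × ℝ →L[ℝ] ℂ) (t₀, 0) := by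
    have h1 : HasStrictDerivAt (γ i) (deriv (γ i) t₀) t₀ :=
      (h.contDiffAt i ht₀).hasStrictDerivAt (by simp)
    have h2 : HasStrictFDerivAt (fun q : ℝ × ℝ => γ i q.1) _ (t₀, 0) :=
      HasStrictFDerivAt.comp (g := γ i) (f := Prod.fst) ((t₀, 0) : ℝ × ℝ)
        h1.hasStrictFDerivAt hasStrictFDerivAt_fst
    have h3 : HasStrictFDerivAt (fun q : ℝ × ℝ => q.2 • w) _ (t₀, 0) :=
      (hasStrictFDerivAt_snd (𝕜 := ℝ) (p := ((t₀, 0) : ℝ × ℝ))).smul_const w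
    have h4 := h2.add h3
    have h5 : Ψ = (fun q : ℝ × ℝ => γ i q.1) + (fun q : ℝ × ℝ => q.2 • w) := by
      ext q; simp [hΨ]
    rw [h5]
    refine h4.congr_fderiv ?_
    ext <;> simp [coordEquiv_apply]
  have hmap := hst.map_nhds_eq_of_equiv
  obtain ⟨δ, hδ, hδV⟩ := Metric.eventually_nhds_iff_ball.1
    (HasStrictFDerivAt.eventually_left_inverse hst)
  have hinj : InjOn Ψ (Metric.ball (t₀, 0) δ) := fun a ha b hb hab => by
    rw [← hδV a ha, ← hδV b hb, hab]
  -- `C` is the rest of `∂Ω`: the other arcs and the distant part of this one. It is closed and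
  -- misses `γ i t₀` because arcs meet only at end points, so in a small box `∂Ω` is just the image
  -- of the axis.
  set C : Set ℂ := (⋃ j ∈ ({i}ᶜ : Set (Fin m)), γ j '' Icc 0 1) ∪
    γ i '' (Icc 0 1 \ Metric.ball t₀ δ) with hC
  have hCc : IsClosed C := by
    refine IsClosed.union ?_ ?_
    · exact (toFinite _).isClosed_biUnion fun j _ =>
        (isCompact_Icc.image_of_continuousOn (h.smooth j).continuousOn).isClosed
    · exact ((isCompact_Icc.diff Metric.isOpen_ball).image_of_continuousOn
        ((h.smooth i).continuousOn.mono sdiff_subset)).isClosed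
  have hz₀ : γ i t₀ ∉ C := by
    rintro (h1 | ⟨t, ht, h1⟩)
    · simp only [mem_iUnion] at h1
      obtain ⟨j, hj, t, ht, h1⟩ := h1
      exact hj (h.eq_of_interior ht₀ ht h1.symm).1.symm
    · have := (h.eq_of_interior ht₀ ht.1 h1.symm).2
      subst this
      exact ht.2 (Metric.mem_ball_self hδ)
  have hΨ0 : Ψ (t₀, 0) = γ i t₀ := by simp [hΨ]
  have hev : ∀ᶠ q in 𝓝 ((t₀, 0) : ℝ × ℝ), q.1 ∈ Ioo (0 : ℝ) 1 ∧ Ψ q ∈ Cᶜ := by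
    refine (continuous_fst.continuousAt.eventually (isOpen_Ioo.mem_nhds ht₀)).and
      (hst.continuousAt.eventually ?_)
    rw [hΨ0]
    exact hCc.isOpen_compl.mem_nhds hz₀
  obtain ⟨ρ, hρ, hρV⟩ := Metric.eventually_nhds_iff_ball.1
    (hev.and (Metric.ball_mem_nhds ((t₀, 0) : ℝ × ℝ) hδ))
  set Q := Metric.ball ((t₀, 0) : ℝ × ℝ) ρ with hQ
  have hcont : ContinuousOn Ψ Q := by
    intro q hq
    have h1 := (h.hasDerivAt i (hρV q hq).1.1).continuousAt
    have : ContinuousAt Ψ q := by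
      have h2 : ContinuousAt (fun q : ℝ × ℝ => γ i q.1) q :=
        ContinuousAt.comp (f := Prod.fst) h1 continuous_fst.continuousAt
      exact h2.add (by fun_prop)
    exact this.continuousWithinAt
  have hoff : ∀ q ∈ Q, q.2 ≠ 0 → Ψ q ∉ frontier Ω := by
    intro q hq hq0 hmem
    rw [h.frontier_eq] at hmem
    obtain ⟨j, t, ht, hjt⟩ := mem_iUnion.1 hmem
    have hqC := (hρV q hq).1.2
    by_cases hji : j = i
    · subst hji
      by_cases htb : t ∈ Metric.ball t₀ δ
      · have h1 : ((t, 0) : ℝ × ℝ) ∈ Metric.ball ((t₀, 0) : ℝ × ℝ) δ := by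
          rw [Metric.mem_ball, Prod.dist_eq]
          simpa [hδ] using htb
        have h2 : Ψ (t, 0) = Ψ q := by rw [← hjt]; simp [hΨ]
        have := hinj h1 (hρV q hq).2 h2
        exact hq0 (by rw [← this])
      · exact hqC (Or.inr ⟨t, ⟨ht, htb⟩, hjt⟩)
    · exact hqC (Or.inl (mem_biUnion (show j ∈ ({i}ᶜ : Set (Fin m)) from hji) ⟨t, ht, hjt⟩))
  have hconv : Convex ℝ Q := convex_ball _ _
  have hdich : ∀ S : Set (ℝ × ℝ), Convex ℝ S → S ⊆ Q → (∀ q ∈ S, q.2 ≠ 0) →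
      Ψ '' S ⊆ Ω ∨ Disjoint (Ψ '' S) Ω := by
    intro S hS hSQ hS0
    have hpre : IsPreconnected (Ψ '' S) := hS.isPreconnected.image _ (hcont.mono hSQ)
    refine hpre.subset_or_disjoint_of_frontier hΩ ?_
    rintro _ ⟨q, hq, rfl⟩
    exact hoff q (hSQ hq) (hS0 q hq)
  have hP : Convex ℝ (Q ∩ {q | 0 < q.2}) :=
    hconv.inter (convex_halfSpace_gt (IsLinearMap.mk (fun _ _ => rfl) fun _ _ => rfl) 0)
  have hN : Convex ℝ (Q ∩ {q | q.2 < 0}) :=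
    hconv.inter (convex_halfSpace_lt (IsLinearMap.mk (fun _ _ => rfl) fun _ _ => rfl) 0)
  have hline : ∀ η : ℝ, |η| < ρ → ((t₀, η) : ℝ × ℝ) ∈ Q := by
    intro η hη
    rw [hQ, Metric.mem_ball, Prod.dist_eq]
    simpa [hρ] using hη
  have hsmall : ∀ᶠ η : ℝ in 𝓝[>] 0, 0 < η ∧ η < ρ := by
    filter_upwards [Ioo_mem_nhdsGT hρ] with η hη using hη
  rcases hdich _ hP inter_subset_left (fun q hq => ne_of_gt hq.2) with h1 | h1
  · left
    filter_upwards [hsmall] with η hη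
    exact h1 ⟨(t₀, η), ⟨hline η (by rw [abs_of_pos hη.1]; exact hη.2), hη.1⟩, rfl⟩
  rcases hdich _ hN inter_subset_left (fun q hq => ne_of_lt hq.2) with h2 | h2
  · right
    filter_upwards [hsmall] with η hη
    refine h2 ⟨(t₀, -η), ⟨hline (-η) (by rw [abs_neg, abs_of_pos hη.1]; exact hη.2), ?_⟩, ?_⟩
    · simpa using hη.1
    · simp [hΨ, sub_eq_add_neg]
  -- If both half boxes missed `Ω`, then near the boundary point `γ i t₀` the open set `Ω` could
  -- only contain points of its own boundary.
  exfalso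
  have hnb : Ψ '' Q ∈ 𝓝 (γ i t₀) := by
    rw [← hΨ0, ← hmap]
    exact image_mem_map (Metric.ball_mem_nhds _ hρ)
  have hcl : γ i t₀ ∈ closure Ω := frontier_subset_closure (h.mem_frontier i ⟨ht₀.1.le, ht₀.2.le⟩)
  obtain ⟨_, ⟨q, hq, rfl⟩, hqΩ⟩ := mem_closure_iff_nhds.1 hcl _ hnb
  rcases lt_trichotomy q.2 0 with h3 | h3 | h3
  · exact disjoint_left.1 h2 ⟨q, ⟨hq, h3⟩, rfl⟩ hqΩ
  · have h4 : Ψ q ∈ frontier Ω := by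
      have h5 := (hρV q hq).1.1
      simpa [hΨ, h3] using h.mem_frontier i (Ioo_subset_Icc_self h5)
    rw [hΩ.frontier_eq] at h4
    exact h4.2 hqΩ
  · exact disjoint_left.1 h1 ⟨q, ⟨hq, h3⟩, rfl⟩ hqΩ

end IsArcSystem

/-! ### The fundamental theorem of calculus on a slice -/

open Classical in
/-- The jump at `x` of the indicator function of `O`, from left to right, with opposite sign. -/
noncomputable def indicatorDrop (O : Set ℝ) (x : ℝ) : ℝ :=
  (if ∀ᶠ t in 𝓝[<] x, t ∈ O then 1 else 0) - (if ∀ᶠ t in 𝓝[>] x, t ∈ O then 1 else 0)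

lemma abs_indicatorDrop_le (O : Set ℝ) (x : ℝ) : |indicatorDrop O x| ≤ 1 := by
  unfold indicatorDrop
  split_ifs <;> norm_num

/-- The fundamental theorem of calculus on a bounded open set with finite boundary. -/
theorem integral_deriv_eq_sum_indicatorDrop {O : Set ℝ} (hO : IsOpen O)
    (hb : Bornology.IsBounded O) (N : Finset ℝ) (hN : frontier O ⊆ N) {g g' : ℝ → ℝ}
    (hg : ∀ x, HasDerivAt g (g' x) x) (hg' : Continuous g') :
    ∫ x in O, g' x = ∑ x ∈ N, indicatorDrop O x * g x := by
  classical
  have hii : ∀ a b, IntervalIntegrable (O.indicator g') volume a b := fun a b => by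
    rw [intervalIntegrable_iff]
    exact (intervalIntegrable_iff.1 (hg'.intervalIntegrable a b)).indicator hO.measurableSet
  -- An interval without boundary points is contained in `O` or disjoint from it.
  have hfree : ∀ a b : ℝ, a < b → (∀ x ∈ Ioo a b, x ∉ frontier O) →
      ((∀ᶠ t in 𝓝[>] a, t ∈ O) ∧ (∀ᶠ t in 𝓝[<] b, t ∈ O) ∧
        ∫ x in a..b, O.indicator g' x = g b - g a) ∨
      ((¬ ∀ᶠ t in 𝓝[>] a, t ∈ O) ∧ (¬ ∀ᶠ t in 𝓝[<] b, t ∈ O) ∧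
        ∫ x in a..b, O.indicator g' x = 0) := by
    intro a b hab hfr
    have e1 : ∀ᶠ t in 𝓝[>] a, t ∈ Ioo a b := Ioo_mem_nhdsGT hab
    have e2 : ∀ᶠ t in 𝓝[<] b, t ∈ Ioo a b := Ioo_mem_nhdsLT hab
    rcases isPreconnected_Ioo.subset_or_disjoint_of_frontier hO hfr with h1 | h1
    · refine Or.inl ⟨e1.mono fun t ht => h1 ht, e2.mono fun t ht => h1 ht, ?_⟩
      rw [← intervalIntegral.integral_eq_sub_of_hasDerivAt (fun x _ => hg x)
        (hg'.intervalIntegrable a b), intervalIntegral.integral_of_le hab.le,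
        intervalIntegral.integral_of_le hab.le, integral_Ioc_eq_integral_Ioo,
        integral_Ioc_eq_integral_Ioo]
      exact setIntegral_congr_fun measurableSet_Ioo fun x hx => indicator_of_mem (h1 hx) _
    · refine Or.inr ⟨fun h2 => ?_, fun h2 => ?_, ?_⟩
      · obtain ⟨t, ht1, ht2⟩ := (e1.and h2).exists
        exact disjoint_left.1 h1 ht1 ht2
      · obtain ⟨t, ht1, ht2⟩ := (e2.and h2).exists
        exact disjoint_left.1 h1 ht1 ht2
      · rw [intervalIntegral.integral_of_le hab.le, integral_Ioc_eq_integral_Ioo,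
          setIntegral_congr_fun (g := fun _ => 0) measurableSet_Ioo
            fun x hx => indicator_of_notMem (disjoint_left.1 h1 hx) _]
        simp
  -- Induction on the largest boundary point. The extra term at `b` remembers whether `O` reaches
  -- `b` from the left, which lets the intervals be concatenated.
  have main : ∀ N : Finset ℝ, ∀ a b : ℝ, a < b → (∀ x ∈ N, x ∈ Ioo a b) →
      (∀ x ∈ Ioo a b, x ∈ frontier O → x ∈ N) → (¬ ∀ᶠ t in 𝓝[>] a, t ∈ O) →
      ∫ x in a..b, O.indicator g' x = ∑ x ∈ N, indicatorDrop O x * g x +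
        (if ∀ᶠ t in 𝓝[<] b, t ∈ O then 1 else 0) * g b := by
    intro N
    induction N using Finset.induction_on_max with
    | empty =>
      intro a b hab _ hfr ha
      rcases hfree a b hab fun x hx hxf => by simpa using hfr x hx hxf with h1 | h1
      · exact absurd h1.1 ha
      · rw [h1.2.2, if_neg h1.2.1]; simp
    | insert x N hmax ih =>
      intro a b hab hNab hfr ha
      have hx := hNab x (Finset.mem_insert_self _ _)
      have ih' := ih a x hx.1
        (fun y hy => ⟨(hNab y (Finset.mem_insert_of_mem hy)).1, hmax y hy⟩)
        (fun y hy hyf => (Finset.mem_insert.1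
          (hfr y ⟨hy.1, hy.2.trans hx.2⟩ hyf)).resolve_left hy.2.ne) ha
      rw [← intervalIntegral.integral_add_adjacent_intervals (hii a x) (hii x b), ih',
        Finset.sum_insert fun hxN => (hmax x hxN).false]
      have h2 : ∀ y ∈ Ioo x b, y ∉ frontier O := fun y hy hyf => by
        rcases Finset.mem_insert.1 (hfr y ⟨hx.1.trans hy.1, hy.2⟩ hyf) with h3 | h3
        · exact hy.1.ne' h3
        · exact (hmax y h3).not_gt hy.1
      unfold indicatorDrop
      rcases hfree x b hx.2 h2 with h1 | h1
      · rw [h1.2.2, if_pos h1.1, if_pos h1.2.1]; ring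
      · rw [h1.2.2, if_neg h1.1, if_neg h1.2.1]; ring
  obtain ⟨R, hR⟩ := (hb.union N.finite_toSet.isBounded).subset_closedBall 0
  have hbd : ∀ x ∈ O ∪ (N : Set ℝ), x ∈ Ioo (-(|R| + 1)) (|R| + 1) := fun x hx => by
    have h1 := hR hx
    rw [mem_closedBall_zero_iff, Real.norm_eq_abs] at h1
    have h2 := abs_le.1 (h1.trans (le_abs_self R))
    constructor <;> linarith
  have hlt : -(|R| + 1) < |R| + 1 := by have := abs_nonneg R; linarith
  -- A margin beyond a bound for `O` and `N` makes both end terms vanish.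
  have ha : ¬ ∀ᶠ t in 𝓝[>] (-(|R| + 1) - 1), t ∈ O := fun h2 => by
    have e1 : ∀ᶠ t in 𝓝[>] (-(|R| + 1) - 1), t ∈ Ioo (-(|R| + 1) - 1) (-(|R| + 1)) :=
      Ioo_mem_nhdsGT (by linarith)
    obtain ⟨t, ht1, ht2⟩ := (e1.and h2).exists
    have := (hbd t (Or.inl ht2)).1
    linarith [ht1.2]
  have hbb : ¬ ∀ᶠ t in 𝓝[<] (|R| + 1 + 1), t ∈ O := fun h2 => by
    have e1 : ∀ᶠ t in 𝓝[<] (|R| + 1 + 1), t ∈ Ioo (|R| + 1) (|R| + 1 + 1) :=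
      Ioo_mem_nhdsLT (by linarith)
    obtain ⟨t, ht1, ht2⟩ := (e1.and h2).exists
    have := (hbd t (Or.inl ht2)).2
    linarith [ht1.1]
  have h3 := main N (-(|R| + 1) - 1) (|R| + 1 + 1) (by linarith)
    (fun x hx => by have := hbd x (Or.inr hx); constructor <;> linarith [this.1, this.2])
    (fun x _ hx => hN hx) ha
  rw [if_neg hbb, zero_mul, add_zero] at h3
  rw [← h3, intervalIntegral.integral_of_le (by linarith), setIntegral_indicator hO.measurableSet]
  congr 2
  symm
  refine inter_eq_right.2 fun x hx => ?_
  have := hbd x (Or.inl hx)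
  constructor <;> linarith [this.1, this.2]

/-! ### Boundary curves and Green's formula by slicing -/

/-- A parametrization `p : [0, T] → ℂ` of (a set containing) the boundary of a bounded open set `M`
which is smooth on the cofinite set `U` of parameters and there runs counterclockwise, with `M` on
the left of every tangent. -/
structure BoundaryCurve (M : Set ℂ) (T : ℝ) (p : ℝ → ℂ) (U : Set ℝ) : Prop where
  isOpen : IsOpen M
  bounded : Bornology.IsBounded M
  continuous : Continuous p
  isOpen_param : IsOpen U
  param_subset : U ⊆ Ioo 0 T
  finite_diff : (Icc 0 T \ U).Finite
  differentiableAt : ∀ s ∈ U, DifferentiableAt ℝ p s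
  continuousOn_deriv : ContinuousOn (deriv p) U
  injOn : InjOn p U
  left : ∀ s ∈ U, ∀ z ∈ M, 0 < (conj (deriv p s) * (z - p s)).im
  frontier_subset : frontier M ⊆ p '' Icc 0 T

namespace BoundaryCurve

variable {M : Set ℂ} {T : ℝ} {p : ℝ → ℂ} {U : Set ℝ} {Ω : Set ℂ} {m : ℕ} {γ : Fin m → ℝ → ℂ}

lemma notMem (hB : BoundaryCurve M T p U) {s : ℝ} (hs : s ∈ U) : p s ∉ M := fun h => by
  simpa using hB.left s hs _ h

lemma left_closure (hB : BoundaryCurve M T p U) {s : ℝ} (hs : s ∈ U) {z : ℂ} (hz : z ∈ closure M) :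
    0 ≤ (conj (deriv p s) * (z - p s)).im := by
  have hcl : IsClosed {z : ℂ | 0 ≤ (conj (deriv p s) * (z - p s)).im} :=
    isClosed_le continuous_const (by fun_prop)
  exact closure_minimal (fun z hz => (hB.left s hs z hz).le) hcl hz

/-- At a boundary point of `Ω` on the smooth part of `∂M`, the inward directions point into `Ω`. -/
theorem inward (hB : BoundaryCurve M T p U) (hΩ : IsOpen Ω) (hΩM : Ω ⊆ M)
    (h : IsArcSystem Ω γ) {s : ℝ} (hs : s ∈ U) (hsΩ : p s ∈ frontier Ω)
    (hse : p s ∉ IsArcSystem.endpoints γ) {w : ℂ} (hw : 0 < (conj (deriv p s) * w).im) :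
    ∀ᶠ η : ℝ in 𝓝[>] 0, p s + η * w ∈ Ω := by
  obtain ⟨i, t₀, ht₀, hit⟩ := h.exists_interior hsΩ hse
  -- The arc of `∂Ω` through `p s` stays in the closed half plane left of the tangent and touches
  -- the line at `t₀`. Hence it is tangent to `∂M`, and `w`, transversal to `∂M`, is transversal to
  -- the arc.
  have hmin : IsLocalMin (fun t => (conj (deriv p s) * (γ i t - p s)).im) t₀ := by
    filter_upwards [Ioo_mem_nhds ht₀.1 ht₀.2] with t ht
    simp only [hit, sub_self, mul_zero, Complex.zero_im]
    exact hB.left_closure hs (closure_mono hΩM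
      (frontier_subset_closure (h.mem_frontier i (Ioo_subset_Icc_self ht))))
  have hder : HasDerivAt (fun t => (conj (deriv p s) * (γ i t - p s)).im)
      (conj (deriv p s) * deriv (γ i) t₀).im t₀ := by
    have h1 := ((h.hasDerivAt i ht₀).sub_const (p s)).const_mul (conj (deriv p s))
    exact Complex.imCLM.hasFDerivAt.comp_hasDerivAt t₀ h1
  have h0 := hmin.hasDerivAt_eq_zero hder
  have hne := h.deriv_ne_zero i ht₀
  set a := deriv p s
  set b := deriv (γ i) t₀
  have hbw : (conj b * w).im ≠ 0 := by
    intro h1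
    simp only [Complex.mul_im, Complex.conj_re, Complex.conj_im] at h0 h1 hw
    have h2 : b.re * (a.re * w.im - a.im * w.re) = 0 := by
      linear_combination a.re * h1 + w.re * h0
    have h3 : b.im * (a.re * w.im - a.im * w.re) = 0 := by
      linear_combination a.im * h1 + w.im * h0
    have h4 : a.re * w.im - a.im * w.re ≠ 0 := by nlinarith
    exact hne (Complex.ext ((mul_eq_zero.1 h2).resolve_right h4)
      ((mul_eq_zero.1 h3).resolve_right h4))
  -- One of the two sides belongs to `Ω`; it cannot be the side of `-w`, which lies outside `M`.
  rcases h.side hΩ ht₀ hbw with h1 | h1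
  · rwa [hit] at h1
  · exfalso
    obtain ⟨η, h2, h3⟩ := (h1.and self_mem_nhdsWithin).exists
    rw [hit] at h2
    have h4 := hB.left s hs _ (hΩM h2)
    have h5 : (conj a * (p s - η * w - p s)).im = -η * (conj a * w).im := by
      simp only [Complex.mul_im, Complex.sub_re, Complex.sub_im, Complex.mul_re,
        Complex.ofReal_re, Complex.ofReal_im]
      ring
    rw [h5] at h4
    have h6 : (0 : ℝ) < η := h3
    nlinarith

end BoundaryCurve

lemma ContinuousOn.measurable_indicator {U : Set ℝ} (hU : IsOpen U) {f : ℝ → ℝ}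
    (hf : ContinuousOn f U) : Measurable (U.indicator f) := by
  classical
  rw [← piecewise_eq_indicator]
  exact hf.measurable_piecewise continuousOn_const hU.measurableSet

/-- Fubini's theorem in the orthonormal frame `w, i w`. -/
lemma integral_eq_integral_slices {w : ℂ} (hw : ‖w‖ = 1) {f : ℂ → ℝ} (hf : Integrable f) :
    Integrable (fun y : ℝ => ∫ x : ℝ, f (w * (x + y * Complex.I))) ∧
      ∫ z, f z = ∫ y : ℝ, ∫ x : ℝ, f (w * (x + y * Complex.I)) := by
  let c : Circle := ⟨w, mem_sphere_zero_iff_norm.2 hw⟩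
  let e : ℝ × ℝ ≃ᵐ ℂ := Complex.measurableEquivRealProd.symm.trans
    (rotation c).toHomeomorph.toMeasurableEquiv
  have he : MeasurePreserving e volume volume :=
    Complex.volume_preserving_equiv_real_prod.symm.trans (rotation c).measurePreserving
  have hev : ∀ q : ℝ × ℝ, e q = w * (q.1 + q.2 * Complex.I) := fun q => by
    change w * (Complex.measurableEquivRealProd.symm q) = _
    rw [Complex.measurableEquivRealProd_symm_apply]
    congr 1
    apply Complex.ext <;> simp
  have h1 : Integrable (fun q : ℝ × ℝ => f (w * (q.1 + q.2 * Complex.I)))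
      ((volume : Measure ℝ).prod volume) := by
    have := (he.integrable_comp_emb e.measurableEmbedding).2 hf
    simp only [Function.comp_def, hev] at this
    exact this
  refine ⟨h1.integral_prod_right, ?_⟩
  rw [← he.integral_comp' f]
  simp only [hev]
  exact integral_prod_symm _ h1

lemma mul_conj_decomp {w : ℂ} (hw : ‖w‖ = 1) (z : ℂ) :
    w * ((conj w * z).re + (conj w * z).im * Complex.I) = z := by
  rw [Complex.re_add_im, ← mul_assoc, Complex.mul_conj, Complex.normSq_eq_norm_sq, hw]
  simp

lemma conj_mul_mul {w : ℂ} (hw : ‖w‖ = 1) (x y : ℝ) :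
    conj w * (w * (x + y * Complex.I)) = x + y * Complex.I := by
  rw [← mul_assoc, mul_comm (conj w), Complex.mul_conj, Complex.normSq_eq_norm_sq, hw]
  simp

lemma IsArcSystem.exists_norm_deriv_le {Ω : Set ℂ} {m : ℕ} {γ : Fin m → ℝ → ℂ}
    (h : IsArcSystem Ω γ) (i : Fin m) : ∃ C, ∀ t ∈ Ioo (0 : ℝ) 1, ‖deriv (γ i) t‖ ≤ C := by
  have h1 : ContinuousOn (derivWithin (γ i) (Icc 0 1)) (Icc 0 1) :=
    (h.smooth i).continuousOn_derivWithin (uniqueDiffOn_Icc zero_lt_one) (by simp)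
  obtain ⟨C, hC⟩ := isCompact_Icc.exists_bound_of_continuousOn h1
  refine ⟨C, fun t ht => ?_⟩
  rw [← derivWithin_of_mem_nhds (Icc_mem_nhds ht.1 ht.2)]
  exact hC t (Ioo_subset_Icc_self ht)

lemma hasDerivAt_conj_mul_im {γ : ℝ → ℂ} {γ' : ℂ} {t : ℝ} (w : ℂ) (h : HasDerivAt γ γ' t) :
    HasDerivAt (fun t => (conj w * γ t).im) (conj w * γ').im t :=
  Complex.imCLM.hasFDerivAt.comp_hasDerivAt t (h.const_mul (conj w))

lemma abs_conj_mul_im_le {w : ℂ} (hw : ‖w‖ = 1) (z : ℂ) : |(conj w * z).im| ≤ ‖z‖ := by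
  refine (Complex.abs_im_le_norm _).trans ?_
  rw [norm_mul, RCLike.norm_conj, hw, one_mul]

/-- The height along an arc has bounded derivative, so the area formula makes almost all of its
level sets finite. -/
lemma IsArcSystem.ae_finite_slice {Ω : Set ℂ} {m : ℕ} {γ : Fin m → ℝ → ℂ}
    (h : IsArcSystem Ω γ) {w : ℂ} (hw : ‖w‖ = 1) (i : Fin m) :
    ∀ᵐ y, (Ioo 0 1 ∩ (fun t => (conj w * γ i t).im) ⁻¹' {y}).Finite := by
  obtain ⟨C, hC⟩ := h.exists_norm_deriv_le i
  refine ae_finite_fiber measurableSet_Ioo isOpen_Ioo Subset.rfl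
    (h' := fun t => (conj w * deriv (γ i) t).im)
    (fun t ht => hasDerivAt_conj_mul_im w (h.hasDerivAt i ht)) ?_ ?_
  · exact Complex.continuous_im.comp_continuousOn (continuousOn_const.mul (h.continuousOn_deriv i))
  · have : ∫⁻ t in Ioo (0 : ℝ) 1, ENNReal.ofReal |(conj w * deriv (γ i) t).im| ≤
        ∫⁻ t in Ioo (0 : ℝ) 1, ENNReal.ofReal C :=
      setLIntegral_mono measurable_const fun t ht =>
        ENNReal.ofReal_le_ofReal ((abs_conj_mul_im_le hw _).trans (hC t ht))
    refine (this.trans_lt ?_).ne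
    simp

namespace BoundaryCurve

variable {M : Set ℂ} {T : ℝ} {p : ℝ → ℂ} {U : Set ℝ} {Ω : Set ℂ} {m : ℕ} {γ : Fin m → ℝ → ℂ}

/-- The parameters of the smooth part of the exterior boundary. -/
def extParam (p : ℝ → ℂ) (U : Set ℝ) (Ω : Set ℂ) : Set ℝ := U ∩ p ⁻¹' frontier Ω

lemma measurableSet_extParam (hB : BoundaryCurve M T p U) : MeasurableSet (extParam p U Ω) :=
  hB.isOpen_param.measurableSet.inter (isClosed_frontier.preimage hB.continuous).measurableSet

/-- The interior parameters of an arc at which it runs inside `M`. -/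
def intParam (γ : ℝ → ℂ) (M : Set ℂ) : Set ℝ := Ioo 0 1 ∩ γ ⁻¹' M

lemma isOpen_intParam (hM : IsOpen M) (h : IsArcSystem Ω γ) (i : Fin m) :
    IsOpen (intParam (γ i) M) :=
  ((h.smooth i).continuousOn.mono Ioo_subset_Icc_self).isOpen_inter_preimage isOpen_Ioo hM

/-- The contribution of the exterior boundary in a slice. -/
lemma slice_exterior (hB : BoundaryCurve M T p U) (hΩ : IsOpen Ω) (hΩM : Ω ⊆ M)
    (h : IsArcSystem Ω γ) {w : ℂ} (hw : ‖w‖ = 1) {s y : ℝ} (hs : s ∈ U)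
    (hsΩ : p s ∈ frontier Ω) (hse : p s ∉ IsArcSystem.endpoints γ)
    (hsy : (conj w * p s).im = y) (hd : (conj w * deriv p s).im ≠ 0) :
    indicatorDrop {x : ℝ | w * (x + y * Complex.I) ∈ Ω} (conj w * p s).re =
      SignType.sign (conj w * deriv p s).im := by
  set x := (conj w * p s).re with hx
  have hz : ∀ η : ℝ, w * (((x + η : ℝ) : ℂ) + y * Complex.I) = p s + η * w := fun η => by
    have := mul_conj_decomp hw (p s)
    rw [hsy] at this
    rw [← this]; push_cast; ring
  have hz' : ∀ η : ℝ, w * (((x - η : ℝ) : ℂ) + y * Complex.I) = p s + η * (-w) := fun η => by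
    have := hz (-η)
    rw [← sub_eq_add_neg] at this
    rw [this]; push_cast; ring
  have hflip : (conj (deriv p s) * (-w)).im = (conj w * deriv p s).im := by
    simp only [Complex.mul_im, Complex.conj_re, Complex.conj_im, Complex.neg_re, Complex.neg_im]
    ring
  have hflip' : (conj (deriv p s) * w).im = -(conj w * deriv p s).im := by
    rw [← hflip]; simp
  -- Directions to the right of the tangent leave `M`, hence `Ω`.
  have out : ∀ v : ℂ, (conj (deriv p s) * v).im < 0 → ¬ ∀ᶠ η : ℝ in 𝓝[>] 0, p s + η * v ∈ Ω := by
    intro v hv hev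
    obtain ⟨η, h2, h3⟩ := (hev.and self_mem_nhdsWithin).exists
    have h4 := hB.left s hs _ (hΩM h2)
    have h5 : (conj (deriv p s) * (p s + η * v - p s)).im = η * (conj (deriv p s) * v).im := by
      simp only [Complex.mul_im, Complex.sub_re, Complex.sub_im, Complex.add_re, Complex.add_im,
        Complex.mul_re, Complex.ofReal_re, Complex.ofReal_im]
      ring
    rw [h5] at h4
    have h6 : (0 : ℝ) < η := h3
    nlinarith
  have tr : (∀ᶠ t in 𝓝[>] x, t ∈ {x : ℝ | w * (x + y * Complex.I) ∈ Ω}) ↔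
      ∀ᶠ η : ℝ in 𝓝[>] 0, p s + η * w ∈ Ω := by
    have : 𝓝[>] x = map (fun η => x + η) (𝓝[>] (0 : ℝ)) := by
      have := map_add_left_nhdsGT (c := x) (a := (0 : ℝ))
      rw [add_zero] at this
      exact this.symm
    rw [this, eventually_map]
    simp only [mem_ofPred_eq, hz]
  have tl : (∀ᶠ t in 𝓝[<] x, t ∈ {x : ℝ | w * (x + y * Complex.I) ∈ Ω}) ↔
      ∀ᶠ η : ℝ in 𝓝[>] 0, p s + η * (-w) ∈ Ω := by
    have : 𝓝[<] x = map (fun η => x - η) (𝓝[>] (0 : ℝ)) := by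
      have h1 := (Homeomorph.subLeft x).isEmbedding.map_nhdsWithin_eq (Ioi 0) 0
      simp only [Homeomorph.coe_subLeft, image_const_sub_Ioi, sub_zero] at h1
      exact h1.symm
    rw [this, eventually_map]
    simp only [mem_ofPred_eq, hz']
  unfold indicatorDrop
  rw [tl, tr]
  -- If the tangent descends in the frame `w, i w`, the inside is on the side of `+w` and the slice
  -- enters `Ω` (drop `-1`); if it ascends, the slice leaves `Ω` (drop `+1`).
  rcases lt_or_gt_of_ne hd with h1 | h1
  · have a1 := hB.inward hΩ hΩM h hs hsΩ hse (w := w) (by rw [hflip']; linarith)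
    have a2 := out (-w) (by rw [hflip]; exact h1)
    rw [if_pos a1, if_neg a2, sign_neg h1]
    simp
  · have a1 := hB.inward hΩ hΩM h hs hsΩ hse (w := -w) (by rw [hflip]; exact h1)
    have a2 := out w (by rw [hflip']; linarith)
    rw [if_pos a1, if_neg a2, sign_pos h1]
    simp

/-- The part of a slice of `∂Ω` outside `M`, as a signed sum over the boundary parameter. -/
lemma slice_sum_exterior (hB : BoundaryCurve M T p U) (hΩ : IsOpen Ω) (hΩM : Ω ⊆ M)
    (h : IsArcSystem Ω γ) {w : ℂ} (hw : ‖w‖ = 1) {y : ℝ} (g : ℂ → ℝ) (N S : Finset ℝ)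
    (hN : ∀ x, x ∈ N ↔ w * (x + y * Complex.I) ∈ frontier Ω \ M)
    (hS : (S : Set ℝ) = extParam p U Ω ∩ (fun s => (conj w * p s).im) ⁻¹' {y})
    (hend : ∀ z ∈ IsArcSystem.endpoints γ, (conj w * z).im ≠ y)
    (hexc : ∀ s ∈ Icc 0 T \ U, (conj w * p s).im ≠ y)
    (hreg : ∀ s ∈ U, (conj w * p s).im = y → (conj w * deriv p s).im ≠ 0) :
    ∑ x ∈ N, indicatorDrop {x : ℝ | w * (x + y * Complex.I) ∈ Ω} x * g (w * (x + y * Complex.I)) =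
      ∑ s ∈ S, SignType.sign (conj w * deriv p s).im * g (p s) := by
  have hSm : ∀ s, s ∈ S ↔ s ∈ U ∧ p s ∈ frontier Ω ∧ (conj w * p s).im = y := fun s => by
    rw [← Finset.mem_coe, hS]
    simp [extParam, and_assoc]
  have hz : ∀ s ∈ S, w * ((conj w * p s).re + y * Complex.I) = p s := fun s hs => by
    have := mul_conj_decomp hw (p s)
    rwa [((hSm s).1 hs).2.2] at this
  symm
  -- A point of `∂Ω` outside `M` lies on `∂M`, hence on the curve. The choice of `y` avoids the
  -- exceptional parameters, so slice points and parameters correspond bijectively.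
  refine Finset.sum_nbij (fun s => (conj w * p s).re) ?_ ?_ ?_ ?_
  · intro s hs
    have h1 := (hSm s).1 hs
    exact (hN _).2 (by rw [hz s hs]; exact ⟨h1.2.1, hB.notMem h1.1⟩)
  · intro s hs t ht hst
    refine hB.injOn ((hSm s).1 hs).1 ((hSm t).1 ht).1 ?_
    have hst' : (conj w * p s).re = (conj w * p t).re := hst
    rw [← hz s hs, ← hz t ht, hst']
  · intro x hx
    have hx' := (hN x).1 hx
    have hyx : (conj w * (w * (x + y * Complex.I))).im = y := by
      rw [conj_mul_mul hw]; simp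
    have hfM : w * (x + y * Complex.I) ∈ frontier M := by
      rw [hB.isOpen.frontier_eq]
      exact ⟨closure_mono hΩM (frontier_subset_closure hx'.1), hx'.2⟩
    obtain ⟨s, hs, hsx⟩ := hB.frontier_subset hfM
    have hsy : (conj w * p s).im = y := by rw [hsx]; exact hyx
    have hsU : s ∈ U := by_contra fun h1 => hexc s ⟨hs, h1⟩ hsy
    refine ⟨s, Finset.mem_coe.2 ((hSm s).2 ⟨hsU, hsx ▸ hx'.1, hsy⟩), ?_⟩
    simp only [hsx, conj_mul_mul hw]
    simp
  · intro s hs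
    have h1 := (hSm s).1 hs
    rw [hB.slice_exterior hΩ hΩM h hw h1.1 h1.2.1 (fun h2 => hend _ h2 h1.2.2) h1.2.2
      (hreg s h1.1 h1.2.2), hz s hs]

/-- The part of a slice of `∂Ω` inside `M` is bounded by the sum over the arc parameters. -/
lemma slice_sum_interior (h : IsArcSystem Ω γ) {w : ℂ} (hw : ‖w‖ = 1) {y : ℝ} (G : ℂ → ℝ≥0∞)
    (N : Finset ℝ) (S : Fin m → Finset ℝ)
    (hN : ∀ x ∈ N, w * (x + y * Complex.I) ∈ frontier Ω ∩ M)
    (hS : ∀ i, (S i : Set ℝ) = intParam (γ i) M ∩ (fun t => (conj w * γ i t).im) ⁻¹' {y})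
    (hend : ∀ z ∈ IsArcSystem.endpoints γ, (conj w * z).im ≠ y) :
    ∑ x ∈ N, G (w * (x + y * Complex.I)) ≤ ∑ i, ∑ t ∈ S i, G (γ i t) := by
  have hyx : ∀ x : ℝ, (conj w * (w * (x + y * Complex.I))).im = y := fun x => by
    rw [conj_mul_mul hw]; simp
  have hex : ∀ x ∈ N, ∃ q : (_ : Fin m) × ℝ, q ∈ Finset.univ.sigma S ∧
      γ q.1 q.2 = w * (x + y * Complex.I) := by
    intro x hx
    obtain ⟨i, t, ht, hit⟩ := h.exists_interior (hN x hx).1 fun h1 => hend _ h1 (hyx x)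
    refine ⟨⟨i, t⟩, Finset.mem_sigma.2 ⟨Finset.mem_univ _, ?_⟩, hit⟩
    rw [← Finset.mem_coe, hS]
    refine ⟨⟨ht, ?_⟩, ?_⟩
    · rw [mem_preimage, hit]; exact (hN x hx).2
    · rw [mem_preimage, hit]; exact hyx x
  rcases N.eq_empty_or_nonempty with rfl | ⟨x₀, hx₀⟩
  · simp
  have : Nonempty ((_ : Fin m) × ℝ) := ⟨(hex x₀ hx₀).choose⟩
  choose! e heS heq using hex
  have hinj : ∀ x ∈ N, ∀ x' ∈ N, e x = e x' → x = x' := by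
    intro x hx x' hx' hxx
    have h1 : w * (x + y * Complex.I) = w * (x' + y * Complex.I) := by
      rw [← heq x hx, ← heq x' hx', hxx]
    have h2 : w ≠ 0 := fun h0 => by simp [h0] at hw
    simpa using mul_left_cancel₀ h2 h1
  classical
  rw [← Finset.sum_sigma Finset.univ S fun q => G (γ q.1 q.2)]
  calc ∑ x ∈ N, G (w * (x + y * Complex.I)) = ∑ x ∈ N, G (γ (e x).1 (e x).2) :=
        Finset.sum_congr rfl fun x hx => by rw [heq x hx]
    _ = ∑ q ∈ N.image e, G (γ q.1 q.2) :=
        (Finset.sum_image (f := fun q : (_ : Fin m) × ℝ => G (γ q.1 q.2)) hinj).symm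
    _ ≤ _ := Finset.sum_le_sum_of_subset (Finset.image_subset_iff.2 heS)

/-- One half of Green's formula, with the interior boundary estimated away. -/
theorem ofReal_abs_integral_sub_le (hB : BoundaryCurve M T p U) {L : ℝ}
    (hL : ∀ s ∈ U, ‖deriv p s‖ ≤ L) (hΩ : IsOpen Ω) (hΩM : Ω ⊆ M)
    (h : IsArcSystem Ω γ) {w : ℂ} (hw : ‖w‖ = 1) {g : ℂ → ℝ} (hg : ContDiff ℝ 1 g) :
    ENNReal.ofReal |(∫ z in Ω, fderiv ℝ g z w) -
        ∫ s in extParam p U Ω, g (p s) * (conj w * deriv p s).im| ≤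
      ∑ i, ∫⁻ t in intParam (γ i) M,
        ENNReal.ofReal (|(conj w * deriv (γ i) t).im| * |g (γ i t)|) := by
  classical
  have hΩb : Bornology.IsBounded Ω := hB.bounded.subset hΩM
  have hgd : Continuous fun z => fderiv ℝ g z w :=
    (hg.continuous_fderiv one_ne_zero).clm_apply continuous_const
  have hint : Integrable (Ω.indicator fun z => fderiv ℝ g z w) := by
    rw [integrable_indicator_iff hΩ.measurableSet]
    exact (hgd.continuousOn.integrableOn_compact hΩb.isCompact_closure).mono_set subset_closure
  have hsl := integral_eq_integral_slices hw hint
  rw [integral_indicator hΩ.measurableSet] at hsl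
  set F : ℝ → ℝ := fun y => ∫ x : ℝ, Ω.indicator (fun z => fderiv ℝ g z w)
    (w * (x + y * Complex.I)) with hF
  -- the exterior part
  set hp : ℝ → ℝ := fun s => (conj w * p s).im with hhp
  set hp' : ℝ → ℝ := fun s => (conj w * deriv p s).im with hhp'
  have hpd : ∀ s ∈ U, HasDerivAt hp (hp' s) s := fun s hs =>
    hasDerivAt_conj_mul_im w (hB.differentiableAt s hs).hasDerivAt
  have hpc : ContinuousOn hp' U :=
    Complex.continuous_im.comp_continuousOn (continuousOn_const.mul hB.continuousOn_deriv)
  have hpm : Measurable hp' :=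
    Complex.measurable_im.comp (measurable_const.mul (measurable_deriv p))
  -- The sign serves twice: `|hp'| * k = g * hp'` is the desired line integrand, and on a slice `k`
  -- is the indicator drop times `g`.
  set k : ℝ → ℝ := fun s => SignType.sign (hp' s) * g (p s) with hk
  have hgp : Continuous fun s => g (p s) := hg.continuous.comp hB.continuous
  have hkm : Measurable k := by
    have h1 : Measurable fun x : ℝ => ((SignType.sign x : SignType) : ℝ) := by
      have : (fun x : ℝ => ((SignType.sign x : SignType) : ℝ)) =
          fun x => if 0 < x then 1 else if x < 0 then -1 else 0 := by
        ext x
        rcases lt_trichotomy x 0 with h | h | h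
        · simp [h, h.not_gt]
        · simp [h]
        · simp [h]
      rw [this]
      exact Measurable.ite measurableSet_Ioi measurable_const
        (Measurable.ite measurableSet_Iio measurable_const measurable_const)
    exact (h1.comp hpm).mul hgp.measurable
  have hkk : ∀ s, |hp' s| * k s = g (p s) * hp' s := fun s => by
    simp only [hk]
    rw [← mul_assoc, mul_comm |hp' s|, sign_mul_abs, mul_comm]
  have hEm : MeasurableSet (extParam p U Ω) := hB.measurableSet_extParam
  have hEfin : volume (extParam p U Ω) < ⊤ :=
    (measure_mono (inter_subset_left.trans hB.param_subset)).trans_lt measure_Ioo_lt_top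
  have hp'b : ∀ s ∈ U, |hp' s| ≤ L := fun s hs => (abs_conj_mul_im_le hw _).trans (hL s hs)
  have hkint : IntegrableOn (fun s => |hp' s| * k s) (extParam p U Ω) := by
    obtain ⟨C, hC⟩ := (isCompact_Icc (a := (0 : ℝ)) (b := T)).exists_bound_of_continuousOn
      hgp.continuousOn
    refine Measure.integrableOn_of_bounded (M := C * L) hEfin.ne ?_ ?_
    · exact ((measurable_norm.comp hpm).mul hkm).aestronglyMeasurable
    · refine (ae_restrict_iff' hEm).2 (Eventually.of_forall fun s hs => ?_)
      rw [hkk, norm_mul]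
      have h1 := hC s (Ioo_subset_Icc_self (hB.param_subset hs.1))
      exact mul_le_mul h1 (hp'b s hs.1) (norm_nonneg _) ((norm_nonneg _).trans h1)
  have hK := integral_fiberSum_sub hEm hB.isOpen_param inter_subset_left hpd hpc hkm hkint
  set K : ℝ → ℝ := fun y => (fiberSum (extParam p U Ω) hp (fun t => ENNReal.ofReal (k t)) y).toReal -
        (fiberSum (extParam p U Ω) hp (fun t => ENNReal.ofReal (-k t)) y).toReal with hKdef
  have hKint : ∫ y, K y = ∫ s in extParam p U Ω, g (p s) * (conj w * deriv p s).im := by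
    rw [hK.2]; exact integral_congr_ae (Eventually.of_forall fun s => hkk s)
  -- the interior part
  set q : Fin m → ℝ → ℝ≥0∞ := fun i t =>
    ENNReal.ofReal ((Ioo (0 : ℝ) 1).indicator (fun t => |g (γ i t)|) t) with hq
  have hγc : ∀ i, ContinuousOn (γ i) (Ioo 0 1) := fun i =>
    (h.smooth i).continuousOn.mono Ioo_subset_Icc_self
  have hqm : ∀ i, Measurable (q i) := fun i =>
    (ContinuousOn.measurable_indicator isOpen_Ioo
      (hg.continuous.comp_continuousOn (hγc i)).abs).ennreal_ofReal
  have hqi : ∀ i t, t ∈ Ioo (0 : ℝ) 1 → q i t = ENNReal.ofReal |g (γ i t)| := fun i t ht => by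
    simp only [hq, indicator_of_mem ht]
  set H : Fin m → ℝ → ℝ≥0∞ := fun i =>
    fiberSum (intParam (γ i) M) (fun t => (conj w * γ i t).im) (q i) with hH
  have hHi := fun i => lintegral_fiberSum (isOpen_intParam hB.isOpen h i).measurableSet isOpen_Ioo
    inter_subset_left (h' := fun t => (conj w * deriv (γ i) t).im)
    (fun t ht => hasDerivAt_conj_mul_im w (h.hasDerivAt i ht))
    (Complex.continuous_im.comp_continuousOn (continuousOn_const.mul (h.continuousOn_deriv i)))
    (hqm i)
  -- generic slices
  have ae1 : ∀ᵐ y, ∀ z ∈ IsArcSystem.endpoints γ, (conj w * z).im ≠ y := by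
    have : ∀ᵐ y : ℝ, y ∉ (fun z => (conj w * z).im) '' IsArcSystem.endpoints γ :=
      measure_eq_zero_iff_ae_notMem.1
        (((IsArcSystem.finite_endpoints γ).image _).measure_zero volume)
    filter_upwards [this] with y hy z hz hzy using hy ⟨z, hz, hzy⟩
  have ae2 : ∀ᵐ y, ∀ s ∈ Icc 0 T \ U, (conj w * p s).im ≠ y := by
    have : ∀ᵐ y : ℝ, y ∉ hp '' (Icc 0 T \ U) :=
      measure_eq_zero_iff_ae_notMem.1 ((hB.finite_diff.image _).measure_zero volume)
    filter_upwards [this] with y hy s hs hsy using hy ⟨s, hs, hsy⟩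
  have ae3 : ∀ᵐ y, ∀ s ∈ U, (conj w * p s).im = y → (conj w * deriv p s).im ≠ 0 := by
    have : ∀ᵐ y : ℝ, y ∉ hp '' {s | s ∈ U ∧ hp' s = 0} :=
      measure_eq_zero_iff_ae_notMem.1
        (volume_image_critical (fun s hs => hpd s hs.1) fun s hs => hs.2)
    filter_upwards [this] with y hy s hs hsy h0 using hy ⟨s, ⟨hs, h0⟩, hsy⟩
  have ae4 : ∀ᵐ y, (extParam p U Ω ∩ hp ⁻¹' {y}).Finite := by
    refine ae_finite_fiber hEm hB.isOpen_param inter_subset_left hpd hpc ?_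
    have : ∫⁻ t in extParam p U Ω, ENNReal.ofReal |hp' t| ≤
        ∫⁻ t in extParam p U Ω, ENNReal.ofReal L :=
      setLIntegral_mono measurable_const fun t ht => ENNReal.ofReal_le_ofReal (hp'b t ht.1)
    refine (this.trans_lt ?_).ne
    rw [setLIntegral_const]
    exact ENNReal.mul_lt_top ENNReal.ofReal_lt_top hEfin
  have ae5 := ae_all_iff.2 fun i => h.ae_finite_slice hw i
  -- On a generic line `F y` is the sum of drops times `g` over the points of `∂Ω`. Those outside
  -- `M` add up to `K y` exactly; those in `M` are bounded by their absolute values, where a drop is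
  -- at most one.
  have key : ∀ᵐ y, ‖F y - K y‖ₑ ≤ ∑ i, H i y := by
    filter_upwards [ae1, ae2, ae3, ae4, ae5] with y h1 h2 h3 h4 h5
    set O : Set ℝ := {x : ℝ | w * (x + y * Complex.I) ∈ Ω} with hO
    have hlc : Continuous fun x : ℝ => w * (x + y * Complex.I) := by fun_prop
    have hOo : IsOpen O := hΩ.preimage hlc
    have hre : ∀ x : ℝ, (conj w * (w * (x + y * Complex.I))).re = x := fun x => by
      rw [conj_mul_mul hw]; simp
    have him : ∀ x : ℝ, (conj w * (w * (x + y * Complex.I))).im = y := fun x => by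
      rw [conj_mul_mul hw]; simp
    have hOb : Bornology.IsBounded O := by
      obtain ⟨R, hR⟩ := hΩb.exists_norm_le
      refine isBounded_iff_forall_norm_le.2 ⟨R, fun x hx => ?_⟩
      refine le_trans ?_ (hR _ hx)
      have h6 := Complex.abs_re_le_norm (conj w * (w * (x + y * Complex.I)))
      rw [hre x, norm_mul, RCLike.norm_conj, hw, one_mul] at h6
      exact h6
    have hfin : {x : ℝ | w * (x + y * Complex.I) ∈ frontier Ω}.Finite := by
      refine (finite_iUnion fun i => (h5 i).image fun t => (conj w * γ i t).re).subset ?_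
      intro x hx
      obtain ⟨i, t, ht, hit⟩ := h.exists_interior hx fun h6 => h1 _ h6 (him x)
      refine mem_iUnion.2 ⟨i, t, ⟨ht, ?_⟩, ?_⟩
      · rw [mem_preimage, hit]; exact him x
      · simp only [hit]; exact hre x
    have hN : frontier O ⊆ hfin.toFinset := by
      rw [hfin.coe_toFinset]
      exact hlc.frontier_preimage_subset Ω
    have hdg : ∀ x : ℝ, HasDerivAt (fun x : ℝ => g (w * (x + y * Complex.I)))
        (fderiv ℝ g (w * (x + y * Complex.I)) w) x := fun x => by
      have h6 : HasDerivAt (fun x : ℝ => w * (x + y * Complex.I)) w x := by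
        have := (((hasDerivAt_id x).ofReal_comp).add_const (y * Complex.I)).const_mul w
        simpa using this
      exact ((hg.differentiable one_ne_zero) _).hasFDerivAt.comp_hasDerivAt x h6
    have hFy : F y = ∑ x ∈ hfin.toFinset, indicatorDrop O x * g (w * (x + y * Complex.I)) := by
      rw [← integral_deriv_eq_sum_indicatorDrop hOo hOb _ hN hdg (hgd.comp hlc),
        ← integral_indicator hOo.measurableSet]
      rfl
    have hKy : K y = ∑ s ∈ h4.toFinset, k s := by
      simp only [hKdef]
      rw [fiberSum_eq_sum (h4.coe_toFinset), fiberSum_eq_sum (h4.coe_toFinset),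
        ENNReal.toReal_sum (by simp), ENNReal.toReal_sum (by simp), ← Finset.sum_sub_distrib]
      refine Finset.sum_congr rfl fun s _ => ?_
      rw [ENNReal.toReal_ofReal', ENNReal.toReal_ofReal', max_zero_sub_max_neg_zero_eq_self]
    have hsplit := Finset.sum_filter_add_sum_filter_not hfin.toFinset
      (fun x : ℝ => w * (x + y * Complex.I) ∈ M)
      (fun x => indicatorDrop O x * g (w * (x + y * Complex.I)))
    have hext := hB.slice_sum_exterior hΩ hΩM h hw g
      (hfin.toFinset.filter fun x : ℝ => ¬ w * (x + y * Complex.I) ∈ M) h4.toFinset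
      (fun x => by simp) h4.coe_toFinset h1 h2 h3
    have hdiff : F y - K y = ∑ x ∈ hfin.toFinset.filter fun x : ℝ => w * (x + y * Complex.I) ∈ M,
        indicatorDrop O x * g (w * (x + y * Complex.I)) := by
      rw [hFy, hKy, ← hsplit, hext]
      simp only [hk, hhp']
      ring
    rw [hdiff]
    have h5' : ∀ i, (intParam (γ i) M ∩ (fun t => (conj w * γ i t).im) ⁻¹' {y}).Finite := fun i =>
      (h5 i).subset (inter_subset_inter_left _ inter_subset_left)
    have hint := slice_sum_interior (M := M) h hw (fun z => ENNReal.ofReal |g z|)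
      (hfin.toFinset.filter fun x : ℝ => w * (x + y * Complex.I) ∈ M) (fun i => (h5' i).toFinset)
      (fun x hx => by simpa using hx) (fun i => (h5' i).coe_toFinset) h1
    calc _ ≤ ∑ x ∈ hfin.toFinset.filter fun x : ℝ => w * (x + y * Complex.I) ∈ M,
          ‖indicatorDrop O x * g (w * (x + y * Complex.I))‖ₑ := enorm_sum_le _ _
      _ ≤ ∑ x ∈ hfin.toFinset.filter fun x : ℝ => w * (x + y * Complex.I) ∈ M,
          ENNReal.ofReal |g (w * (x + y * Complex.I))| := by
        refine Finset.sum_le_sum fun x _ => ?_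
        rw [← ofReal_norm, norm_mul, Real.norm_eq_abs, Real.norm_eq_abs]
        exact ENNReal.ofReal_le_ofReal
          (mul_le_of_le_one_left (abs_nonneg _) (abs_indicatorDrop_le O x))
      _ ≤ _ := hint
      _ = _ := by
        refine Finset.sum_congr rfl fun i _ => ?_
        rw [hH]
        simp only
        rw [fiberSum_eq_sum ((h5' i).coe_toFinset)]
        refine Finset.sum_congr rfl fun t ht => ?_
        rw [hqi]
        have : t ∈ intParam (γ i) M ∩ (fun t => (conj w * γ i t).im) ⁻¹' {y} := by simpa using ht
        exact this.1.1
  rw [hsl.2, ← hKint, ← integral_sub hsl.1 hK.1, ← Real.enorm_eq_ofReal_abs]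
  calc _ ≤ ∫⁻ y, ‖F y - K y‖ₑ := enorm_integral_le_lintegral_enorm _
    _ ≤ ∫⁻ y, ∑ i, H i y := lintegral_mono_ae key
    _ = ∑ i, ∫⁻ y, H i y := lintegral_finsetSum' _ fun i _ => (hHi i).1
    _ = _ := by
      refine Finset.sum_congr rfl fun i _ => ?_
      rw [(hHi i).2]
      refine setLIntegral_congr_fun (isOpen_intParam hB.isOpen h i).measurableSet fun t ht => ?_
      rw [hqi i t ht.1, ENNReal.ofReal_mul (abs_nonneg _)]

end BoundaryCurve

/-- With suitable signs the left side is `D` at a vector whose coordinates are those of `z` up to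
sign, so of the same norm. Thus the horizontal and vertical halves of Green's formula combine
without loss of a factor. -/
lemma ContinuousLinearMap.abs_re_mul_add_abs_im_mul_le {D : ℂ →L[ℝ] ℝ} (hD : ‖D‖ ≤ 1) (z : ℂ) :
    |z.im| * |D Complex.I| + |z.re| * |D 1| ≤ ‖z‖ := by
  have key : ∀ a b : ℝ, |a| = |z.re| → |b| = |z.im| → b * D Complex.I + a * D 1 ≤ ‖z‖ := by
    intro a b ha hb
    have h1 : D (a + b * Complex.I) = b * D Complex.I + a * D 1 := by
      have : (a + b * Complex.I : ℂ) = a • (1 : ℂ) + b • Complex.I := by simp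
      rw [this, map_add, map_smul, map_smul, smul_eq_mul, smul_eq_mul, add_comm]
    have h2 : ‖(a + b * Complex.I : ℂ)‖ = ‖z‖ := by
      rw [Complex.norm_add_mul_I, Complex.norm_eq_sqrt_sq_add_sq, ← sq_abs a, ← sq_abs b, ha, hb,
        sq_abs, sq_abs]
    rw [← h1, ← h2]
    exact (le_abs_self _).trans (D.le_of_opNorm_le hD _ |>.trans_eq (one_mul _))
  rcases abs_choice (D Complex.I) with h1 | h1 <;> rcases abs_choice (D 1) with h2 | h2 <;>
    rw [h1, h2]
  · exact key |z.re| |z.im| (abs_abs _) (abs_abs _)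
  · have := key (-|z.re|) |z.im| (by simp) (by simp); linarith
  · have := key |z.re| (-|z.im|) (by simp) (by simp); linarith
  · have := key (-|z.re|) (-|z.im|) (by simp) (by simp); linarith

namespace BoundaryCurve

variable {M : Set ℂ} {T : ℝ} {p : ℝ → ℂ} {U : Set ℝ} {Ω : Set ℂ} {m : ℕ} {γ : Fin m → ℝ → ℂ}

/-- The arcs are injective and mutually disjoint off their end points, so their lengths add up
within the Hausdorff measure. -/
lemma sum_lintegral_norm_deriv_le (hM : IsOpen M) (h : IsArcSystem Ω γ) :
    ∑ i, ∫⁻ t in intParam (γ i) M, ‖deriv (γ i) t‖ₑ ≤ μH[1] (interiorBoundary M Ω) := by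
  have hm : ∀ i, MeasurableSet (intParam (γ i) M) := fun i =>
    (isOpen_intParam hM h i).measurableSet
  have hinj : ∀ i, InjOn (γ i) (intParam (γ i) M) := fun i s hs t ht hst =>
    (h.eq_of_interior hs.1 (Ioo_subset_Icc_self ht.1) hst).2
  have hc : ∀ i, ContinuousOn (γ i) (intParam (γ i) M) := fun i =>
    (h.smooth i).continuousOn.mono (inter_subset_left.trans Ioo_subset_Icc_self)
  calc _ ≤ ∑ i, μH[1] (γ i '' intParam (γ i) M) := by
        refine Finset.sum_le_sum fun i _ => ?_
        exact lintegral_norm_deriv_le_hausdorff (hm i) isOpen_Ioo inter_subset_left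
          (measure_mono inter_subset_left |>.trans_lt measure_Ioo_lt_top).ne
          (fun t ht => h.hasDerivAt i ht) (h.continuousOn_deriv i) (hinj i)
    _ = μH[1] (⋃ i, γ i '' intParam (γ i) M) := by
        rw [measure_iUnion, tsum_fintype]
        · intro i j hij
          refine disjoint_left.2 ?_
          rintro _ ⟨s, hs, rfl⟩ ⟨t, ht, hst⟩
          exact hij (h.eq_of_interior hs.1 (Ioo_subset_Icc_self ht.1) hst.symm).1
        · exact fun i => (hm i).image_of_continuousOn_injOn (hc i) (hinj i)
    _ ≤ _ := by
        refine measure_mono (iUnion_subset fun i => ?_)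
        rintro _ ⟨t, ht, rfl⟩
        exact ⟨h.mem_frontier i (Ioo_subset_Icc_self ht.1), ht.2⟩

/-- The integral of `du` over the exterior boundary is at most the length of the interior
boundary, if `u` is `C²` with gradient at most one. -/
theorem ofReal_integral_fderiv_le (hB : BoundaryCurve M T p U) {L : ℝ}
    (hL : ∀ s ∈ U, ‖deriv p s‖ ≤ L) (hΩ : IsOpen Ω) (hΩM : Ω ⊆ M)
    (h : IsArcSystem Ω γ) {u : ℂ → ℝ} (hu : ContDiff ℝ 2 u) (hu1 : ∀ z, ‖fderiv ℝ u z‖ ≤ 1) :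
    ENNReal.ofReal (∫ s in extParam p U Ω, fderiv ℝ u (p s) (deriv p s)) ≤
      μH[1] (interiorBoundary M Ω) := by
  have hdu : ContDiff ℝ 1 (fderiv ℝ u) := hu.fderiv_right (by norm_num)
  have hg : ∀ v : ℂ, ContDiff ℝ 1 fun z => fderiv ℝ u z v := fun v =>
    hdu.clm_apply contDiff_const
  have hgd : ∀ v v' z : ℂ, fderiv ℝ (fun z => fderiv ℝ u z v) z v' =
      fderiv ℝ (fderiv ℝ u) z v' v := fun v v' z => by
    have h1 := ((hdu.differentiable one_ne_zero) z).hasFDerivAt.clm_apply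
      (hasFDerivAt_const v z)
    rw [h1.fderiv]
    simp
  have hsymm : ∀ z, fderiv ℝ (fderiv ℝ u) z 1 Complex.I = fderiv ℝ (fderiv ℝ u) z Complex.I 1 :=
    fun z => (hu.contDiffAt.isSymmSndFDerivAt (by simp)) 1 Complex.I
  -- Slicing along `1` with `∂u/∂y` and along `I` with `∂u/∂x` produces the same area integral `F`
  -- by symmetry of the second derivative. It cancels in `a + b = (F + b) - (F - a)`.
  have e1 := hB.ofReal_abs_integral_sub_le hL hΩ hΩM h (w := 1) (by simp) (hg Complex.I)
  have e2 := hB.ofReal_abs_integral_sub_le hL hΩ hΩM h (w := Complex.I) (by simp) (hg 1)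
  simp only [hgd, map_one, one_mul, Complex.conj_I] at e1 e2
  simp only [hsymm] at e1
  have hIm : ∀ z : ℂ, (-Complex.I * z).im = -z.re := fun z => by simp
  simp only [hIm, abs_neg, mul_neg, integral_neg, sub_neg_eq_add] at e2
  have hEm : MeasurableSet (extParam p U Ω) := hB.measurableSet_extParam
  have hEfin : volume (extParam p U Ω) < ⊤ :=
    (measure_mono (inter_subset_left.trans hB.param_subset)).trans_lt measure_Ioo_lt_top
  have hdp : Measurable (deriv p) := measurable_deriv p
  have hbd : ∀ v : ℂ, ‖v‖ ≤ 1 → ∀ z, ‖fderiv ℝ u z v‖ ≤ 1 := fun v hv z =>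
    ((fderiv ℝ u z).le_of_opNorm_le (hu1 z) v).trans (by simpa using hv)
  have hint : ∀ (v : ℂ), ‖v‖ ≤ 1 → ∀ (a : ℂ → ℝ), Measurable a → (∀ z, |a z| ≤ ‖z‖) →
      IntegrableOn (fun s => fderiv ℝ u (p s) v * a (deriv p s)) (extParam p U Ω) := by
    intro v hv a ha haz
    refine Measure.integrableOn_of_bounded (M := 1 * L) hEfin.ne ?_ ?_
    · exact (((hg v).continuous.comp hB.continuous).measurable.mul
        (ha.comp hdp)).aestronglyMeasurable
    · refine (ae_restrict_iff' hEm).2 (Eventually.of_forall fun s hs => ?_)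
      rw [norm_mul]
      exact mul_le_mul (hbd v hv _) ((haz _).trans (hL s hs.1)) (norm_nonneg _) zero_le_one
  have hi1 := hint Complex.I (by simp) Complex.im Complex.measurable_im Complex.abs_im_le_norm
  have hi2 := hint 1 (by simp) Complex.re Complex.measurable_re Complex.abs_re_le_norm
  have hsum : ∫ s in extParam p U Ω, fderiv ℝ u (p s) (deriv p s) =
      (∫ s in extParam p U Ω, fderiv ℝ u (p s) Complex.I * (deriv p s).im) +
      ∫ s in extParam p U Ω, fderiv ℝ u (p s) 1 * (deriv p s).re := by
    rw [← integral_add hi1 hi2]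
    refine integral_congr_ae (Eventually.of_forall fun s => ?_)
    have h1 : deriv p s = (deriv p s).re • (1 : ℂ) + (deriv p s).im • Complex.I := by
      simp [Complex.re_add_im]
    have h2 : fderiv ℝ u (p s) (deriv p s) = (deriv p s).re * fderiv ℝ u (p s) 1 +
        (deriv p s).im * fderiv ℝ u (p s) Complex.I := by
      conv_lhs => rw [h1]
      rw [map_add, map_smul, map_smul, smul_eq_mul, smul_eq_mul]
    simp only [h2]
    ring
  rw [hsum]
  set a := ∫ s in extParam p U Ω, fderiv ℝ u (p s) Complex.I * (deriv p s).im
  set b := ∫ s in extParam p U Ω, fderiv ℝ u (p s) 1 * (deriv p s).re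
  set F := ∫ z in Ω, fderiv ℝ (fderiv ℝ u) z Complex.I 1
  calc ENNReal.ofReal (a + b) ≤ ENNReal.ofReal (|F - a| + |F + b|) := by
        refine ENNReal.ofReal_le_ofReal ?_
        have h1 := neg_abs_le (F - a)
        have h2 := le_abs_self (F + b)
        linarith
    _ = ENNReal.ofReal |F - a| + ENNReal.ofReal |F + b| :=
        ENNReal.ofReal_add (abs_nonneg _) (abs_nonneg _)
    _ ≤ _ := add_le_add e1 e2
    _ ≤ ∑ i, ∫⁻ t in intParam (γ i) M, ‖deriv (γ i) t‖ₑ := by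
        rw [← Finset.sum_add_distrib]
        refine Finset.sum_le_sum fun i _ => (le_lintegral_add _ _).trans ?_
        refine lintegral_mono fun t => ?_
        rw [← ENNReal.ofReal_add (by positivity) (by positivity), ← ofReal_norm]
        exact ENNReal.ofReal_le_ofReal
          (ContinuousLinearMap.abs_re_mul_add_abs_im_mul_le (hu1 _) _)
    _ ≤ _ := sum_lintegral_norm_deriv_le hB.isOpen h

end BoundaryCurve

/-! ### The calibration and the isoperimetric inequality -/

/-- Lipschitz functions on the plane are uniform limits of smooth functions with the same
Lipschitz constant. -/
lemma LipschitzWith.exists_contDiff_approx {u : ℂ → ℝ} (hu : LipschitzWith 1 u) {ε : ℝ}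
    (hε : 0 < ε) :
    ∃ v : ℂ → ℝ, ContDiff ℝ ∞ v ∧ LipschitzWith 1 v ∧ ∀ z, |v z - u z| ≤ ε := by
  let φ : ContDiffBump (0 : ℂ) := ⟨ε / 2, ε, by positivity, by linarith⟩
  let v := convolution (φ.normed volume) u (ContinuousLinearMap.lsmul ℝ ℝ) volume
  have hsm := hu.continuous.aestronglyMeasurable (μ := (volume : Measure ℂ))
  refine ⟨v, ?_, ?_, ?_⟩
  · exact φ.hasCompactSupport_normed.contDiff_convolution_left _ φ.contDiff_normed
      hu.continuous.locallyIntegrable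
  · refine LipschitzWith.of_dist_le_mul fun x y => ?_
    have hce : ConvolutionExists (φ.normed volume) u (ContinuousLinearMap.lsmul ℝ ℝ) volume :=
      φ.hasCompactSupport_normed.convolutionExists_left _ φ.continuous_normed
        hu.continuous.locallyIntegrable
    rw [dist_eq_norm]
    have h1 : v x - v y = ∫ t, φ.normed volume t * (u (x - t) - u (y - t)) := by
      simp only [v, convolution]
      rw [← integral_sub (hce x) (hce y)]
      simp [mul_sub]
    rw [h1]
    have h2 : ∀ t, ‖φ.normed volume t * (u (x - t) - u (y - t))‖ ≤ φ.normed volume t * dist x y := by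
      intro t
      rw [norm_mul, Real.norm_of_nonneg (φ.nonneg_normed t)]
      refine mul_le_mul_of_nonneg_left ?_ (φ.nonneg_normed t)
      have := hu.dist_le_mul (x - t) (y - t)
      simpa [dist_eq_norm] using this
    refine (norm_integral_le_of_norm_le (φ.integrable_normed.mul_const _)
      (Eventually.of_forall h2)).trans ?_
    rw [integral_mul_const, φ.integral_normed]
    simp
  · intro z
    have := φ.dist_normed_convolution_le (μ := volume) (g := u) (x₀ := z) (ε := ε) hsm
      fun x hx => by
        have h1 := hu.dist_le_mul x z
        simp only [NNReal.coe_one, one_mul] at h1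
        exact h1.trans (Metric.mem_ball.1 hx).le
    exact this

/-- A measurable subset of an open interval is approximated in `L¹` by smooth functions. -/
lemma exists_contDiff_approx_indicator {E : Set ℝ} (hE : MeasurableSet E) {T : ℝ}
    (hET : E ⊆ Ioo 0 T) {δ : ℝ} (hδ : 0 < δ) :
    ∃ φ : ℝ → ℝ, ContDiff ℝ 1 φ ∧ (∀ s, φ s ∈ Icc (0 : ℝ) 1) ∧ φ 0 = 0 ∧ φ T = 0 ∧
      ∫ s in Ioc 0 T, |φ s - E.indicator 1 s| ≤ δ := by
  have hfin : volume E ≠ ⊤ := ((measure_mono hET).trans_lt measure_Ioo_lt_top).ne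
  have hδ' : ENNReal.ofReal (δ / 2) ≠ 0 := by simpa using hδ
  -- Squeeze `E` between a compact and an open set. A smooth Urysohn function differs from the
  -- indicator only on their difference, and cutting `V` down to `(0, T)` makes it vanish at both
  -- ends.
  obtain ⟨K, hKE, hK, hEK⟩ := hE.exists_isCompact_sdiff_lt hfin hδ'
  obtain ⟨V, hEV, hV, -, hVE⟩ := hE.exists_isOpen_sdiff_lt hfin hδ'
  set W := V ∩ Ioo 0 T with hW
  have hWo : IsOpen W := hV.inter isOpen_Ioo
  have hKW : K ⊆ W := fun x hx => ⟨hEV (hKE hx), hET (hKE hx)⟩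
  obtain ⟨f, hf0, hf1, hf⟩ := exists_contMDiffMap_zero_one_of_isClosed (n := 1)
    (modelWithCornersSelf ℝ ℝ) hWo.isClosed_compl hK.isClosed
    (disjoint_compl_left.mono_right hKW)
  refine ⟨f, contMDiff_iff_contDiff.1 f.contMDiff, hf, hf0 fun h => h.2.1.false,
    hf0 fun h => h.2.2.false, ?_⟩
  set B := (E \ K) ∪ (V \ E) with hBdef
  have hBm : MeasurableSet B := (hE.diff hK.measurableSet).union (hV.measurableSet.diff hE)
  have hBv : volume B ≤ ENNReal.ofReal δ := by
    refine (measure_union_le _ _).trans ((add_le_add hEK.le hVE.le).trans_eq ?_)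
    rw [← ENNReal.ofReal_add (by positivity) (by positivity), add_halves]
  have hle : ∀ s, |f s - E.indicator 1 s| ≤ B.indicator 1 s := by
    intro s
    have hs := hf s
    by_cases hsB : s ∈ B
    · rw [indicator_of_mem hsB]
      by_cases hsE : s ∈ E
      · rw [indicator_of_mem hsE, Pi.one_apply, abs_le]
        constructor <;> linarith [hs.1, hs.2]
      · rw [indicator_of_notMem hsE, Pi.one_apply, abs_le]
        constructor <;> linarith [hs.1, hs.2]
    · rw [indicator_of_notMem hsB]
      by_cases hsE : s ∈ E
      · have hsK : s ∈ K := by_contra fun h => hsB (Or.inl ⟨hsE, h⟩)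
        rw [indicator_of_mem hsE, hf1 hsK]
        simp
      · have hsV : s ∉ V := fun h => hsB (Or.inr ⟨h, hsE⟩)
        rw [indicator_of_notMem hsE, hf0 fun h => hsV h.1]
        simp
  have hBi : Integrable (B.indicator (1 : ℝ → ℝ)) :=
    (integrable_indicator_iff hBm).2 (integrableOn_const
      (hBv.trans_lt ENNReal.ofReal_lt_top).ne (by simp))
  calc ∫ s in Ioc 0 T, |f s - E.indicator 1 s| ≤ ∫ s in Ioc 0 T, B.indicator (1 : ℝ → ℝ) s := by
        refine integral_mono_of_nonneg (Eventually.of_forall fun _ => abs_nonneg _)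
          hBi.integrableOn (Eventually.of_forall hle)
    _ ≤ ∫ s, B.indicator (1 : ℝ → ℝ) s :=
        setIntegral_le_integral hBi (Eventually.of_forall fun s =>
          indicator_nonneg (fun _ _ => zero_le_one) s)
    _ = (volume B).toReal := by
        rw [integral_indicator_one hBm]; rfl
    _ ≤ δ := ENNReal.toReal_le_of_le_ofReal hδ.le hBv

/-- The circular distance between parameters in `[0, T]`, truncated at one. -/
noncomputable def circDist (T s t : ℝ) : ℝ := min (min |s - t| (T - |s - t|)) 1

/-- The primitive of a density `φ`, tilted so as to be `T`-periodic, varies at most like the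
truncated circular distance. -/
lemma abs_tilted_primitive_sub_le {φ : ℝ → ℝ} (hφ : Continuous φ) (h01 : ∀ s, φ s ∈ Icc (0 : ℝ) 1)
    {T c κ K : ℝ} (hc : 0 ≤ c) (hcK : c ≤ K) (hκ : 0 ≤ κ)
    (hK : c * (∫ s in (0)..T, φ s) ≤ K)
    (hκT : κ * (T - ∫ s in (0)..T, φ s) = c * ∫ s in (0)..T, φ s) (hκc : κ ≤ c) {s t : ℝ}
    (hs : s ∈ Icc 0 T) (ht : t ∈ Icc 0 T) :
    |(∫ x in (0)..s, ((c + κ) * φ x - κ)) - ∫ x in (0)..t, ((c + κ) * φ x - κ)| ≤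
      K * circDist T s t := by
  wlog hst : s ≤ t generalizing s t with H
  · have := H ht hs (le_of_not_ge hst)
    rwa [abs_sub_comm, circDist, abs_sub_comm s t]
  have hi : ∀ a b, IntervalIntegrable φ volume a b := fun a b => hφ.intervalIntegrable a b
  have hi' : ∀ a b, IntervalIntegrable (fun x => (c + κ) * φ x - κ) volume a b := fun a b =>
    Continuous.intervalIntegrable (by fun_prop) a b
  have hval : ∀ a b, ∫ x in a..b, ((c + κ) * φ x - κ) = (c + κ) * (∫ x in a..b, φ x) - κ * (b - a) := by
    intro a b
    rw [intervalIntegral.integral_sub ((hi a b).const_mul _) (by simp),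
      intervalIntegral.integral_const_mul, intervalIntegral.integral_const, smul_eq_mul, mul_comm κ]
  have hsub : (∫ x in (0)..s, ((c + κ) * φ x - κ)) - ∫ x in (0)..t, ((c + κ) * φ x - κ) =
      -∫ x in s..t, ((c + κ) * φ x - κ) := by
    rw [← intervalIntegral.integral_add_adjacent_intervals (hi' 0 s) (hi' s t)]; ring
  have h0 : ∀ a b, a ≤ b → 0 ≤ ∫ x in a..b, φ x := fun a b hab =>
    intervalIntegral.integral_nonneg hab fun x _ => (h01 x).1
  have h1 : ∀ a b, a ≤ b → ∫ x in a..b, φ x ≤ b - a := fun a b hab => by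
    have := intervalIntegral.integral_mono_on hab (hi a b)
      (by simp : IntervalIntegrable (fun _ => (1 : ℝ)) volume a b) fun x _ => (h01 x).2
    simpa using this
  have hadd : (∫ x in (0)..s, φ x) + (∫ x in s..t, φ x) + (∫ x in t..T, φ x) =
      ∫ x in (0)..T, φ x := by
    rw [intervalIntegral.integral_add_adjacent_intervals (hi 0 s) (hi s t),
      intervalIntegral.integral_add_adjacent_intervals (hi 0 t) (hi t T)]
  rw [hsub, abs_neg, hval, circDist, abs_sub_comm s t, abs_of_nonneg (sub_nonneg.2 hst)]
  have a1 := h0 0 s hs.1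
  have a2 := h0 s t hst
  have a3 := h0 t T ht.2
  have b1 := h1 0 s hs.1
  have b2 := h1 s t hst
  have b3 := h1 t T ht.2
  set I := ∫ x in s..t, φ x
  set A := ∫ x in (0)..s, φ x
  set B := ∫ x in t..T, φ x
  set Λ := ∫ x in (0)..T, φ x
  set d := t - s with hd
  have hd0 : 0 ≤ d := sub_nonneg.2 hst
  have hTd : A + B ≤ T - d := by rw [hd]; linarith
  have hJ : A + B = Λ - I := by linarith
  -- By periodicity the increment over `[s, t]` is minus that over the complementary arc. The slope
  -- lies in `[-κ, c]`, so the two expressions give the bounds `K * d` and `K * (T - d)`; the total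
  -- rise `c * Λ ≤ K` gives the bound `K` from both sides.
  have e1 : (c + κ) * I - κ * d = κ * ((T - d) - (A + B)) - c * (A + B) := by
    rw [hJ]; linear_combination -hκT
  have p1 : 0 ≤ κ * (d - I) := mul_nonneg hκ (by linarith)
  have p2 : 0 ≤ κ * ((T - d) - (A + B)) := mul_nonneg hκ (by linarith)
  have p3 : 0 ≤ c * (A + B) := by positivity
  have p4 : 0 ≤ c * I := mul_nonneg hc a2
  have p5 : c * I ≤ c * d := mul_le_mul_of_nonneg_left b2 hc
  have p6 : c * (A + B) ≤ c * (T - d) := mul_le_mul_of_nonneg_left hTd hc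
  have p7 : c * I ≤ c * Λ := mul_le_mul_of_nonneg_left (by linarith) hc
  have p8 : c * (A + B) ≤ c * Λ := mul_le_mul_of_nonneg_left (by linarith) hc
  have p9 : κ * (d - I) ≤ c * (d - I) := mul_le_mul_of_nonneg_right hκc (by linarith)
  have p10 : κ * ((T - d) - (A + B)) ≤ c * ((T - d) - (A + B)) :=
    mul_le_mul_of_nonneg_right hκc (by linarith)
  have p11 : c * d ≤ K * d := mul_le_mul_of_nonneg_right hcK hd0
  have p12 : c * (T - d) ≤ K * (T - d) := mul_le_mul_of_nonneg_right hcK (by linarith)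
  have hKmin : K * min (min d (T - d)) 1 = min (min (K * d) (K * (T - d))) K := by
    rw [mul_min_of_nonneg _ _ (hc.trans hcK), mul_min_of_nonneg _ _ (hc.trans hcK), mul_one]
  rw [hKmin, le_min_iff, le_min_iff, abs_le, abs_le, abs_le]
  refine ⟨⟨⟨?_, ?_⟩, ?_, ?_⟩, ?_, ?_⟩ <;> linarith

/-- The hypothesis forces `f` to agree at parameters with the same image, such as the two ends of a
closed curve, so `f` descends to the curve as a 1-Lipschitz function and extends to the plane. -/
lemma exists_lipschitz_extension_comp {p : ℝ → ℂ} {S : Set ℝ} {f : ℝ → ℝ}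
    (h : ∀ s ∈ S, ∀ t ∈ S, |f s - f t| ≤ ‖p s - p t‖) :
    ∃ u : ℂ → ℝ, LipschitzWith 1 u ∧ ∀ s ∈ S, u (p s) = f s := by
  classical
  have hex : ∀ z ∈ p '' S, ∃ s ∈ S, p s = z := fun z hz => hz
  choose! σ hσS hσ using hex
  have hL : LipschitzOnWith 1 (fun z => f (σ z)) (p '' S) := by
    refine LipschitzOnWith.of_dist_le_mul fun x hx y hy => ?_
    have := h _ (hσS x hx) _ (hσS y hy)
    rw [hσ x hx, hσ y hy] at this
    simpa [dist_eq_norm] using this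
  obtain ⟨u, hu, huf⟩ := hL.extend_real
  refine ⟨u, hu, fun s hs => ?_⟩
  have hm : p s ∈ p '' S := ⟨s, hs, rfl⟩
  rw [← huf hm]
  have := h _ (hσS _ hm) s hs
  rw [hσ _ hm, sub_self, norm_zero] at this
  exact sub_eq_zero.1 (abs_nonpos_iff.1 this)

namespace BoundaryCurve

variable {M : Set ℂ} {T : ℝ} {p : ℝ → ℂ} {U : Set ℝ} {Ω : Set ℂ} {m : ℕ} {γ : Fin m → ℝ → ℂ}

lemma ae_mem (hB : BoundaryCurve M T p U) : ∀ᵐ s ∂volume.restrict (Ioc 0 T), s ∈ U := by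
  rw [ae_restrict_iff' measurableSet_Ioc]
  have : ∀ᵐ s : ℝ, s ∉ Icc 0 T \ U :=
    measure_eq_zero_iff_ae_notMem.1 (hB.finite_diff.measure_zero volume)
  filter_upwards [this] with s hs hsT
  exact by_contra fun h => hs ⟨Ioc_subset_Icc_self hsT, h⟩

/-- Integration by parts along the boundary curve. -/
lemma integral_mul_fderiv_eq (hB : BoundaryCurve M T p U) (hT : 0 ≤ T) {L : ℝ}
    (hL : ∀ s ∈ U, ‖deriv p s‖ ≤ L) {v : ℂ → ℝ} (hv : ContDiff ℝ 1 v)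
    (hv1 : ∀ z, ‖fderiv ℝ v z‖ ≤ 1) {φ : ℝ → ℝ} (hφ : ContDiff ℝ 1 φ) (h0 : φ 0 = 0)
    (h1 : φ T = 0) :
    IntegrableOn (fun s => fderiv ℝ v (p s) (deriv p s)) (Ioc 0 T) ∧
    ∫ s in Ioc 0 T, φ s * fderiv ℝ v (p s) (deriv p s) =
      -∫ s in Ioc 0 T, deriv φ s * v (p s) := by
  have hD : ∀ s ∈ U, ‖fderiv ℝ v (p s) (deriv p s)‖ ≤ L := fun s hs =>
    ((fderiv ℝ v (p s)).le_of_opNorm_le (hv1 _) _).trans (by simpa using hL s hs)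
  have hm : Measurable fun s => fderiv ℝ v (p s) (deriv p s) := by
    have h2 : (fun s => fderiv ℝ v (p s) (deriv p s)) = fun s =>
        (deriv p s).re * fderiv ℝ v (p s) 1 + (deriv p s).im * fderiv ℝ v (p s) Complex.I := by
      ext s
      have h1 : deriv p s = (deriv p s).re • (1 : ℂ) + (deriv p s).im • Complex.I := by
        simp [Complex.re_add_im]
      conv_lhs => rw [h1]
      rw [map_add, map_smul, map_smul, smul_eq_mul, smul_eq_mul]
    rw [h2]
    have hc : ∀ w : ℂ, Measurable fun s => fderiv ℝ v (p s) w := fun w =>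
      (((hv.continuous_fderiv one_ne_zero).comp hB.continuous).clm_apply
        continuous_const).measurable
    have hd := measurable_deriv p
    exact ((Complex.measurable_re.comp hd).mul (hc 1)).add
      ((Complex.measurable_im.comp hd).mul (hc Complex.I))
  have hDi : IntegrableOn (fun s => fderiv ℝ v (p s) (deriv p s)) (Ioc 0 T) := by
    refine Measure.integrableOn_of_bounded (M := L) measure_Ioc_lt_top.ne
      hm.aestronglyMeasurable ?_
    filter_upwards [hB.ae_mem] with s hs using hD s hs
  refine ⟨hDi, ?_⟩
  have hvp : Continuous fun s => v (p s) := hv.continuous.comp hB.continuous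
  have hφ' : Continuous (deriv φ) := hφ.continuous_deriv le_rfl
  have i1 : IntegrableOn (fun s => deriv φ s * v (p s)) (Ioc 0 T) :=
    (Continuous.integrableOn_Icc (hφ'.mul hvp)).mono_set Ioc_subset_Icc_self
  have i2 : IntegrableOn (fun s => φ s * fderiv ℝ v (p s) (deriv p s)) (Ioc 0 T) := by
    obtain ⟨C, hC⟩ := (isCompact_Icc (a := (0 : ℝ)) (b := T)).exists_bound_of_continuousOn
      hφ.continuous.continuousOn
    refine hDi.bdd_mul hφ.continuous.aestronglyMeasurable (c := C) ?_
    exact (ae_restrict_iff' measurableSet_Ioc).2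
      (Eventually.of_forall fun s hs => hC s (Ioc_subset_Icc_self hs))
  have key := MeasureTheory.integral_eq_of_hasDerivAt_off_countable (a := 0) (b := T)
    (fun s => φ s * v (p s))
    (fun s => deriv φ s * v (p s) + φ s * fderiv ℝ v (p s) (deriv p s))
    hB.finite_diff.countable (hφ.continuous.mul hvp).continuousOn (fun s hs => by
      rw [min_eq_left hT, max_eq_right hT] at hs
      have hsU : s ∈ U := by_contra fun h => hs.2 ⟨Ioo_subset_Icc_self hs.1, h⟩
      have hp := (hB.differentiableAt s hsU).hasDerivAt
      have h3 := ((hv.differentiable one_ne_zero) (p s)).hasFDerivAt.comp_hasDerivAt s hp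
      have h4 := ((hφ.differentiable one_ne_zero) s).hasDerivAt
      exact h4.mul h3)
    (by
      rw [intervalIntegrable_iff, uIoc_of_le hT]
      exact i1.add i2)
  rw [intervalIntegral.integral_of_le hT, integral_add i1 i2, h0, h1] at key
  simp only [zero_mul, sub_self] at key
  linarith

/-- The isoperimetric inequality behind the lower bounds: if the boundary curve satisfies a
chord-arc condition at parameter distances up to one, then a domain whose exterior boundary has
parameter measure at most one has a long interior boundary. -/
theorem mul_volume_extParam_le (hB : BoundaryCurve M T p U) (hT : 3 ≤ T) {L K : ℝ} (hL0 : 0 ≤ L)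
    (hK : 0 ≤ K) (hL : ∀ s ∈ U, ‖deriv p s‖ ≤ L)
    (hchord : ∀ s ∈ Icc 0 T, ∀ t ∈ Icc 0 T, K * circDist T s t ≤ ‖p s - p t‖)
    (hΩ : IsOpen Ω) (hΩM : Ω ⊆ M) (h : IsArcSystem Ω γ) (hE : volume (extParam p U Ω) ≤ 1) :
    ENNReal.ofReal K * volume (extParam p U Ω) ≤ μH[1] (interiorBoundary M Ω) := by
  rcases eq_or_ne (μH[1] (interiorBoundary M Ω)) ⊤ with htop | htop
  · rw [htop]; exact le_top
  set E := extParam p U Ω with hEdef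
  set X := (μH[1] (interiorBoundary M Ω)).toReal with hX
  set l := (volume E).toReal with hl
  have hT0 : 0 ≤ T := by linarith
  have hEfin : volume E ≠ ⊤ := (hE.trans_lt ENNReal.one_lt_top).ne
  have hl1 : l ≤ 1 := ENNReal.toReal_le_of_le_ofReal zero_le_one (by simpa using hE)
  have hEm : MeasurableSet E := hB.measurableSet_extParam
  have hET : E ⊆ Ioo 0 T := inter_subset_left.trans hB.param_subset
  have hET' : E ⊆ Ioc 0 T := hET.trans Ioo_subset_Ioc_self
  have main : ∀ δ : ℝ, 0 < δ → δ ≤ 1 / 2 →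
      K / (1 + δ) * l - 3 * (K / (1 + δ)) * δ - L * δ ≤ X := by
    intro δ hδ hδ2
    obtain ⟨φ, hφ, h01, hφ0, hφT, hφE⟩ := exists_contDiff_approx_indicator hEm hET hδ
    have hφc := hφ.continuous
    have hEi : IntegrableOn (E.indicator (1 : ℝ → ℝ)) (Ioc 0 T) :=
      ((integrable_indicator_iff hEm).2 (integrableOn_const hEfin (by simp))).integrableOn
    have hφi : IntegrableOn φ (Ioc 0 T) := hφc.integrableOn_Icc.mono_set Ioc_subset_Icc_self
    have hEl : ∫ s in Ioc 0 T, E.indicator (1 : ℝ → ℝ) s = l := by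
      rw [integral_indicator_one hEm, measureReal_restrict_apply hEm, inter_eq_left.2 hET']
      rfl
    have hdi : IntegrableOn (fun s => |φ s - E.indicator 1 s|) (Ioc 0 T) := (hφi.sub hEi).abs
    set Λ := ∫ s in (0)..T, φ s with hΛ
    have hΛI : Λ = ∫ s in Ioc 0 T, φ s := intervalIntegral.integral_of_le hT0
    have hΛ0 : 0 ≤ Λ := intervalIntegral.integral_nonneg hT0 fun x _ => (h01 x).1
    have hΛ1 : Λ ≤ 1 + δ := by
      have : Λ - l ≤ δ := by
        rw [hΛI, ← hEl, ← integral_sub hφi hEi]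
        exact (integral_mono (hφi.sub hEi) hdi fun s => le_abs_self _).trans hφE
      linarith
    -- The mollified indicator may have integral up to `1 + δ`; the smaller slope keeps the total
    -- rise `c * Λ` below `K`.
    set c := K / (1 + δ) with hc
    have hc0 : 0 ≤ c := by positivity
    have hcK : c ≤ K := div_le_self hK (by linarith)
    have hTΛ : 0 < T - Λ := by linarith
    set κ := c * Λ / (T - Λ) with hκ
    have hκ0 : 0 ≤ κ := by positivity
    have hκT : κ * (T - Λ) = c * Λ := div_mul_cancel₀ _ hTΛ.ne'
    -- Here `3 ≤ T` enters: `Λ ≤ 3 / 2 ≤ T - Λ`, so the descent off `E` is no steeper than the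
    -- ascent on it.
    have hκc : κ ≤ c := by
      rw [hκ, div_le_iff₀ hTΛ]
      exact mul_le_mul_of_nonneg_left (by linarith) hc0
    have hcΛ : c * Λ ≤ K := by
      calc c * Λ ≤ c * (1 + δ) := mul_le_mul_of_nonneg_left hΛ1 hc0
        _ = K := div_mul_cancel₀ _ (by linarith)
    -- The calibration: slope `c` where `φ = 1` and `-κ` where `φ = 0`, with `κ` chosen so that `f T
    -- = f 0`.
    set f : ℝ → ℝ := fun s => ∫ x in (0)..s, ((c + κ) * φ x - κ) with hf
    have hfd : ∀ s, HasDerivAt f ((c + κ) * φ s - κ) s := fun s =>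
      intervalIntegral.integral_hasDerivAt_right (Continuous.intervalIntegrable (by fun_prop) _ _)
        (Continuous.stronglyMeasurableAtFilter (by fun_prop) _ _) (by fun_prop)
    have hfc : Continuous f := continuous_iff_continuousAt.2 fun s => (hfd s).continuousAt
    have hfp : ∀ s ∈ Icc 0 T, ∀ t ∈ Icc 0 T, |f s - f t| ≤ ‖p s - p t‖ := fun s hs t ht =>
      (abs_tilted_primitive_sub_le hφc h01 hc0 hcK hκ0 hcΛ hκT hκc hs ht).trans
        (hchord s hs t ht)
    obtain ⟨u, hu, huf⟩ := exists_lipschitz_extension_comp hfp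
    have hφ' : Continuous (deriv φ) := hφ.continuous_deriv le_rfl
    set C := ∫ s in Ioc 0 T, |deriv φ s| with hC
    have hpar : ∫ s in Ioc 0 T, φ s * ((c + κ) * φ s - κ) = -∫ s in Ioc 0 T, deriv φ s * f s := by
      have key := intervalIntegral.integral_eq_sub_of_hasDerivAt (a := 0) (b := T)
        (f := fun s => φ s * f s) (f' := fun s => deriv φ s * f s + φ s * ((c + κ) * φ s - κ))
        (fun s _ => ((hφ.differentiable one_ne_zero) s).hasDerivAt.mul (hfd s))
        (Continuous.intervalIntegrable (by fun_prop) _ _)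
      rw [intervalIntegral.integral_of_le hT0, integral_add, hφ0, hφT] at key
      · simp only [zero_mul, sub_self] at key
        linarith
      · exact (Continuous.integrableOn_Icc (by fun_prop)).mono_set Ioc_subset_Icc_self
      · exact (Continuous.integrableOn_Icc (by fun_prop)).mono_set Ioc_subset_Icc_self
    -- Pointwise the integrand is at least `c * 1_E - 3 * c * |φ - 1_E|`; the loss on `E` is at most
    -- `(2 * c + κ) * (1 - φ)`, and `κ ≤ c`.
    have hlow : c * l - 3 * c * δ ≤ ∫ s in Ioc 0 T, φ s * ((c + κ) * φ s - κ) := by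
      calc c * l - 3 * c * δ ≤ c * (∫ s in Ioc 0 T, E.indicator (1 : ℝ → ℝ) s) -
            3 * c * ∫ s in Ioc 0 T, |φ s - E.indicator 1 s| := by
            rw [hEl]
            have := mul_le_mul_of_nonneg_left hφE (by positivity : 0 ≤ 3 * c)
            linarith
        _ = ∫ s in Ioc 0 T, (c * E.indicator (1 : ℝ → ℝ) s -
            3 * c * |φ s - E.indicator 1 s|) := by
            rw [integral_sub (hEi.const_mul c) (hdi.const_mul (3 * c)), integral_const_mul,
              integral_const_mul]
        _ ≤ _ := by
            refine integral_mono ((hEi.const_mul c).sub (hdi.const_mul (3 * c))) ?_ fun s => ?_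
            · exact (Continuous.integrableOn_Icc (by fun_prop)).mono_set Ioc_subset_Icc_self
            · have h2 := h01 s
              simp only
              by_cases hs : s ∈ E
              · rw [indicator_of_mem hs, Pi.one_apply, abs_sub_comm,
                  abs_of_nonneg (by linarith [h2.2])]
                nlinarith [h2.1, h2.2, mul_nonneg hc0 (sub_nonneg.2 h2.2),
                  mul_nonneg hκ0 h2.1, mul_nonneg (add_nonneg hc0 hκ0) (sq_nonneg (1 - φ s)),
                  mul_nonneg (sub_nonneg.2 hκc) (sub_nonneg.2 h2.2)]
              · rw [indicator_of_notMem hs, sub_zero, abs_of_nonneg h2.1]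
                nlinarith [h2.1, h2.2, mul_nonneg hc0 h2.1,
                  mul_nonneg (add_nonneg hc0 hκ0) (sq_nonneg (φ s)),
                  mul_nonneg (sub_nonneg.2 hκc) h2.1]
    -- The smooth `v` is close to `u` only uniformly, not in its derivative. Weighting with the
    -- smooth `φ` and integrating by parts along the boundary makes uniform closeness sufficient, at
    -- the cost `C * ε`.
    have step : ∀ ε : ℝ, 0 < ε → c * l - 3 * c * δ - L * δ ≤ X + C * ε := by
      intro ε hε
      obtain ⟨v, hv, hvL, hvu⟩ := hu.exists_contDiff_approx hε
      have hv1 : ∀ z, ‖fderiv ℝ v z‖ ≤ 1 := fun z => by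
        simpa using norm_fderiv_le_of_lipschitz ℝ hvL
      obtain ⟨hDi, hbp⟩ := hB.integral_mul_fderiv_eq hT0 hL (hv.of_le (by simp)) hv1 hφ hφ0 hφT
      set D : ℝ → ℝ := fun s => fderiv ℝ v (p s) (deriv p s) with hD
      have hDL : ∀ᵐ s ∂volume.restrict (Ioc 0 T), |D s| ≤ L := by
        filter_upwards [hB.ae_mem] with s hs
        exact ((fderiv ℝ v (p s)).le_of_opNorm_le (hv1 _) _).trans (by simpa using hL s hs)
      have hst := hB.ofReal_integral_fderiv_le hL hΩ hΩM h (hv.of_le (by norm_cast)) hv1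
      have hst' : ∫ s in E, D s ≤ X := ENNReal.ofReal_le_iff_le_toReal htop |>.1 hst
      have hφD : IntegrableOn (fun s => φ s * D s) (Ioc 0 T) :=
        hDi.bdd_mul hφc.aestronglyMeasurable (c := 1) (Eventually.of_forall fun s => by
          rw [Real.norm_eq_abs, abs_of_nonneg (h01 s).1]; exact (h01 s).2)
      have hED : ∫ s in E, D s = ∫ s in Ioc 0 T, E.indicator 1 s * D s := by
        have h4 : ∀ s, E.indicator 1 s * D s = E.indicator D s := fun s => by
          by_cases hs : s ∈ E <;> simp [hs]
        simp_rw [h4]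
        rw [setIntegral_indicator hEm, inter_eq_right.2 hET']
      have hEDi : IntegrableOn (fun s => E.indicator (1 : ℝ → ℝ) s * D s) (Ioc 0 T) := by
        refine (hDi.indicator hEm).congr (Eventually.of_forall fun s => ?_)
        by_cases hs : s ∈ E <;> simp [hs]
      have h2 : (∫ s in Ioc 0 T, φ s * D s) - ∫ s in E, D s ≤ L * δ := by
        rw [hED, ← integral_sub hφD hEDi]
        calc _ ≤ ∫ s in Ioc 0 T, L * |φ s - E.indicator 1 s| := by
              refine integral_mono_ae (hφD.sub hEDi) (hdi.const_mul L) ?_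
              filter_upwards [hDL] with s hs
              have h3 : φ s * D s - E.indicator 1 s * D s = (φ s - E.indicator 1 s) * D s := by ring
              change φ s * D s - E.indicator 1 s * D s ≤ _
              rw [h3]
              refine (le_abs_self _).trans ?_
              rw [abs_mul, mul_comm]
              exact mul_le_mul_of_nonneg_right hs (abs_nonneg _)
          _ ≤ L * δ := by
              rw [integral_const_mul]
              exact mul_le_mul_of_nonneg_left hφE hL0
      have h3 : (∫ s in Ioc 0 T, deriv φ s * v (p s)) - ∫ s in Ioc 0 T, deriv φ s * f s ≤ C * ε := by
        have hvc : Continuous fun s => v (p s) := hv.continuous.comp hB.continuous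
        have i1 : IntegrableOn (fun s => deriv φ s * v (p s)) (Ioc 0 T) :=
          (Continuous.integrableOn_Icc (hφ'.mul hvc)).mono_set Ioc_subset_Icc_self
        have i2 : IntegrableOn (fun s => deriv φ s * f s) (Ioc 0 T) :=
          (Continuous.integrableOn_Icc (by fun_prop)).mono_set Ioc_subset_Icc_self
        have i3 : IntegrableOn (fun s => |deriv φ s| * ε) (Ioc 0 T) :=
          (Continuous.integrableOn_Icc (by fun_prop)).mono_set Ioc_subset_Icc_self
        rw [← integral_sub i1 i2, hC, ← integral_mul_const]
        refine setIntegral_mono_on (i1.sub i2) i3 measurableSet_Ioc fun s hs => ?_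
        have h4 := hvu (p s)
        rw [huf s (Ioc_subset_Icc_self hs)] at h4
        rw [← mul_sub]
        refine (le_abs_self _).trans ?_
        rw [abs_mul]
        exact mul_le_mul_of_nonneg_left h4 (abs_nonneg _)
      linarith
    refine le_of_tendsto' (f := fun n : ℕ => c * l - 3 * c * δ - L * δ - C * (1 / ((n : ℝ) + 1)))
      (x := atTop) ?_ fun n => ?_
    · simpa using (tendsto_one_div_add_atTop_nhds_zero_nat (𝕜 := ℝ)).const_mul C |>.const_sub
        (c * l - 3 * c * δ - L * δ)
    · have := step (1 / ((n : ℝ) + 1)) (by positivity)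
      linarith
  have hlim : K * l ≤ X := by
    have ht : Tendsto (fun δ : ℝ => K / (1 + δ) * l - 3 * (K / (1 + δ)) * δ - L * δ) (𝓝[>] 0)
        (𝓝 (K * l)) := by
      have hc : ContinuousAt (fun δ : ℝ => K / (1 + δ) * l - 3 * (K / (1 + δ)) * δ - L * δ) 0 := by
        fun_prop (disch := norm_num)
      have := hc.tendsto
      simp only [add_zero, div_one, mul_zero, sub_zero] at this
      exact this.mono_left nhdsWithin_le_nhds
    refine le_of_tendsto ht ?_
    filter_upwards [Ioc_mem_nhdsGT (show (0 : ℝ) < 1 / 2 by norm_num)] with δ hδ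
    exact main δ hδ.1 hδ.2
  rw [← ENNReal.ofReal_toReal hEfin, ← ENNReal.ofReal_mul hK]
  exact (ENNReal.ofReal_le_iff_le_toReal htop).2 hlim

end BoundaryCurve

/-! ### Lower bounds from a chord-arc condition -/

/-- A nonempty bounded open set in the plane has boundary of positive length. -/
lemma hausdorffMeasure_frontier_pos {Ω : Set ℂ} (hΩ : IsOpen Ω) (hne : Ω.Nonempty)
    (hb : Bornology.IsBounded Ω) : μH[1] (frontier Ω) ≠ 0 := by
  -- Every vertical line through `Ω` leaves it and so meets `∂Ω`. The 1-Lipschitz projection of `∂Ω`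
  -- therefore covers a nonempty open set of reals.
  have hsub : Complex.re '' Ω ⊆ Complex.re '' frontier Ω := by
    rintro _ ⟨z, hz, rfl⟩
    by_contra hcon
    have hconn : IsPreconnected (range fun y : ℝ => (z.re : ℂ) + y * Complex.I) :=
      isPreconnected_range (by fun_prop)
    rcases hconn.subset_or_disjoint_of_frontier hΩ (by
      rintro _ ⟨y, rfl⟩ hy
      exact hcon ⟨_, hy, by simp⟩) with h1 | h1
    · obtain ⟨R, hR⟩ := hb.exists_norm_le
      have h2 := hR _ (h1 ⟨|R| + 1, rfl⟩)
      have h3 := (Complex.abs_im_le_norm _).trans h2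
      simp only [Complex.add_im, Complex.ofReal_im, Complex.mul_im, Complex.ofReal_re,
        Complex.I_im, Complex.I_re, mul_one, mul_zero, add_zero, zero_add] at h3
      have h4 := le_abs_self R
      have h5 := le_abs_self (|R| + 1)
      linarith
    · exact disjoint_left.1 h1 ⟨z.im, Complex.re_add_im z⟩ hz
  have hpos : 0 < volume (Complex.re '' Ω) :=
    (Complex.isOpenMap_re Ω hΩ).measure_pos _ (hne.image _)
  have hlip : LipschitzWith 1 Complex.re := LipschitzWith.of_dist_le_mul fun x y => by
    simpa [dist_eq_norm] using Complex.abs_re_le_norm (x - y)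
  have h1 := hlip.hausdorffMeasure_image_le zero_le_one (frontier Ω)
  rw [hausdorffMeasure_real] at h1
  intro h0
  rw [h0, mul_zero] at h1
  exact absurd ((measure_mono hsub).trans h1) (not_le.2 hpos)

namespace BoundaryCurve

variable {M : Set ℂ} {T : ℝ} {p : ℝ → ℂ} {U : Set ℝ} {Ω : Set ℂ} {m : ℕ} {γ : Fin m → ℝ → ℂ}

/-- At a common boundary point on the smooth part of `∂M` that is no arc end point, the inward
normal would enter both of the disjoint domains. Only the finitely many arc end points can be
shared. -/
lemma finite_inter_extParam (hB : BoundaryCurve M T p U) {Ω' : Set ℂ} {m' : ℕ}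
    {γ' : Fin m' → ℝ → ℂ} (hΩ : IsOpen Ω) (hΩM : Ω ⊆ M) (h : IsArcSystem Ω γ) (hne : Ω.Nonempty)
    (hΩ' : IsOpen Ω') (hΩM' : Ω' ⊆ M) (h' : IsArcSystem Ω' γ') (hd : Disjoint Ω Ω') :
    (extParam p U Ω ∩ extParam p U Ω').Finite := by
  have hfin := (IsArcSystem.finite_endpoints γ).union (IsArcSystem.finite_endpoints γ')
  refine (Finite.of_finite_image (f := p) (s := extParam p U Ω ∩ extParam p U Ω')
    (hfin.subset ?_) (hB.injOn.mono (inter_subset_left.trans inter_subset_left)))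
  rintro _ ⟨s, ⟨⟨hs, h1⟩, -, h2⟩, rfl⟩
  by_contra hcon
  rw [mem_union, not_or] at hcon
  obtain ⟨z, hz⟩ := hne
  have hp' : deriv p s ≠ 0 := fun h0 => by
    have := hB.left s hs z (hΩM hz)
    simp [h0] at this
  have hw : 0 < (conj (deriv p s) * (Complex.I * deriv p s)).im := by
    have h3 : conj (deriv p s) * (Complex.I * deriv p s) =
        Complex.normSq (deriv p s) * Complex.I := by
      rw [Complex.normSq_eq_conj_mul_self]; ring
    rw [h3]
    simpa using hp'
  obtain ⟨η, h3, h4⟩ := ((hB.inward hΩ hΩM h hs h1 hcon.1 hw).and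
    (hB.inward hΩ' hΩM' h' hs h2 hcon.2 hw)).exists
  exact disjoint_left.1 hd h3 h4

/-- Lower bound for the Escobar constants from a chord-arc condition for the boundary. -/
theorem ofReal_le_escobarConstant {n k : ℕ} (hn : 3 ≤ n) (hk : n ≤ k)
    (hB : BoundaryCurve M n p U) {L : NNReal} (hL : LipschitzWith L p) {c : ℝ} (hc : 0 ≤ c)
    (hchord : ∀ s ∈ Icc (0 : ℝ) n, ∀ t ∈ Icc (0 : ℝ) n, c * L * circDist n s t ≤ ‖p s - p t‖) :
    ENNReal.ofReal c ≤ escobarConstant k M := by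
  refine le_iInf fun Ω => le_iInf fun hΩ => le_iInf fun hdisj => ?_
  have hsub : ∀ j, Ω j ⊆ M := fun j => (hΩ j).1
  have hne : ∀ j, (Ω j).Nonempty := fun j => (hΩ j).2.1
  have ho : ∀ j, IsOpen (Ω j) := fun j => (hΩ j).2.2.1
  have harc : ∀ j, ∃ (m : ℕ) (γ : Fin m → ℝ → ℂ), IsArcSystem (Ω j) γ := fun j => by
    obtain ⟨m, γ, h1, h2, h3, h4⟩ := (hΩ j).2.2.2
    exact ⟨m, γ, h1, h2, h3, h4⟩
  choose m γ hγ using harc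
  have hEm : ∀ j, MeasurableSet (extParam p U (Ω j)) := fun j => hB.measurableSet_extParam
  have hsum : ∑ j, volume (extParam p U (Ω j)) ≤ n := by
    have had : Pairwise (Function.onFun (AEDisjoint volume) fun j => extParam p U (Ω j)) :=
      fun i j hij => (hB.finite_inter_extParam (ho i) (hsub i) (hγ i) (hne i) (ho j) (hsub j) (hγ j)
        (hdisj hij)).measure_zero volume
    have h1 := measure_iUnion₀ had fun j => (hEm j).nullMeasurableSet
    rw [tsum_fintype] at h1
    rw [← h1]
    refine (measure_mono (iUnion_subset fun j => inter_subset_left.trans hB.param_subset)).trans ?_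
    simp
  have hfin : ∀ j, volume (extParam p U (Ω j)) ≠ ⊤ := fun j =>
    ((Finset.single_le_sum (f := fun j => volume (extParam p U (Ω j))) (fun _ _ => zero_le)
      (Finset.mem_univ j)).trans_lt (hsum.trans_lt (ENNReal.natCast_lt_top n))).ne
  -- Pigeonhole: the parameter measures of `k ≥ n` domains add up to at most `n`.
  obtain ⟨j, -, hj⟩ : ∃ j ∈ Finset.univ, (volume (extParam p U (Ω j))).toReal ≤ 1 := by
    have : Nonempty (Fin k) := ⟨⟨0, by omega⟩⟩
    refine Finset.exists_le_of_sum_le Finset.univ_nonempty ?_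
    rw [← ENNReal.toReal_sum fun j _ => hfin j]
    refine (ENNReal.toReal_mono (ENNReal.natCast_ne_top n) hsum).trans ?_
    simpa using hk
  refine le_trans ?_ (le_iSup _ j)
  have hE1 : volume (extParam p U (Ω j)) ≤ 1 := by
    rw [← ENNReal.ofReal_toReal (hfin j)]
    exact ENNReal.ofReal_le_one.2 hj
  have hLd : ∀ s ∈ U, ‖deriv p s‖ ≤ L := fun s _ => norm_deriv_le_of_lipschitz hL
  have hiso := hB.mul_volume_extParam_le (by exact_mod_cast hn) L.coe_nonneg (mul_nonneg hc L.coe_nonneg) hLd hchord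
    (ho j) (hsub j) (hγ j) hE1
  rw [escobarRatio]
  split_ifs with hemp
  · exact le_top
  have hext : μH[1] (exteriorBoundary M (Ω j)) ≤ L * volume (extParam p U (Ω j)) := by
    have hcov : exteriorBoundary M (Ω j) ⊆ p '' extParam p U (Ω j) ∪ p '' (Icc 0 n \ U) := by
      rintro z ⟨hz1, hz2⟩
      obtain ⟨s, hs, rfl⟩ := hB.frontier_subset hz2
      by_cases hsU : s ∈ U
      · exact Or.inl ⟨s, ⟨hsU, hz1⟩, rfl⟩
      · exact Or.inr ⟨s, ⟨hs, hsU⟩, rfl⟩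
    refine (measure_mono hcov).trans ((measure_union_le _ _).trans ?_)
    have := Measure.nullSingletonClass_hausdorff ℂ (d := 1) zero_lt_one
    rw [(hB.finite_diff.image p).measure_zero, add_zero]
    have := hL.hausdorffMeasure_image_le zero_le_one (extParam p U (Ω j))
    rwa [hausdorffMeasure_real, ENNReal.rpow_one] at this
  have hle : ENNReal.ofReal c * μH[1] (exteriorBoundary M (Ω j)) ≤
      μH[1] (interiorBoundary M (Ω j)) := by
    refine le_trans ?_ hiso
    rw [ENNReal.ofReal_mul hc, mul_assoc, ENNReal.ofReal_coe_nnreal]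
    gcongr
  rw [ENNReal.le_div_iff_mul_le]
  · exact hle
  -- The quotient `0 / 0` would be `0` and has to be excluded: were both parts of the boundary of
  -- length zero, `∂Ω` would have length zero.
  · by_contra! hcon
    have hcov : frontier (Ω j) ⊆ interiorBoundary M (Ω j) ∪ exteriorBoundary M (Ω j) := by
      intro z hz
      by_cases hzM : z ∈ M
      · exact Or.inl ⟨hz, hzM⟩
      · refine Or.inr ⟨hz, ?_⟩
        rw [hB.isOpen.frontier_eq]
        exact ⟨closure_mono (hsub j) (frontier_subset_closure hz), hzM⟩
    refine hausdorffMeasure_frontier_pos (ho j) (hne j) (hB.bounded.subset (hsub j)) ?_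
    exact measure_mono_null hcov (measure_union_null hcon.2 hcon.1)
  · left
    exact (hext.trans_lt (ENNReal.mul_lt_top ENNReal.coe_lt_top (hfin j).lt_top)).ne

end BoundaryCurve

/-! ### The unit disk -/

/-- The point of the unit circle at the fraction `x / n` of a full turn. -/
noncomputable def circlePoint (n : ℕ) (x : ℝ) : ℂ := Complex.exp ((2 * Real.pi * x / n : ℝ) * Complex.I)

lemma norm_circlePoint (n : ℕ) (x : ℝ) : ‖circlePoint n x‖ = 1 :=
  Complex.norm_exp_ofReal_mul_I _

lemma circlePoint_add (n : ℕ) (x y : ℝ) :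
    circlePoint n (x + y) = circlePoint n x * circlePoint n y := by
  rw [circlePoint, circlePoint, circlePoint, ← Complex.exp_add]
  congr 1; push_cast; ring

lemma conj_circlePoint (n : ℕ) (x : ℝ) : conj (circlePoint n x) = circlePoint n (-x) := by
  rw [circlePoint, circlePoint, ← Complex.exp_conj]
  congr 1; simp only [map_mul, Complex.conj_ofReal, Complex.conj_I]; push_cast; ring

lemma circlePoint_zero (n : ℕ) : circlePoint n 0 = 1 := by simp [circlePoint]

lemma circlePoint_natCast {n : ℕ} (hn : n ≠ 0) : circlePoint n n = 1 := by
  rw [circlePoint]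
  have : (2 * Real.pi * n / n : ℝ) = 2 * Real.pi := by field_simp
  rw [this]; push_cast; exact Complex.exp_two_pi_mul_I

lemma circlePoint_re (n : ℕ) (x : ℝ) : (circlePoint n x).re = Real.cos (2 * Real.pi * x / n) :=
  Complex.exp_ofReal_mul_I_re _

lemma circlePoint_im (n : ℕ) (x : ℝ) : (circlePoint n x).im = Real.sin (2 * Real.pi * x / n) :=
  Complex.exp_ofReal_mul_I_im _

lemma norm_circlePoint_sub (n : ℕ) (x y : ℝ) :
    ‖circlePoint n x - circlePoint n y‖ = 2 * |Real.sin (Real.pi * (x - y) / n)| := by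
  have h1 : circlePoint n x - circlePoint n y = circlePoint n y * (circlePoint n (x - y) - 1) := by
    rw [mul_sub, ← circlePoint_add, mul_one]; congr 2; ring
  rw [h1, norm_mul, norm_circlePoint, one_mul, circlePoint, mul_comm, Complex.norm_exp_I_mul_ofReal_sub_one,
    norm_mul, Real.norm_eq_abs, Real.norm_eq_abs, abs_two]
  congr 3; ring

lemma exists_circlePoint {n : ℕ} (hn : n ≠ 0) {z : ℂ} (hz : ‖z‖ = 1) :
    ∃ s ∈ Ico (0 : ℝ) n, circlePoint n s = z := by
  have hn' : (0 : ℝ) < n := by positivity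
  have hpi := Real.pi_pos
  have hz1 : Complex.exp (z.arg * Complex.I) = z := by
    have := Complex.norm_mul_exp_arg_mul_I z
    rwa [hz, Complex.ofReal_one, one_mul] at this
  have ha := Complex.neg_pi_lt_arg z
  have hb := Complex.arg_le_pi z
  rcases le_or_gt 0 z.arg with h | h
  · refine ⟨n * z.arg / (2 * Real.pi), ⟨by positivity, ?_⟩, ?_⟩
    · rw [div_lt_iff₀ (by positivity)]; nlinarith
    · rw [circlePoint]
      have : 2 * Real.pi * (n * z.arg / (2 * Real.pi)) / n = z.arg := by field_simp
      rw [this, hz1]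
  · refine ⟨n * (z.arg + 2 * Real.pi) / (2 * Real.pi), ⟨?_, ?_⟩, ?_⟩
    · have : 0 ≤ z.arg + 2 * Real.pi := by linarith
      positivity
    · rw [div_lt_iff₀ (by positivity)]; nlinarith
    · rw [circlePoint]
      have : 2 * Real.pi * (n * (z.arg + 2 * Real.pi) / (2 * Real.pi)) / n =
          z.arg + 2 * Real.pi := by field_simp
      rw [this]
      push_cast
      rw [add_mul, Complex.exp_add, hz1, Complex.exp_two_pi_mul_I, mul_one]

lemma Real.sin_le_sin_of_le_of_le_pi_sub {x y : ℝ} (hy : 0 ≤ y) (hyx : y ≤ x)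
    (hyx' : y ≤ Real.pi - x) : Real.sin y ≤ Real.sin x := by
  rcases le_or_gt x (Real.pi / 2) with h | h
  · exact Real.sin_le_sin_of_le_of_le_pi_div_two (by linarith [Real.pi_pos]) h hyx
  · rw [← Real.sin_pi_sub x]
    exact Real.sin_le_sin_of_le_of_le_pi_div_two (by linarith [Real.pi_pos]) (by linarith) hyx'

/-- From `y ≤ tan y` and `cos x ≤ cos y`. This is where `cos (π / n)` comes from for the disk. -/
lemma Real.mul_cos_le_sin_of_le {x y : ℝ} (hy : 0 ≤ y) (hyx : y ≤ x) (hx : x < Real.pi / 2) :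
    y * Real.cos x ≤ Real.sin y := by
  have hc : 0 < Real.cos y := Real.cos_pos_of_mem_Ioo ⟨by linarith [Real.pi_pos], by linarith⟩
  have h1 := Real.le_tan hy (hyx.trans_lt hx)
  rw [Real.tan_eq_sin_div_cos, le_div_iff₀ hc] at h1
  refine le_trans ?_ h1
  exact mul_le_mul_of_nonneg_left
    (Real.cos_le_cos_of_nonneg_of_le_pi hy (by linarith [Real.pi_pos]) hyx) hy

lemma pi_div_lt {n : ℕ} (hn : 3 ≤ n) : Real.pi / n < Real.pi / 2 := by
  have : (3 : ℝ) ≤ n := by exact_mod_cast hn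
  exact div_lt_div_of_pos_left Real.pi_pos (by norm_num) (by linarith)

lemma cos_pi_div_pos {n : ℕ} (hn : 3 ≤ n) : 0 < Real.cos (Real.pi / n) :=
  Real.cos_pos_of_mem_Ioo ⟨by have := Real.pi_pos; have : 0 ≤ Real.pi / n := by positivity
                              linarith, pi_div_lt hn⟩

lemma hasDerivAt_circlePoint (n : ℕ) (x : ℝ) :
    HasDerivAt (circlePoint n) ((2 * Real.pi / n : ℝ) * Complex.I * circlePoint n x) x := by
  have h1 : HasDerivAt (fun x : ℝ => ((2 * Real.pi * x / n : ℝ) : ℂ) * Complex.I)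
      ((2 * Real.pi / n : ℝ) * Complex.I) x := by
    have h2 : HasDerivAt (fun x : ℝ => 2 * Real.pi * x / n) (2 * Real.pi / n) x := by
      have := ((hasDerivAt_id x).const_mul (2 * Real.pi)).div_const (n : ℝ)
      simpa using this
    exact h2.ofReal_comp.mul_const _
  have h3 := h1.cexp
  rw [mul_comm (Complex.exp _)] at h3
  exact h3

lemma boundaryCurve_unitDisk {n : ℕ} (hn : 3 ≤ n) :
    BoundaryCurve unitDisk n (circlePoint n) (Ioo 0 n) := by
  have hn0 : n ≠ 0 := by omega
  have hn' : (0 : ℝ) < n := by positivity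
  have hd : ∀ x, deriv (circlePoint n) x = (2 * Real.pi / n : ℝ) * Complex.I * circlePoint n x :=
    fun x => (hasDerivAt_circlePoint n x).deriv
  have hc : Continuous (circlePoint n) :=
    continuous_iff_continuousAt.2 fun x => (hasDerivAt_circlePoint n x).continuousAt
  refine ⟨Metric.isOpen_ball, Metric.isBounded_ball, hc, isOpen_Ioo, Subset.rfl, ?_,
    fun s _ => (hasDerivAt_circlePoint n s).differentiableAt, ?_, ?_, ?_, ?_⟩
  · exact ((finite_singleton (n : ℝ)).insert 0).subset (by
      rw [Icc_sdiff_Ioo_same hn'.le])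
  · rw [funext hd]
    exact (continuous_const.mul hc).continuousOn
  · intro s hs t ht hst
    have h1 := norm_circlePoint_sub n s t
    rw [hst, sub_self, norm_zero, eq_comm, mul_eq_zero, or_iff_right two_ne_zero, abs_eq_zero,
      Real.sin_eq_zero_iff_of_lt_of_lt] at h1
    · have := Real.pi_ne_zero
      field_simp at h1
      simpa [sub_eq_zero, this] using h1
    · rw [lt_div_iff₀ hn']; nlinarith [Real.pi_pos, hs.1, ht.2]
    · rw [div_lt_iff₀ hn']; nlinarith [Real.pi_pos, hs.2, ht.1]
  · intro s _ z hz
    rw [hd]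
    -- After rotating the boundary point to `1`, lying left of the tangent means having real part
    -- less than one.
    have h1 : conj ((2 * Real.pi / n : ℝ) * Complex.I * circlePoint n s) * (z - circlePoint n s) =
        (2 * Real.pi / n : ℝ) * (Complex.I * (1 - conj (circlePoint n s) * z)) := by
      have h2 : conj (circlePoint n s) * circlePoint n s = 1 := by
        rw [mul_comm, Complex.mul_conj, Complex.normSq_eq_norm_sq, norm_circlePoint]; simp
      simp only [map_mul, Complex.conj_ofReal, Complex.conj_I]
      linear_combination (2 * Real.pi / n : ℝ) * Complex.I * h2
    rw [h1, Complex.im_ofReal_mul]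
    have h3 : (Complex.I * (1 - conj (circlePoint n s) * z)).im =
        1 - (conj (circlePoint n s) * z).re := by simp
    rw [h3]
    refine mul_pos (by positivity) (sub_pos.2 ?_)
    refine (Complex.re_le_norm _).trans_lt ?_
    rw [norm_mul, RCLike.norm_conj, norm_circlePoint, one_mul]
    simpa [unitDisk] using hz
  · intro z hz
    rw [unitDisk, frontier_ball _ one_ne_zero, mem_sphere_zero_iff_norm] at hz
    obtain ⟨s, hs, hsz⟩ := exists_circlePoint hn0 hz
    exact ⟨s, Ico_subset_Icc_self hs, hsz⟩

/-- At parameter distance `d` the chord is `2 sin (π d / n)`. It dominates `2 sin (π r / n)` for the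
truncated circular distance `r ≤ 1`, hence `L r cos (π / n)` with the speed `L = 2π / n`. -/
theorem cos_le_escobarConstant_unitDisk {n k : ℕ} (hn : 3 ≤ n) (hk : n ≤ k) :
    ENNReal.ofReal (Real.cos (Real.pi / n)) ≤ escobarConstant k unitDisk := by
  have hn' : (0 : ℝ) < n := by positivity
  have hpi := Real.pi_pos
  have hL : LipschitzWith (2 * Real.pi / n).toNNReal (circlePoint n) := by
    refine lipschitzWith_of_nnnorm_deriv_le
      (fun x => (hasDerivAt_circlePoint n x).differentiableAt) fun x => ?_
    rw [← NNReal.coe_le_coe, coe_nnnorm, (hasDerivAt_circlePoint n x).deriv, norm_mul, norm_mul,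
      norm_circlePoint, Complex.norm_I, mul_one, mul_one, Complex.norm_real,
      Real.coe_toNNReal _ (by positivity), Real.norm_of_nonneg (by positivity)]
  refine (boundaryCurve_unitDisk hn).ofReal_le_escobarConstant hn hk hL (cos_pi_div_pos hn).le ?_
  intro s hs t ht
  rw [Real.coe_toNNReal _ (by positivity), norm_circlePoint_sub]
  set d := |s - t| with hd
  have hd1 : d ≤ n := abs_le.2 ⟨by linarith [hs.1, ht.2], by linarith [hs.2, ht.1]⟩
  set r := circDist n s t with hr
  have r1 : r ≤ d := (min_le_left _ _).trans (min_le_left _ _)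
  have r2 : r ≤ n - d := (min_le_left _ _).trans (min_le_right _ _)
  have r3 : r ≤ 1 := min_le_right _ _
  have r0 : 0 ≤ r := le_min (le_min (abs_nonneg _) (by linarith)) zero_le_one
  have hsin : |Real.sin (Real.pi * (s - t) / n)| = Real.sin (Real.pi * d / n) := by
    have h1 : 0 ≤ Real.sin (Real.pi * d / n) := by
      refine Real.sin_nonneg_of_nonneg_of_le_pi (by positivity) ?_
      rw [div_le_iff₀ hn']; nlinarith
    rcases abs_choice (s - t) with h | h
    · rw [← abs_of_nonneg h1, hd, h]
    · rw [← abs_of_nonneg h1, hd, h, mul_neg, neg_div, Real.sin_neg, abs_neg]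
  rw [hsin]
  have h1 : Real.sin (Real.pi * r / n) ≤ Real.sin (Real.pi * d / n) := by
    refine Real.sin_le_sin_of_le_of_le_pi_sub (by positivity) (by gcongr) ?_
    rw [le_sub_iff_add_le, ← add_div, div_le_iff₀ hn']
    nlinarith
  have h2 := Real.mul_cos_le_sin_of_le (y := Real.pi * r / n) (x := Real.pi / n) (by positivity)
    (by gcongr; nlinarith) (pi_div_lt hn)
  calc _ = 2 * (Real.pi * r / n * Real.cos (Real.pi / n)) := by ring
    _ ≤ _ := by linarith

/-! ### The regular polygon -/

/-- The boundary of the regular `n`-gon, parametrized so that every edge takes unit time. -/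
noncomputable def gonPoint (n : ℕ) (s : ℝ) : ℂ :=
  circlePoint n ⌊s⌋ + Int.fract s * (circlePoint n (⌊s⌋ + 1) - circlePoint n ⌊s⌋)

lemma circlePoint_add_natCast {n : ℕ} (hn : n ≠ 0) (x : ℝ) :
    circlePoint n (x + n) = circlePoint n x := by
  rw [circlePoint_add, circlePoint_natCast hn, mul_one]

lemma circlePoint_emod {n : ℕ} (hn : n ≠ 0) (j : ℤ) :
    circlePoint n ((j % n : ℤ) : ℝ) = circlePoint n j := by
  have h1 : Function.Periodic (circlePoint n) n := circlePoint_add_natCast hn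
  have h2 := h1.int_mul (j / n) ((j % n : ℤ) : ℝ)
  rw [← h2]
  congr 1
  have := Int.emod_add_mul_ediv j n
  have h3 : ((j % n + n * (j / n) : ℤ) : ℝ) = j := by rw [this]
  push_cast at h3
  linarith

lemma circlePoint_sub (n : ℕ) (x y : ℝ) : circlePoint n x - circlePoint n y =
    (2 * Real.sin (Real.pi / n * (x - y)) : ℝ) * Complex.I * circlePoint n ((x + y) / 2) := by
  have h1 : circlePoint n x = circlePoint n ((x - y) / 2) * circlePoint n ((x + y) / 2) := by
    rw [← circlePoint_add]; congr 1; ring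
  have h2 : circlePoint n y = conj (circlePoint n ((x - y) / 2)) * circlePoint n ((x + y) / 2) := by
    rw [conj_circlePoint, ← circlePoint_add]; congr 1; ring
  rw [h1, h2, ← sub_mul, Complex.sub_conj, circlePoint_im]
  congr 2
  push_cast
  congr 3
  ring

lemma conj_circlePoint_mul (n : ℕ) (x y : ℝ) :
    conj (circlePoint n x) * circlePoint n y = circlePoint n (y - x) := by
  rw [conj_circlePoint, ← circlePoint_add]; congr 1; ring

/-- The edge vectors of the regular polygon. -/
lemma circlePoint_add_one_sub (n : ℕ) (x : ℝ) : circlePoint n (x + 1) - circlePoint n x =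
    (2 * Real.sin (Real.pi / n) : ℝ) * Complex.I * circlePoint n (x + 1 / 2) := by
  rw [circlePoint_sub]
  congr 2
  · congr 3; ring
  · ring

/-- At the right end of the edge the floor jumps to `j + 1`, but the formulas of consecutive edges
agree at the common vertex, so closed intervals may be used. -/
lemma gonPoint_of_mem {n : ℕ} {j : ℤ} {s : ℝ} (hs : s ∈ Icc (j : ℝ) (j + 1)) :
    gonPoint n s = circlePoint n j + (s - j : ℝ) * (circlePoint n (j + 1) - circlePoint n j) := by
  rcases hs.2.lt_or_eq with h | h
  · have : ⌊s⌋ = j := Int.floor_eq_iff.2 ⟨hs.1, h⟩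
    rw [gonPoint, Int.fract, this]
  · have hf : ⌊s⌋ = j + 1 := by rw [h]; exact_mod_cast Int.floor_intCast (j + 1)
    rw [gonPoint, Int.fract, hf, h]
    push_cast
    simp

lemma gonPoint_intCast (n : ℕ) (j : ℤ) : gonPoint n j = circlePoint n j := by
  rw [gonPoint_of_mem (j := j) ⟨le_rfl, by linarith⟩]; simp

lemma gonPoint_add_natCast {n : ℕ} (hn : n ≠ 0) (s : ℝ) :
    gonPoint n (s + n) = gonPoint n s := by
  rw [gonPoint, gonPoint, Int.floor_add_natCast, Int.fract_add_natCast]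
  push_cast
  rw [circlePoint_add_natCast hn, add_right_comm, circlePoint_add_natCast hn]

/-- The edge is orthogonal to the direction `j + 1 / 2` of its midpoint, so the component along that
direction is constantly the apothem. -/
lemma conj_mul_gonPoint_re {n : ℕ} {j : ℤ} {s : ℝ} (hs : s ∈ Icc (j : ℝ) (j + 1)) :
    (conj (circlePoint n (j + 1 / 2)) * gonPoint n s).re = Real.cos (Real.pi / n) := by
  have h1 : conj (circlePoint n (j + 1 / 2)) * gonPoint n s = circlePoint n (-(1 / 2)) +
      ((s - j) * (2 * Real.sin (Real.pi / n)) : ℝ) * Complex.I *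
        (conj (circlePoint n (j + 1 / 2)) * circlePoint n (j + 1 / 2)) := by
    rw [gonPoint_of_mem hs, circlePoint_add_one_sub, mul_add, conj_circlePoint_mul]
    push_cast
    rw [show (j : ℝ) - (j + 1 / 2) = -(1 / 2) by ring]
    ring
  rw [h1, conj_circlePoint_mul, sub_self, circlePoint_zero, mul_one, Complex.add_re,
    circlePoint_re, Complex.re_ofReal_mul, Complex.I_re, mul_zero, add_zero,
    ← Real.cos_neg]
  congr 1; ring

lemma Real.cos_le_cos_of_le_of_le_two_pi_sub {x y : ℝ} (hy : 0 ≤ y)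
    (hyx : y ≤ x) (hx : x ≤ 2 * Real.pi - y) : Real.cos x ≤ Real.cos y := by
  rcases le_or_gt x Real.pi with h | h
  · exact Real.cos_le_cos_of_nonneg_of_le_pi hy h hyx
  · rw [← Real.cos_two_pi_sub x]
    exact Real.cos_le_cos_of_nonneg_of_le_pi hy (by linarith) (by linarith)

lemma pi_div_mul_self {n : ℕ} (hn : n ≠ 0) : Real.pi / n * n = Real.pi := by
  field_simp

/-- The angle is an odd multiple of `π / n`; reduced modulo a full turn it stays at least `π / n`
away from zero. -/
lemma circlePoint_half_re_le {n : ℕ} (hn : n ≠ 0) (r : ℤ) :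
    (circlePoint n (r - 1 / 2)).re ≤ Real.cos (Real.pi / n) := by
  have hn1 : (1 : ℝ) ≤ n := by exact_mod_cast Nat.one_le_iff_ne_zero.2 hn
  have hpos : 0 < Real.pi / n := by have := Real.pi_pos; positivity
  have hn' := pi_div_mul_self hn
  have h0 : (circlePoint n (r - 1 / 2)).re = (circlePoint n (((r % n : ℤ) : ℝ) - 1 / 2)).re := by
    rw [sub_eq_add_neg, circlePoint_add, ← circlePoint_emod hn r, ← circlePoint_add,
      ← sub_eq_add_neg]
  rw [h0, circlePoint_re]
  have hr0 : 0 ≤ r % n := Int.emod_nonneg _ (by exact_mod_cast hn)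
  have hrn : r % n + 1 ≤ n := Int.emod_lt_of_pos _ (by positivity)
  set q : ℤ := r % n
  have hq : 2 * Real.pi * ((q : ℝ) - 1 / 2) / n = Real.pi / n * (2 * q - 1) := by ring
  rw [hq]
  rcases hr0.eq_or_lt with h | h
  · rw [← h, ← Real.cos_neg]; apply le_of_eq; congr 1; push_cast; ring
  · have h1 : (1 : ℝ) ≤ q := by exact_mod_cast h
    have h2 : (q : ℝ) + 1 ≤ n := by exact_mod_cast hrn
    refine Real.cos_le_cos_of_le_of_le_two_pi_sub hpos.le (by nlinarith) ?_
    have : Real.pi / n * (2 * q) ≤ Real.pi / n * (2 * n - 2) :=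
      mul_le_mul_of_nonneg_left (by linarith) hpos.le
    nlinarith

/-- The closed regular `n`-gon. -/
noncomputable def closedGon (n : ℕ) : Set ℂ := convexHull ℝ (range fun j : Fin n => circlePoint n (j : ℕ))

lemma regularNGon_eq (n : ℕ) : regularNGon n = interior (closedGon n) := by
  unfold regularNGon closedGon
  congr 3
  ext j
  rw [circlePoint]
  congr 1; push_cast; ring

lemma circlePoint_mem_closedGon {n : ℕ} (hn : n ≠ 0) (j : ℤ) : circlePoint n j ∈ closedGon n := by
  have h0 : 0 ≤ j % n := Int.emod_nonneg _ (by exact_mod_cast hn)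
  have h1 : j % n < n := Int.emod_lt_of_pos _ (by positivity)
  refine subset_convexHull ℝ _ ⟨⟨(j % n).toNat, by omega⟩, ?_⟩
  rw [← circlePoint_emod hn j]
  simp only
  congr 1
  exact_mod_cast Int.toNat_of_nonneg h0

lemma convex_closedGon (n : ℕ) : Convex ℝ (closedGon n) := convex_convexHull ℝ _

lemma isCompact_closedGon (n : ℕ) : IsCompact (closedGon n) :=
  (finite_range _).isCompact_convexHull ℝ

lemma gonPoint_mem_closedGon {n : ℕ} (hn : n ≠ 0) (s : ℝ) : gonPoint n s ∈ closedGon n := by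
  have h1 := circlePoint_mem_closedGon hn ⌊s⌋
  have h2 := circlePoint_mem_closedGon hn (⌊s⌋ + 1)
  push_cast at h2
  have := (convex_closedGon n) h1 h2 (sub_nonneg.2 (Int.fract_lt_one s).le) (Int.fract_nonneg s)
    (by ring)
  convert this using 1
  rw [gonPoint]
  simp only [Complex.real_smul]
  push_cast
  ring

lemma re_conj_mul_le_of_mem_closedGon {n : ℕ} (hn : n ≠ 0) (j : ℤ) {z : ℂ}
    (hz : z ∈ closedGon n) :
    (conj (circlePoint n (j + 1 / 2)) * z).re ≤ Real.cos (Real.pi / n) := by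
  have hlin : IsLinearMap ℝ fun z : ℂ => (conj (circlePoint n (j + 1 / 2)) * z).re :=
    ⟨fun x y => by rw [mul_add, Complex.add_re], fun a x => by
      simp only [Complex.real_smul]
      rw [mul_left_comm, Complex.re_ofReal_mul, smul_eq_mul]⟩
  refine convexHull_min (𝕜 := ℝ) ?_ (convex_halfSpace_le (𝕜 := ℝ) hlin (Real.cos (Real.pi / n))) hz
  rintro _ ⟨i, rfl⟩
  have := circlePoint_half_re_le hn ((i : ℕ) - j)
  simp only [mem_ofPred_eq, conj_circlePoint_mul]
  have e : ((i : ℕ) : ℝ) - (j + 1 / 2) = (((i : ℕ) - j : ℤ) : ℝ) - 1 / 2 := by push_cast; ring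
  rw [e]
  exact this

lemma re_conj_mul_lt_of_mem_regularNGon {n : ℕ} (hn : n ≠ 0) (j : ℤ) {z : ℂ}
    (hz : z ∈ regularNGon n) :
    (conj (circlePoint n (j + 1 / 2)) * z).re < Real.cos (Real.pi / n) := by
  rw [regularNGon_eq, mem_interior_iff_mem_nhds, Metric.mem_nhds_iff] at hz
  obtain ⟨ε, hε, hb⟩ := hz
  have h1 : z + (ε / 2 : ℝ) * circlePoint n (j + 1 / 2) ∈ closedGon n := hb (by
    rw [Metric.mem_ball, dist_eq_norm, add_sub_cancel_left, norm_mul, norm_circlePoint,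
      Complex.norm_real, Real.norm_of_nonneg (by positivity)]
    linarith)
  have h2 := re_conj_mul_le_of_mem_closedGon hn j h1
  rw [mul_add, mul_left_comm, conj_circlePoint_mul, sub_self, circlePoint_zero, mul_one,
    Complex.add_re, Complex.ofReal_re] at h2
  linarith

/-- Every point lies in the cone over some edge of the regular polygon. -/
lemma exists_cone {n : ℕ} (hn : 3 ≤ n) (z : ℂ) : ∃ j : ℤ, 0 ≤ j ∧ j < n ∧ ∃ a b : ℝ, 0 ≤ a ∧ 0 ≤ b ∧
    z = a * circlePoint n j + b * circlePoint n (j + 1) := by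
  rcases eq_or_ne z 0 with rfl | hz
  · exact ⟨0, le_rfl, by positivity, 0, 0, le_rfl, le_rfl, by simp⟩
  have hn0 : n ≠ 0 := by omega
  have hn' : (0 : ℝ) < n := by positivity
  have hpi := Real.pi_pos
  have hz0 : 0 < ‖z‖ := norm_pos_iff.2 hz
  obtain ⟨s, hs, hsz⟩ := exists_circlePoint hn0 (z := z / ‖z‖) (by
    rw [norm_div, Complex.norm_real, norm_norm, div_self hz0.ne'])
  have hpn := pi_div_lt hn
  have hppos : 0 < Real.pi / n := by positivity
  have hsin : 0 < Real.sin (2 * Real.pi / n) := Real.sin_pos_of_pos_of_lt_pi (by positivity) (by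
    rw [mul_div_assoc]; linarith)
  set t := Int.fract s with ht
  have ht0 := Int.fract_nonneg s
  have ht1 := (Int.fract_lt_one s).le
  -- The identity `sin β * e^{iτ} = sin (β - τ) + sin τ * e^{iβ}` with `β = 2π / n`; it supplies the
  -- nonnegative coefficients in the cone.
  have hid : (Real.sin (2 * Real.pi / n) : ℂ) * circlePoint n t =
      Real.sin (2 * Real.pi / n - 2 * Real.pi * t / n) +
        Real.sin (2 * Real.pi * t / n) * circlePoint n 1 := by
    apply Complex.ext
    · rw [Complex.re_ofReal_mul, Complex.add_re, Complex.re_ofReal_mul, circlePoint_re,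
        circlePoint_re, Complex.ofReal_re, Real.sin_sub, mul_one]
      ring
    · rw [Complex.im_ofReal_mul, Complex.add_im, Complex.im_ofReal_mul, circlePoint_im,
        circlePoint_im, Complex.ofReal_im, mul_one]
      ring
  have hle : 2 * Real.pi * t / n ≤ 2 * Real.pi / n := by
    exact div_le_div_of_nonneg_right (mul_le_of_le_one_right (by positivity) ht1) hn'.le
  have h1 : 0 ≤ Real.sin (2 * Real.pi / n - 2 * Real.pi * t / n) :=
    Real.sin_nonneg_of_nonneg_of_le_pi (by linarith) (by
      have : 0 ≤ 2 * Real.pi * t / n := by positivity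
      rw [mul_div_assoc 2 Real.pi] at *; linarith)
  have h2 : 0 ≤ Real.sin (2 * Real.pi * t / n) :=
    Real.sin_nonneg_of_nonneg_of_le_pi (by positivity) (by
      rw [mul_div_assoc 2 Real.pi] at hle; linarith)
  refine ⟨⌊s⌋, Int.floor_nonneg.2 hs.1, Int.floor_lt.2 (by exact_mod_cast hs.2),
    ‖z‖ * Real.sin (2 * Real.pi / n - 2 * Real.pi * t / n) / Real.sin (2 * Real.pi / n),
    ‖z‖ * Real.sin (2 * Real.pi * t / n) / Real.sin (2 * Real.pi / n), by positivity, by positivity,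
    ?_⟩
  have hzs : z = ‖z‖ * (circlePoint n ⌊s⌋ * circlePoint n t) := by
    rw [← circlePoint_add, ht, Int.floor_add_fract, hsz]
    have : (‖z‖ : ℂ) ≠ 0 := by exact_mod_cast hz0.ne'
    field_simp
  have hsc : (Real.sin (2 * Real.pi / n) : ℂ) ≠ 0 := by exact_mod_cast hsin.ne'
  have hpt : circlePoint n t = (Real.sin (2 * Real.pi / n - 2 * Real.pi * t / n) +
        Real.sin (2 * Real.pi * t / n) * circlePoint n 1) / Real.sin (2 * Real.pi / n) := by
    rw [eq_div_iff hsc, mul_comm, hid]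
  conv_lhs => rw [hzs, hpt]
  rw [circlePoint_add n ⌊s⌋ 1]
  push_cast
  field_simp

lemma cone_re {n : ℕ} (j : ℤ) (a b : ℝ) :
    (conj (circlePoint n (j + 1 / 2)) * (a * circlePoint n j + b * circlePoint n (j + 1))).re =
      (a + b) * Real.cos (Real.pi / n) := by
  have h1 : conj (circlePoint n (j + 1 / 2)) * (a * circlePoint n j + b * circlePoint n (j + 1)) =
      a * circlePoint n (-(1 / 2)) + b * circlePoint n (1 / 2) := by
    rw [mul_add, mul_left_comm, mul_left_comm _ (b : ℂ), conj_circlePoint_mul, conj_circlePoint_mul,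
      show (j : ℝ) - (j + 1 / 2) = -(1 / 2) by ring, show (j : ℝ) + 1 - (j + 1 / 2) = 1 / 2 by ring]
  rw [h1, Complex.add_re, Complex.re_ofReal_mul, Complex.re_ofReal_mul, circlePoint_re,
    circlePoint_re, ← Real.cos_neg]
  have e1 : -(2 * Real.pi * -(1 / 2) / n) = Real.pi / n := by ring
  have e2 : 2 * Real.pi * (1 / 2) / n = Real.pi / n := by ring
  rw [e1, e2]; ring

/-- The antipode of a vertex lies in the cone over some edge; normalizing this relation writes `0`
as a convex combination of three vertices. -/
lemma zero_mem_closedGon {n : ℕ} (hn : 3 ≤ n) : (0 : ℂ) ∈ closedGon n := by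
  have hn0 : n ≠ 0 := by omega
  obtain ⟨j, -, -, a, b, ha, hb, hz⟩ := exists_cone hn (-circlePoint n (0 : ℤ))
  have h1 := circlePoint_mem_closedGon hn0 0
  have h2 := circlePoint_mem_closedGon hn0 j
  have h3 := circlePoint_mem_closedGon hn0 (j + 1)
  push_cast at h3
  have hpos : 0 < 1 + a + b := by linarith
  have h4 := (convex_closedGon n).sum_mem (t := Finset.univ)
    (w := ![1 / (1 + a + b), a / (1 + a + b), b / (1 + a + b)])
    (z := ![circlePoint n (0 : ℤ), circlePoint n j, circlePoint n (j + 1)])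
    (by intro i _; fin_cases i <;> simp <;> positivity)
    (by simp [Fin.sum_univ_three]; field_simp)
    (by intro i _; fin_cases i <;> simp <;> [simpa using h1; exact h2; exact h3])
  convert h4 using 1
  have hc : ((1 + a + b : ℝ) : ℂ) ≠ 0 := by exact_mod_cast hpos.ne'
  simp only [Fin.sum_univ_three, Matrix.cons_val_zero, Matrix.cons_val_one, Matrix.cons_val_two,
    Matrix.tail_cons, Matrix.head_cons, Complex.real_smul, Complex.ofReal_div, Complex.ofReal_one]
  push_cast at hc hz ⊢
  field_simp
  linear_combination hz

/-- In the cone over an edge `(a + b) * cos (π / n) ≤ ‖z‖`, so a short vector has `a + b < 1` and is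
a convex combination of `0` and the two vertices. -/
lemma ball_subset_closedGon {n : ℕ} (hn : 3 ≤ n) :
    Metric.ball 0 (Real.cos (Real.pi / n)) ⊆ closedGon n := by
  intro z hz
  have hn0 : n ≠ 0 := by omega
  obtain ⟨j, -, -, a, b, ha, hb, rfl⟩ := exists_cone hn z
  have h2 := circlePoint_mem_closedGon hn0 j
  have h3 := circlePoint_mem_closedGon hn0 (j + 1)
  push_cast at h3
  have hab : a + b < 1 := by
    have h4 := Complex.re_le_norm (conj (circlePoint n (j + 1 / 2)) *
      (a * circlePoint n j + b * circlePoint n (j + 1)))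
    rw [cone_re, norm_mul, RCLike.norm_conj, norm_circlePoint, one_mul] at h4
    have h5 := h4.trans_lt (mem_ball_zero_iff.1 hz)
    have := cos_pi_div_pos hn
    nlinarith
  have h4 := (convex_closedGon n).sum_mem (t := Finset.univ) (w := ![1 - a - b, a, b])
    (z := ![0, circlePoint n j, circlePoint n (j + 1)])
    (by intro i _; fin_cases i <;> simp <;> linarith)
    (by simp [Fin.sum_univ_three]; ring)
    (by intro i _; fin_cases i <;> simp <;> [exact zero_mem_closedGon hn; exact h2; exact h3])
  convert h4 using 1
  simp [Fin.sum_univ_three]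

lemma zero_mem_interior_closedGon {n : ℕ} (hn : 3 ≤ n) : (0 : ℂ) ∈ interior (closedGon n) :=
  mem_interior.2 ⟨_, ball_subset_closedGon hn, Metric.isOpen_ball,
    Metric.mem_ball_self (cos_pi_div_pos hn)⟩

/-- In the cone over an edge the polygon is `a + b ≤ 1`. A point with `a + b < 1` is a contraction
towards the interior point `0`, hence interior, so boundary points lie on the edge. Conversely, edge
points violate a strict inequality valid in the interior. -/
lemma frontier_regularNGon_eq {n : ℕ} (hn : 3 ≤ n) :
    frontier (regularNGon n) = gonPoint n '' Icc 0 n := by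
  have hn0 : n ≠ 0 := by omega
  have hcl : closure (interior (closedGon n)) = closedGon n := by
    rw [(convex_closedGon n).closure_interior_eq_closure_of_nonempty_interior
      ⟨0, zero_mem_interior_closedGon hn⟩, (isCompact_closedGon n).isClosed.closure_eq]
  have hc := cos_pi_div_pos hn
  rw [frontier, regularNGon_eq, interior_interior, hcl]
  ext z
  constructor
  · rintro ⟨hzK, hzi⟩
    obtain ⟨j, hj0, hjn, a, b, ha, hb, rfl⟩ := exists_cone hn z
    have hle := re_conj_mul_le_of_mem_closedGon hn0 j hzK
    rw [cone_re] at hle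
    have hab1 : a + b ≤ 1 := by nlinarith
    have hab : a + b = 1 := by
      by_contra hne
      have hlt : a + b < 1 := lt_of_le_of_ne hab1 hne
      rcases (add_nonneg ha hb).eq_or_lt with h0 | h0
      · have ha0 : a = 0 := by linarith
        have hb0 : b = 0 := by linarith
        rw [ha0, hb0] at hzi
        simp only [Complex.ofReal_zero, zero_mul, add_zero] at hzi
        exact hzi (zero_mem_interior_closedGon hn)
      · have h2 := circlePoint_mem_closedGon hn0 j
        have h3 := circlePoint_mem_closedGon hn0 (j + 1)
        push_cast at h3
        have h4 := (convex_closedGon n) h2 h3 (div_nonneg ha h0.le) (div_nonneg hb h0.le)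
          (by field_simp)
        have h5 := (convex_closedGon n).combo_interior_self_mem_interior
          (zero_mem_interior_closedGon hn) h4 (sub_pos.2 hlt) h0.le (by ring)
        refine hzi ?_
        convert h5 using 1
        have hc' : ((a + b : ℝ) : ℂ) ≠ 0 := by exact_mod_cast h0.ne'
        simp only [smul_zero, zero_add, Complex.real_smul, Complex.ofReal_div]
        push_cast at hc' ⊢
        field_simp
    have hbj : (j : ℝ) + b ∈ Icc (j : ℝ) (j + 1) := ⟨by linarith, by linarith⟩
    have hj0' : (0 : ℝ) ≤ j := by exact_mod_cast hj0
    have hjn' : (j : ℝ) + 1 ≤ n := by exact_mod_cast hjn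
    refine ⟨j + b, ⟨by linarith, by linarith⟩, ?_⟩
    rw [gonPoint_of_mem hbj, show a = 1 - b by linarith]
    push_cast; ring
  · rintro ⟨s, -, rfl⟩
    refine ⟨gonPoint_mem_closedGon hn0 s, fun hi => ?_⟩
    rw [← regularNGon_eq] at hi
    have h1 := re_conj_mul_lt_of_mem_regularNGon hn0 ⌊s⌋ hi
    rw [conj_mul_gonPoint_re ⟨Int.floor_le s, (Int.lt_floor_add_one s).le⟩] at h1
    exact h1.false

lemma sin_pi_div_pos {n : ℕ} (hn : 3 ≤ n) : 0 < Real.sin (Real.pi / n) := by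
  have hpi := Real.pi_pos
  have : (0 : ℝ) < n := by positivity
  exact Real.sin_pos_of_pos_of_lt_pi (by positivity) (by have := pi_div_lt hn; linarith)

lemma circlePoint_component (n : ℕ) (x y : ℝ) :
    (conj (Complex.I * circlePoint n x) * circlePoint n y).re =
      Real.sin (2 * Real.pi / n * (y - x)) := by
  have h : conj (Complex.I * circlePoint n x) * circlePoint n y =
      -(Complex.I * circlePoint n (y - x)) := by
    rw [map_mul, Complex.conj_I, mul_assoc, conj_circlePoint_mul]; ring
  rw [h, Complex.neg_re, Complex.I_mul_re, neg_neg, circlePoint_im]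
  congr 1; ring

/-- Chords of the polygon are bounded below by their component along the tangential direction at a
well chosen parameter `x`. -/
lemma component_le_norm (n : ℕ) (x : ℝ) (z : ℂ) :
    (conj (Complex.I * circlePoint n x) * z).re ≤ ‖z‖ := by
  refine (Complex.re_le_norm _).trans ?_
  rw [norm_mul, RCLike.norm_conj, norm_mul, Complex.norm_I, norm_circlePoint, one_mul, one_mul]

lemma gonPoint_component {n : ℕ} {j : ℤ} {s : ℝ} (hs : s ∈ Icc (j : ℝ) (j + 1)) (x : ℝ) :
    (conj (Complex.I * circlePoint n x) * gonPoint n s).re =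
      (1 - (s - j)) * Real.sin (2 * Real.pi / n * (j - x)) +
        (s - j) * Real.sin (2 * Real.pi / n * (j + 1 - x)) := by
  have h1 : conj (Complex.I * circlePoint n x) * gonPoint n s =
      (1 - (s - j) : ℝ) * (conj (Complex.I * circlePoint n x) * circlePoint n j) +
        (s - j : ℝ) * (conj (Complex.I * circlePoint n x) * circlePoint n (j + 1)) := by
    rw [gonPoint_of_mem hs]
    push_cast; ring
  rw [h1, Complex.add_re, Complex.re_ofReal_mul, Complex.re_ofReal_mul, circlePoint_component,
    circlePoint_component]

/-- Points on adjacent edges of the regular polygon. -/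
lemma le_norm_gonPoint_sub_of_adjacent {n : ℕ} {i : ℤ} {s t : ℝ}
    (hs : s ∈ Icc (i : ℝ) (i + 1)) (ht : t ∈ Icc ((i : ℝ) + 1) (i + 1 + 1)) :
    Real.cos (Real.pi / n) * (2 * Real.sin (Real.pi / n)) * (t - s) ≤
      ‖gonPoint n t - gonPoint n s‖ := by
  have ht' : t ∈ Icc ((i + 1 : ℤ) : ℝ) ((i + 1 : ℤ) + 1) := by push_cast; exact ht
  -- Project on the tangential direction at the common vertex: both edges make the angle `π / n`
  -- with it, so the component is exactly the left side.
  refine le_trans (le_of_eq ?_) (component_le_norm n (i + 1) _)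
  rw [mul_sub (conj _), Complex.sub_re, gonPoint_component ht', gonPoint_component hs]
  push_cast
  have e1 : 2 * Real.pi / n * ((i : ℝ) + 1 - (i + 1)) = 0 := by ring
  have e2 : 2 * Real.pi / n * ((i : ℝ) + 1 + 1 - (i + 1)) = 2 * (Real.pi / n) := by ring
  have e3 : 2 * Real.pi / n * ((i : ℝ) - (i + 1)) = -(2 * (Real.pi / n)) := by ring
  rw [e1, e2, e3, Real.sin_neg, Real.sin_zero, Real.sin_two_mul]
  ring

/-- Points on edges of the regular polygon which are not adjacent. -/
lemma le_norm_gonPoint_sub_of_far {n : ℕ} (hn : 3 ≤ n) {i j : ℤ} {s t : ℝ}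
    (hs : s ∈ Icc (j : ℝ) (j + 1)) (ht : t ∈ Icc (i : ℝ) (i + 1)) (h2 : j + 2 ≤ i)
    (h3 : i + 2 ≤ j + n) :
    Real.cos (Real.pi / n) * (2 * Real.sin (Real.pi / n)) ≤ ‖gonPoint n t - gonPoint n s‖ := by
  have hpi := Real.pi_pos
  have hn' : (0 : ℝ) < n := by positivity
  have hζ : 0 < Real.pi / n := by positivity
  have hζn : Real.pi / n * n = Real.pi := pi_div_mul_self (by omega)
  have hζ2 := pi_div_lt hn
  have hc := cos_pi_div_pos hn
  have hsn := sin_pi_div_pos hn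
  -- The mean of the midpoint parameters of the two edges.
  set x : ℝ := (i + j + 1) / 2 with hx
  have h2' : (j : ℝ) + 2 ≤ i := by exact_mod_cast h2
  have h3' : (i : ℝ) + 2 ≤ j + n := by exact_mod_cast h3
  -- For end points `y`, `z` of the two edges the component is `2 sin (π / n * (y - z)) cos (π / n *
  -- (y + z - 2 * x))`; the constraints keep both factors at least `sin (π / n)` and `cos (π / n)`.
  have key : ∀ y z : ℝ, 1 ≤ y - z → y - z ≤ n - 1 → |y + z - 2 * x| ≤ 1 →
      Real.cos (Real.pi / n) * (2 * Real.sin (Real.pi / n)) ≤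
        Real.sin (2 * Real.pi / n * (y - x)) - Real.sin (2 * Real.pi / n * (z - x)) := by
    intro y z hyz hyz' hm
    rw [Real.sin_sub_sin]
    have e1 : (2 * Real.pi / n * (y - x) - 2 * Real.pi / n * (z - x)) / 2 =
        Real.pi / n * (y - z) := by ring
    have e2 : (2 * Real.pi / n * (y - x) + 2 * Real.pi / n * (z - x)) / 2 =
        Real.pi / n * (y + z - 2 * x) := by ring
    rw [e1, e2]
    have s1 : Real.sin (Real.pi / n) ≤ Real.sin (Real.pi / n * (y - z)) :=
      Real.sin_le_sin_of_le_of_le_pi_sub hζ.le (by nlinarith) (by nlinarith)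
    have s2 : Real.cos (Real.pi / n) ≤ Real.cos (Real.pi / n * (y + z - 2 * x)) := by
      rw [← Real.cos_abs (Real.pi / n * (y + z - 2 * x))]
      refine Real.cos_le_cos_of_nonneg_of_le_pi (abs_nonneg _) (by linarith) ?_
      rw [abs_mul, abs_of_pos hζ]
      nlinarith
    calc _ = 2 * Real.sin (Real.pi / n) * Real.cos (Real.pi / n) := by ring
      _ ≤ _ := mul_le_mul (by linarith) s2 hc.le (by linarith)
  refine le_trans ?_ (component_le_norm n x _)
  rw [mul_sub, Complex.sub_re, gonPoint_component ht, gonPoint_component hs]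
  have k1 := key i j (by linarith) (by linarith) (by rw [hx]; ring_nf; simp)
  have k2 := key (i + 1) j (by linarith) (by linarith) (by rw [hx]; ring_nf; simp)
  have k3 := key i (j + 1) (by linarith) (by linarith) (by rw [hx]; ring_nf; simp)
  have k4 := key (i + 1) (j + 1) (by linarith) (by linarith) (by rw [hx]; ring_nf; simp)
  obtain ⟨a0, a1⟩ : 0 ≤ s - j ∧ 0 ≤ 1 - (s - j) := ⟨by linarith [hs.1], by linarith [hs.2]⟩
  obtain ⟨b0, b1⟩ : 0 ≤ t - i ∧ 0 ≤ 1 - (t - i) := ⟨by linarith [ht.1], by linarith [ht.2]⟩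
  -- The component is affine in each of the two positions, hence a convex combination of its values
  -- at the four pairs of vertices.
  have m1 := mul_le_mul_of_nonneg_left k1 (mul_nonneg a1 b1)
  have m2 := mul_le_mul_of_nonneg_left k2 (mul_nonneg a1 b0)
  have m3 := mul_le_mul_of_nonneg_left k3 (mul_nonneg a0 b1)
  have m4 := mul_le_mul_of_nonneg_left k4 (mul_nonneg a0 b0)
  linarith

lemma exists_edge {n : ℕ} (hn : n ≠ 0) {s : ℝ} (hs : s ∈ Icc (0 : ℝ) n) :
    ∃ j : ℤ, 0 ≤ j ∧ j + 1 ≤ n ∧ s ∈ Icc (j : ℝ) (j + 1) := by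
  rcases hs.2.lt_or_eq with h | h
  · exact ⟨⌊s⌋, Int.floor_nonneg.2 hs.1, Int.floor_lt.2 (by exact_mod_cast h), Int.floor_le s,
      (Int.lt_floor_add_one s).le⟩
  · refine ⟨n - 1, by omega, by omega, ?_⟩
    push_cast
    constructor <;> linarith

lemma norm_circlePoint_add_one_sub {n : ℕ} (hn : 3 ≤ n) (x : ℝ) :
    ‖circlePoint n (x + 1) - circlePoint n x‖ = 2 * Real.sin (Real.pi / n) := by
  rw [circlePoint_add_one_sub, norm_mul, norm_mul, Complex.norm_I, norm_circlePoint,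
    Complex.norm_real, mul_one, mul_one, Real.norm_of_nonneg]
  have := sin_pi_div_pos hn
  positivity

lemma norm_gonPoint_sub_of_mem {n : ℕ} (hn : 3 ≤ n) {j : ℤ} {s t : ℝ}
    (hs : s ∈ Icc (j : ℝ) (j + 1)) (ht : t ∈ Icc (j : ℝ) (j + 1)) :
    ‖gonPoint n s - gonPoint n t‖ = 2 * Real.sin (Real.pi / n) * |s - t| := by
  have : gonPoint n s - gonPoint n t = (s - t : ℝ) * (circlePoint n (j + 1) - circlePoint n j) := by
    rw [gonPoint_of_mem hs, gonPoint_of_mem ht]; push_cast; ring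
  rw [this, norm_mul, norm_circlePoint_add_one_sub hn, Complex.norm_real, Real.norm_eq_abs,
    mul_comm]

/-- The chord-arc condition for the regular polygon. -/
theorem circDist_le_norm_gonPoint_sub {n : ℕ} (hn : 3 ≤ n) {s t : ℝ} (hs : s ∈ Icc (0 : ℝ) n)
    (ht : t ∈ Icc (0 : ℝ) n) :
    Real.cos (Real.pi / n) * (2 * Real.sin (Real.pi / n)) * circDist n s t ≤
      ‖gonPoint n s - gonPoint n t‖ := by
  have hn0 : n ≠ 0 := by omega
  have hc := cos_pi_div_pos hn
  have hsn := sin_pi_div_pos hn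
  have hcs : 0 ≤ Real.cos (Real.pi / n) * (2 * Real.sin (Real.pi / n)) := by positivity
  obtain ⟨j, hj0, hjn, hsj⟩ := exists_edge hn0 hs
  obtain ⟨i, hi0, hin, hti⟩ := exists_edge hn0 ht
  wlog hji : j ≤ i generalizing s t i j with H
  · have := H ht hs i hi0 hin hti j hj0 hjn hsj (by omega)
    rwa [norm_sub_rev, circDist, abs_sub_comm] at this
  have r1 : circDist n s t ≤ |s - t| := (min_le_left _ _).trans (min_le_left _ _)
  have r2 : circDist n s t ≤ n - |s - t| := (min_le_left _ _).trans (min_le_right _ _)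
  have r3 : circDist n s t ≤ 1 := min_le_right _ _
  rcases hji.eq_or_lt with rfl | hlt
  · rw [norm_gonPoint_sub_of_mem hn hsj hti]
    have h1 := mul_le_mul_of_nonneg_left r1 hcs
    refine h1.trans (mul_le_mul_of_nonneg_right ?_ (abs_nonneg _))
    exact mul_le_of_le_one_left (by positivity) (Real.cos_le_one _)
  have hst : s ≤ t := by
    have : (j : ℝ) + 1 ≤ i := by exact_mod_cast hlt
    linarith [hsj.2, hti.1]
  rw [abs_sub_comm, abs_of_nonneg (sub_nonneg.2 hst)] at r1 r2
  rw [norm_sub_rev]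
  rcases (show j + 1 ≤ i from hlt).eq_or_lt with h1 | h1
  · have hti' : t ∈ Icc ((j : ℝ) + 1) (j + 1 + 1) := by
      rw [← h1] at hti; push_cast at hti; exact hti
    exact (mul_le_mul_of_nonneg_left r1 hcs).trans (le_norm_gonPoint_sub_of_adjacent hsj hti')
  -- The first and the last edge meet at parameter `0 = n`. Shifting `s` by `n` makes them
  -- consecutive, and the relevant distance is `n - |s - t|`.
  rcases (show i + 1 ≤ j + n by omega).eq_or_lt with h2 | h2
  · have hs' : s + n ∈ Icc ((i : ℝ) + 1) (i + 1 + 1) := by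
      have : (i : ℝ) + 1 = j + n := by exact_mod_cast h2
      rw [this]
      constructor <;> linarith [hsj.1, hsj.2]
    have h3 := le_norm_gonPoint_sub_of_adjacent (n := n) hti hs'
    rw [gonPoint_add_natCast hn0, norm_sub_rev] at h3
    refine le_trans (mul_le_mul_of_nonneg_left r2 hcs) (le_trans (le_of_eq ?_) h3)
    ring
  · have h3 := le_norm_gonPoint_sub_of_far hn hsj hti (by omega) (by omega)
    exact (mul_le_of_le_one_right hcs r3).trans h3

lemma hasDerivWithinAt_gonPoint {n : ℕ} {j : ℤ} {s : ℝ} (hs : s ∈ Icc (j : ℝ) (j + 1)) :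
    HasDerivWithinAt (gonPoint n) (circlePoint n (j + 1) - circlePoint n j) (Icc (j : ℝ) (j + 1)) s := by
  have h1 : HasDerivAt (fun s : ℝ => circlePoint n j +
      (s - j : ℝ) * (circlePoint n (j + 1) - circlePoint n j))
      (circlePoint n (j + 1) - circlePoint n j) s := by
    have := ((((hasDerivAt_id s).sub_const (j : ℝ)).ofReal_comp).mul_const
      (circlePoint n (j + 1) - circlePoint n j)).const_add (circlePoint n j)
    simpa using this
  exact h1.hasDerivWithinAt.congr (fun t ht => gonPoint_of_mem ht) (gonPoint_of_mem hs)

lemma continuous_gonPoint (n : ℕ) : Continuous (gonPoint n) := by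
  refine continuous_iff_continuousAt.2 fun s => continuousAt_iff_continuous_left_right.2 ⟨?_, ?_⟩
  · have h1 : ((⌈s⌉ - 1 : ℤ) : ℝ) < s := by
      have := Int.ceil_lt_add_one s; push_cast; linarith
    have h2 : s ≤ ((⌈s⌉ - 1 : ℤ) : ℝ) + 1 := by
      have := Int.le_ceil s; push_cast; linarith
    have h3 := (hasDerivWithinAt_gonPoint (n := n) ⟨h1.le, h2⟩).continuousWithinAt
    exact h3.mono_of_mem_nhdsWithin (mem_of_superset (Ioc_mem_nhdsLE h1)
      fun t ht => ⟨ht.1.le, ht.2.trans h2⟩)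
  · have h1 := Int.floor_le s
    have h2 := Int.lt_floor_add_one s
    have h3 := (hasDerivWithinAt_gonPoint (n := n) ⟨h1, h2.le⟩).continuousWithinAt
    exact h3.mono_of_mem_nhdsWithin (mem_of_superset (Ico_mem_nhdsGE h2)
      fun t ht => ⟨h1.trans ht.1, ht.2.le⟩)

lemma lipschitzWith_gonPoint {n : ℕ} (hn : 3 ≤ n) :
    LipschitzWith (2 * Real.sin (Real.pi / n)).toNNReal (gonPoint n) := by
  have hpos : 0 ≤ 2 * Real.sin (Real.pi / n) := by have := sin_pi_div_pos hn; positivity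
  have key : ∀ a b : ℝ, a ≤ b → ‖gonPoint n b - gonPoint n a‖ ≤
      2 * Real.sin (Real.pi / n) * (b - a) := by
    intro a b hab
    refine norm_image_sub_le_of_norm_deriv_right_le_segment
      (f' := fun s => circlePoint n (⌊s⌋ + 1) - circlePoint n ⌊s⌋)
      (continuous_gonPoint n).continuousOn (fun s _ => ?_)
      (fun s _ => (norm_circlePoint_add_one_sub hn _).le) b ⟨hab, le_rfl⟩
    exact (hasDerivWithinAt_gonPoint ⟨Int.floor_le s, (Int.lt_floor_add_one s).le⟩).mono_of_mem_nhdsWithin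
      (mem_of_superset (Ico_mem_nhdsGE (Int.lt_floor_add_one s))
        fun t ht => ⟨(Int.floor_le s).trans ht.1, ht.2.le⟩)
  refine LipschitzWith.of_dist_le_mul fun a b => ?_
  rw [Real.coe_toNNReal _ hpos, Real.dist_eq, dist_eq_norm]
  rcases le_total a b with h | h
  · rw [norm_sub_rev, abs_sub_comm, abs_of_nonneg (sub_nonneg.2 h)]; exact key a b h
  · rw [abs_of_nonneg (sub_nonneg.2 h)]; exact key b a h

/-- The chord-arc condition also shows that the closed polygon is simple: a vanishing chord forces
circular distance zero. -/
lemma circDist_eq_zero_of_gonPoint_eq {n : ℕ} (hn : 3 ≤ n) {s t : ℝ} (hs : s ∈ Icc (0 : ℝ) n)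
    (ht : t ∈ Icc (0 : ℝ) n) (h : gonPoint n s = gonPoint n t) :
    s = t ∨ (s = 0 ∧ t = n) ∨ (s = n ∧ t = 0) := by
  have h1 := circDist_le_norm_gonPoint_sub hn hs ht
  rw [h, sub_self, norm_zero] at h1
  have h2 : 0 < Real.cos (Real.pi / n) * (2 * Real.sin (Real.pi / n)) := by
    have := cos_pi_div_pos hn
    have := sin_pi_div_pos hn
    positivity
  have h3 : circDist n s t ≤ 0 := by
    by_contra! h4
    nlinarith [mul_pos h2 h4]
  rcases min_le_iff.1 h3 with h4 | h4
  · rcases min_le_iff.1 h4 with h5 | h5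
    · exact Or.inl (sub_eq_zero.1 (abs_nonpos_iff.1 h5))
    · right
      rcases abs_cases (s - t) with h6 | h6
      · right; constructor <;> linarith [hs.1, hs.2, ht.1, ht.2]
      · left; constructor <;> linarith [hs.1, hs.2, ht.1, ht.2]
  · linarith

/-- The integers, where the tangent jumps, are removed from the smooth parameters. Left of a tangent
is then the strict half plane of an edge. -/
lemma boundaryCurve_regularNGon {n : ℕ} (hn : 3 ≤ n) :
    BoundaryCurve (regularNGon n) n (gonPoint n) (Ioo 0 n \ range ((↑) : ℤ → ℝ)) := by
  have hn0 : n ≠ 0 := by omega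
  have hn' : (0 : ℝ) < n := by positivity
  have hL := sin_pi_div_pos hn
  have hUo : IsOpen (Ioo (0 : ℝ) n \ range ((↑) : ℤ → ℝ)) :=
    isOpen_Ioo.sdiff Int.isClosedEmbedding_coe_real.isClosed_range
  have hfl : ∀ s : ℝ, s ∉ range ((↑) : ℤ → ℝ) → s ∈ Ioo (⌊s⌋ : ℝ) (⌊s⌋ + 1) := fun s hs =>
    ⟨(Int.floor_le s).lt_of_ne fun h => hs ⟨⌊s⌋, h⟩, Int.lt_floor_add_one s⟩
  have hd : ∀ s : ℝ, s ∉ range ((↑) : ℤ → ℝ) →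
      HasDerivAt (gonPoint n) (circlePoint n (⌊s⌋ + 1) - circlePoint n ⌊s⌋) s := fun s hs =>
    (hasDerivWithinAt_gonPoint (Ioo_subset_Icc_self (hfl s hs))).hasDerivAt
      (Icc_mem_nhds (hfl s hs).1 (hfl s hs).2)
  refine ⟨?_, ?_, continuous_gonPoint n, hUo, sdiff_subset, ?_,
    fun s hs => (hd s hs.2).differentiableAt, ?_, ?_, ?_, ?_⟩
  · rw [regularNGon_eq]; exact isOpen_interior
  · rw [regularNGon_eq]; exact (isCompact_closedGon n).isBounded.subset interior_subset
  · refine ((finite_Icc (0 : ℤ) n).image ((↑) : ℤ → ℝ)).subset ?_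
    rintro s ⟨hs, hsU⟩
    by_cases hsr : s ∈ range ((↑) : ℤ → ℝ)
    · obtain ⟨j, rfl⟩ := hsr
      exact ⟨j, ⟨by exact_mod_cast hs.1, by exact_mod_cast hs.2⟩, rfl⟩
    · have h1 : ¬ s ∈ Ioo (0 : ℝ) n := fun h => hsU ⟨h, hsr⟩
      exfalso
      apply hsr
      rcases hs.1.eq_or_lt with h2 | h2
      · exact ⟨0, by rw [← h2]; simp⟩
      · exact ⟨n, by push_cast; exact hs.2.antisymm (not_lt.1 fun h3 => h1 ⟨h2, h3⟩) |>.symm⟩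
  · intro s hs
    have h1 : deriv (gonPoint n) =ᶠ[𝓝 s]
        fun _ => circlePoint n (⌊s⌋ + 1) - circlePoint n ⌊s⌋ := by
      filter_upwards [hUo.mem_nhds hs, Ioo_mem_nhds (hfl s hs.2).1 (hfl s hs.2).2] with t ht ht'
      have : ⌊t⌋ = ⌊s⌋ := Int.floor_eq_iff.2 ⟨ht'.1.le, ht'.2⟩
      rw [(hd t ht.2).deriv, this]
    exact (continuousAt_const.congr h1.symm).continuousWithinAt
  · intro s hs t ht hst
    rcases circDist_eq_zero_of_gonPoint_eq hn (Ioo_subset_Icc_self hs.1)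
      (Ioo_subset_Icc_self ht.1) hst with h | h | h
    · exact h
    · exact absurd h.1 hs.1.1.ne'
    · exact absurd h.2 ht.1.1.ne'
  · intro s hs z hz
    rw [(hd s hs.2).deriv, circlePoint_add_one_sub]
    have h1 : conj ((2 * Real.sin (Real.pi / n) : ℝ) * Complex.I * circlePoint n (⌊s⌋ + 1 / 2)) *
        (z - gonPoint n s) = (2 * Real.sin (Real.pi / n) : ℝ) * (Complex.I *
          (conj (circlePoint n (⌊s⌋ + 1 / 2)) * gonPoint n s -
            conj (circlePoint n (⌊s⌋ + 1 / 2)) * z)) := by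
      simp only [map_mul, Complex.conj_ofReal, Complex.conj_I]; ring
    rw [h1, Complex.im_ofReal_mul, Complex.I_mul_im, Complex.sub_re,
      conj_mul_gonPoint_re (Ioo_subset_Icc_self (hfl s hs.2))]
    exact mul_pos (by positivity) (sub_pos.2 (re_conj_mul_lt_of_mem_regularNGon hn0 _ hz))
  · rw [frontier_regularNGon_eq hn]

theorem cos_le_escobarConstant_regularNGon {n k : ℕ} (hn : 3 ≤ n) (hk : n ≤ k) :
    ENNReal.ofReal (Real.cos (Real.pi / n)) ≤ escobarConstant k (regularNGon n) := by
  refine (boundaryCurve_regularNGon hn).ofReal_le_escobarConstant hn hk (lipschitzWith_gonPoint hn)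
    (cos_pi_div_pos hn).le ?_
  intro s hs t ht
  rw [Real.coe_toNNReal _ (by have := sin_pi_div_pos hn; positivity)]
  exact circDist_le_norm_gonPoint_sub hn hs ht

lemma finRotate_val_circlePoint {n : ℕ} (hn : n ≠ 0) (i : Fin n) :
    circlePoint n ((finRotate n i : Fin n) : ℕ) = circlePoint n ((i : ℕ) + 1) := by
  obtain ⟨m, rfl⟩ := Nat.exists_eq_succ_of_ne_zero hn
  rcases eq_or_ne i (Fin.last m) with rfl | h
  · rw [finRotate_last]
    have := circlePoint_natCast hn
    push_cast at this
    simp [this, circlePoint_zero]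
  · rw [coe_finRotate_of_ne_last h]
    push_cast
    rfl

/-- The regular `n`-gon is a Euclidean `n`-gon. -/
theorem isEuclideanNGon_regularNGon {n : ℕ} (hn : 3 ≤ n) : IsEuclideanNGon n (regularNGon n) := by
  have hn0 : n ≠ 0 := by omega
  have hB := boundaryCurve_regularNGon hn
  have hne : (regularNGon n).Nonempty := by
    rw [regularNGon_eq]; exact ⟨0, zero_mem_interior_closedGon hn⟩
  have hconv : Convex ℝ (regularNGon n) := by
    rw [regularNGon_eq]; exact (convex_closedGon n).interior
  set P : Polygon ℂ n := ⟨fun j => circlePoint n (j : ℕ)⟩ with hP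
  have hPj : ∀ j : Fin n, P j = gonPoint n (j : ℕ) := fun j => by
    have := gonPoint_intCast n ((j : ℕ) : ℤ)
    push_cast at this
    exact this.symm
  have hPj1 : ∀ j : Fin n, P (finRotate n j) = gonPoint n ((j : ℕ) + 1) := fun j => by
    have := gonPoint_intCast n (((j : ℕ) : ℤ) + 1)
    push_cast at this
    rw [this]
    exact finRotate_val_circlePoint hn0 j
  have hedge : ∀ j : Fin n, P.edgeSet ℝ j = gonPoint n '' Icc ((j : ℕ) : ℝ) ((j : ℕ) + 1) := by
    intro j
    have hg : ∀ s ∈ Icc ((j : ℕ) : ℝ) ((j : ℕ) + 1), gonPoint n s =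
        AffineMap.lineMap (P j) (P (finRotate n j)) (s - (j : ℕ)) := fun s hs => by
      have h1 := gonPoint_of_mem (n := n) (j := ((j : ℕ) : ℤ)) (s := s) (by push_cast; exact hs)
      have h2 : P (finRotate n j) = circlePoint n ((j : ℕ) + 1) := finRotate_val_circlePoint hn0 j
      rw [h1, AffineMap.lineMap_apply, h2]
      simp only [vsub_eq_sub, vadd_eq_add, Complex.real_smul, hP]
      push_cast
      ring
    rw [Polygon.edgeSet, affineSegment]
    ext z
    constructor
    · rintro ⟨r, hr, rfl⟩
      have hm : ((j : ℕ) : ℝ) + r ∈ Icc ((j : ℕ) : ℝ) ((j : ℕ) + 1) :=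
        ⟨by linarith [hr.1], by linarith [hr.2]⟩
      exact ⟨_, hm, by rw [hg _ hm, add_sub_cancel_left]⟩
    · rintro ⟨s, hs, rfl⟩
      exact ⟨s - (j : ℕ), ⟨by linarith [hs.1], by linarith [hs.2]⟩, (hg s hs).symm⟩
  have hjn : ∀ j : Fin n, ((j : ℕ) : ℝ) + 1 ≤ n := fun j => by exact_mod_cast j.2
  have hj0 : ∀ j : Fin n, (0 : ℝ) ≤ ((j : ℕ) : ℝ) := fun j => by positivity
  have hmem : ∀ j : Fin n, ∀ s ∈ Icc ((j : ℕ) : ℝ) ((j : ℕ) + 1), s ∈ Icc (0 : ℝ) n :=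
    fun j s hs => ⟨(hj0 j).trans hs.1, hs.2.trans (hjn j)⟩
  refine ⟨hB.isOpen, ⟨hne, hconv.isPreconnected⟩, hB.bounded, P, ⟨?_, ?_⟩, ?_⟩
  · intro i j hij
    have hij' : gonPoint n (i : ℕ) = gonPoint n (j : ℕ) := by rw [← hPj, ← hPj]; exact hij
    have hi : ((i : ℕ) : ℝ) ∈ Icc ((i : ℕ) : ℝ) ((i : ℕ) + 1) := ⟨le_rfl, by linarith⟩
    have hj : ((j : ℕ) : ℝ) ∈ Icc ((j : ℕ) : ℝ) ((j : ℕ) + 1) := ⟨le_rfl, by linarith⟩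
    rcases circDist_eq_zero_of_gonPoint_eq hn (hmem i _ hi) (hmem j _ hj) hij' with h | h | h
    · exact Fin.ext (by exact_mod_cast h)
    · linarith [hjn j, h.2]
    · linarith [hjn i, h.1]
  · intro i j hij z hzi hzj
    rw [hedge] at hzi hzj
    obtain ⟨s, hs, rfl⟩ := hzi
    obtain ⟨t, ht, hts⟩ := hzj
    rw [hPj1 i, hPj1 j, hPj i, hPj j]
    rcases circDist_eq_zero_of_gonPoint_eq hn (hmem i s hs) (hmem j t ht) hts.symm with h | h | h
    · subst h
      rcases lt_or_gt_of_ne (Fin.val_ne_of_ne hij) with h1 | h1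
      · have h2 : ((i : ℕ) : ℝ) + 1 ≤ (j : ℕ) := by exact_mod_cast h1
        have h3 : s = (i : ℕ) + 1 := le_antisymm hs.2 (h2.trans ht.1)
        have h4 : s = (j : ℕ) := le_antisymm (hs.2.trans h2) ht.1
        exact ⟨Or.inr (by rw [← h3]), Or.inl (by rw [← h4])⟩
      · have h2 : ((j : ℕ) : ℝ) + 1 ≤ (i : ℕ) := by exact_mod_cast h1
        have h3 : s = (j : ℕ) + 1 := le_antisymm ht.2 (h2.trans hs.1)
        have h4 : s = (i : ℕ) := le_antisymm (ht.2.trans h2) hs.1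
        exact ⟨Or.inl (by rw [← h4]), Or.inr (by rw [← h3])⟩
    · have h3 : s = (i : ℕ) := le_antisymm (h.1 ▸ hj0 i) hs.1
      have h4 : t = (j : ℕ) + 1 := le_antisymm ht.2 (h.2 ▸ hjn j)
      exact ⟨Or.inl (by rw [← h3]), Or.inr (by rw [← h4, hts])⟩
    · have h3 : s = (i : ℕ) + 1 := le_antisymm hs.2 (h.1 ▸ hjn i)
      have h4 : t = (j : ℕ) := le_antisymm (h.2 ▸ hj0 j) ht.1
      exact ⟨Or.inr (by rw [← h3]), Or.inl (by rw [← h4, hts])⟩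
  · rw [frontier_regularNGon_eq hn, Polygon.boundary]
    ext z
    simp only [hedge, mem_iUnion]
    constructor
    · rintro ⟨s, hs, rfl⟩
      obtain ⟨j, h0, h1, hsj⟩ := exists_edge hn0 hs
      lift j to ℕ using h0
      exact ⟨⟨j, by omega⟩, s, by simpa using hsj, rfl⟩
    · rintro ⟨j, s, hs, rfl⟩
      exact ⟨s, hmem j s hs, rfl⟩

/-! ### An extremal vertex with a small angle -/

/-- The length of the set of directions pointing away from both `e^{i(m-φ)}` and `e^{i(m+φ)}`. -/
lemma volume_directions_le {m φ : ℝ} (h1 : φ ≤ Real.pi / 2) :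
    volume ({θ : ℝ | Real.cos (θ - (m - φ)) ≤ 0 ∧ Real.cos (θ - (m + φ)) ≤ 0} ∩
      Ioc 0 (2 * Real.pi)) ≤ ENNReal.ofReal (Real.pi - 2 * φ) := by
  have hpi := Real.pi_pos
  set A : Set ℝ := {θ : ℝ | Real.cos (θ - (m - φ)) ≤ 0 ∧ Real.cos (θ - (m + φ)) ≤ 0} with hA
  have hAm : MeasurableSet A := by
    apply IsClosed.measurableSet
    have hc : ∀ x : ℝ, IsClosed {θ : ℝ | Real.cos (θ - x) ≤ 0} := fun x =>
      isClosed_le (by fun_prop) continuous_const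
    exact (hc _).inter (hc _)
  have hper : ∀ g : AddSubgroup.zmultiples (2 * Real.pi), (fun x => g +ᵥ x) ⁻¹' A = A := by
    rintro ⟨g, hg⟩
    obtain ⟨j, rfl⟩ := AddSubgroup.mem_zmultiples_iff.1 hg
    ext θ
    have h2 : ∀ x : ℝ, Real.cos (j • (2 * Real.pi) + θ - x) = Real.cos (θ - x) := fun x => by
      rw [zsmul_eq_mul, show (j : ℝ) * (2 * Real.pi) + θ - x = θ - x + j * (2 * Real.pi) by ring,
        Real.cos_add_int_mul_two_pi]
    change (Real.cos (j • (2 * Real.pi) + θ - (m - φ)) ≤ 0 ∧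
      Real.cos (j • (2 * Real.pi) + θ - (m + φ)) ≤ 0) ↔ _
    rw [h2, h2]
    rfl
  -- The set is `2π`-periodic, so it may be measured over the period starting at `m`, where it is
  -- contained in a single interval together with the end point `m + 2π`.
  have hs := isAddFundamentalDomain_Ioc Real.two_pi_pos 0 volume
  have ht := isAddFundamentalDomain_Ioc Real.two_pi_pos m volume
  rw [zero_add] at hs
  rw [hs.measure_set_eq ht hAm hper]
  have hsub : A ∩ Ioc m (m + 2 * Real.pi) ⊆
      {m + 2 * Real.pi} ∪ Icc (m + Real.pi / 2 + φ) (m + 3 * Real.pi / 2 - φ) := by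
    rintro θ ⟨⟨h2, h3⟩, h4, h5⟩
    rcases h5.eq_or_lt with h5 | h5
    · exact Or.inl h5
    · right
      constructor
      · by_contra! h6
        exact absurd h3 (not_le.2 (Real.cos_pos_of_mem_Ioo ⟨by linarith, by linarith⟩))
      · by_contra! h6
        have h7 : 0 < Real.cos (θ - (m - φ) - 2 * Real.pi) :=
          Real.cos_pos_of_mem_Ioo ⟨by linarith, by linarith⟩
        rw [Real.cos_sub_two_pi] at h7
        exact absurd h2 (not_le.2 h7)
  refine (measure_mono hsub).trans ((measure_union_le _ _).trans ?_)
  rw [Real.volume_singleton, Real.volume_Icc, zero_add]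
  exact ENNReal.ofReal_le_ofReal (by linarith)

lemma re_conj_exp_mul_exp (θ α : ℝ) :
    (conj (Complex.exp (θ * Complex.I)) * Complex.exp (α * Complex.I)).re = Real.cos (θ - α) := by
  rw [← Complex.exp_conj, ← Complex.exp_add, map_mul, Complex.conj_I, Complex.conj_ofReal,
    show (θ : ℂ) * -Complex.I + α * Complex.I = ((α - θ : ℝ) : ℂ) * Complex.I by push_cast; ring,
    Complex.exp_ofReal_mul_I_re, ← Real.cos_neg, neg_sub]

/-- If many directions point away from the unit vectors `d₁` and `d₂`, then these are close. -/
lemma norm_sub_le_of_directions {d₁ d₂ : ℂ} (hd₁ : ‖d₁‖ = 1) (hd₂ : ‖d₂‖ = 1) {ζ : ℝ}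
    (h0 : 0 < ζ)
    (h : ENNReal.ofReal (2 * ζ) ≤ volume ({θ : ℝ |
      (conj (Complex.exp (θ * Complex.I)) * d₁).re ≤ 0 ∧
      (conj (Complex.exp (θ * Complex.I)) * d₂).re ≤ 0} ∩ Ioc 0 (2 * Real.pi))) :
    ‖d₁ - d₂‖ ≤ 2 * Real.cos ζ := by
  have hpi := Real.pi_pos
  -- For unit vectors at angle `2φ` the distance is `2 sin φ`, and at most `π - 2φ` directions are
  -- available; hence `φ ≤ π / 2 - ζ`.
  have key : ∀ m φ : ℝ, 0 ≤ φ → φ ≤ Real.pi / 2 → ∀ e₁ e₂ : ℂ,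
      e₁ = Complex.exp ((m - φ : ℝ) * Complex.I) → e₂ = Complex.exp ((m + φ : ℝ) * Complex.I) →
      ENNReal.ofReal (2 * ζ) ≤ volume ({θ : ℝ |
        (conj (Complex.exp (θ * Complex.I)) * e₁).re ≤ 0 ∧
        (conj (Complex.exp (θ * Complex.I)) * e₂).re ≤ 0} ∩ Ioc 0 (2 * Real.pi)) →
      ‖e₁ - e₂‖ ≤ 2 * Real.cos ζ := by
    rintro m φ hφ hφ' _ _ rfl rfl hv
    simp only [re_conj_exp_mul_exp] at hv
    have h1 : 2 * ζ ≤ Real.pi - 2 * φ := by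
      by_contra! hlt
      exact absurd (hv.trans (volume_directions_le hφ'))
        (not_le.2 ((ENNReal.ofReal_lt_ofReal_iff (by positivity)).2 hlt))
    have h2 : Complex.exp ((m - φ : ℝ) * Complex.I) - Complex.exp ((m + φ : ℝ) * Complex.I) =
        Complex.exp (m * Complex.I) * ((-2 * Real.sin φ : ℝ) * Complex.I) := by
      have e1 : ((m - φ : ℝ) : ℂ) * Complex.I = m * Complex.I + (-φ : ℝ) * Complex.I := by
        push_cast; ring
      have e2 : ((m + φ : ℝ) : ℂ) * Complex.I = m * Complex.I + (φ : ℝ) * Complex.I := by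
        push_cast; ring
      rw [e1, e2, Complex.exp_add, Complex.exp_add, ← mul_sub]
      congr 1
      apply Complex.ext
      · simp [Complex.exp_ofReal_mul_I_re, -Complex.ofReal_neg, -Complex.ofReal_cos]
      · simp only [Complex.sub_im, Complex.exp_ofReal_mul_I_im, Real.sin_neg]
        simp [-Complex.ofReal_sin]
        ring
    have h3 : Real.sin φ ≤ Real.cos ζ := by
      rw [← Real.sin_pi_div_two_sub]
      exact Real.sin_le_sin_of_le_of_le_pi_div_two (by linarith) (by linarith) (by linarith)
    have h4 : 0 ≤ Real.sin φ := Real.sin_nonneg_of_nonneg_of_le_pi hφ (by linarith)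
    rw [h2, norm_mul, Complex.norm_exp_ofReal_mul_I, norm_mul, Complex.norm_I, one_mul, mul_one,
      Complex.norm_real, Real.norm_eq_abs, abs_mul, abs_of_nonneg h4]
    norm_num
    exact h3
  have hexp : ∀ z : ℂ, ‖z‖ = 1 → Complex.exp (z.arg * Complex.I) = z := fun z hz => by
    have := Complex.norm_mul_exp_arg_mul_I z
    rwa [hz, Complex.ofReal_one, one_mul] at this
  set x := (conj d₁ * d₂).arg with hx
  have hw : d₂ = Complex.exp ((d₁.arg + x : ℝ) * Complex.I) := by
    have h2 : ‖conj d₁ * d₂‖ = 1 := by rw [norm_mul, RCLike.norm_conj, hd₁, hd₂, one_mul]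
    have h3 : d₁ * conj d₁ = 1 := by
      rw [Complex.mul_conj, Complex.normSq_eq_norm_sq, hd₁]; norm_num
    rw [Complex.ofReal_add, add_mul, Complex.exp_add, hexp _ hd₁, hexp _ h2, ← mul_assoc, h3,
      one_mul]
  have hx1 : x ≤ Real.pi := Complex.arg_le_pi _
  have hx2 : -Real.pi < x := Complex.neg_pi_lt_arg _
  rcases le_total 0 x with hx0 | hx0
  · refine key (d₁.arg + x / 2) (x / 2) (by linarith) (by linarith) d₁ d₂ ?_ ?_ h
    · rw [add_sub_cancel_right, hexp _ hd₁]
    · rw [add_assoc, add_halves]; exact hw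
  · rw [norm_sub_rev]
    refine key (d₁.arg + x / 2) (-x / 2) (by linarith) (by linarith) d₂ d₁ ?_ ?_ ?_
    · rw [show d₁.arg + x / 2 - -x / 2 = d₁.arg + x by ring]; exact hw
    · rw [show d₁.arg + x / 2 + -x / 2 = d₁.arg by ring, hexp _ hd₁]
    · simp only [and_comm] at h ⊢; exact h

/-- Among `n` points, some one is extremal in a set of directions of length at least `2π / n`. -/
lemma exists_normalCone {n : ℕ} (hn : n ≠ 0) (p : Fin n → ℂ) :
    ∃ i, ENNReal.ofReal (2 * (Real.pi / n)) ≤ volume ({θ : ℝ | ∀ j,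
      (conj (Complex.exp (θ * Complex.I)) * (p j - p i)).re ≤ 0} ∩ Ioc 0 (2 * Real.pi)) := by
  have : Nonempty (Fin n) := ⟨⟨0, Nat.pos_of_ne_zero hn⟩⟩
  by_contra! hlt
  -- Each direction is maximized by some point, so the `n` sets of directions cover a full turn.
  have hcov : Ioc 0 (2 * Real.pi) ⊆ ⋃ i, ({θ : ℝ | ∀ j,
      (conj (Complex.exp (θ * Complex.I)) * (p j - p i)).re ≤ 0} ∩ Ioc 0 (2 * Real.pi)) := by
    intro θ hθ
    obtain ⟨i, hi⟩ := Finite.exists_max fun j => (conj (Complex.exp (θ * Complex.I)) * p j).re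
    refine mem_iUnion.2 ⟨i, fun j => ?_, hθ⟩
    rw [mul_sub, Complex.sub_re]
    linarith [hi j]
  have h1 := (measure_mono (μ := volume) hcov).trans (measure_iUnion_le _)
  rw [tsum_fintype] at h1
  have h2 := ENNReal.sum_lt_sum_of_nonempty (Finset.univ_nonempty (α := Fin n))
    (fun i _ => hlt i)
  have h3 := h1.trans_lt h2
  rw [Real.volume_Ioc, Finset.sum_const, Finset.card_univ, Fintype.card_fin, nsmul_eq_mul,
    ← ENNReal.ofReal_natCast, ← ENNReal.ofReal_mul (by positivity)] at h3
  refine absurd h3 (not_lt.2 (ENNReal.ofReal_le_ofReal (le_of_eq ?_)))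
  have : (n : ℝ) ≠ 0 := by exact_mod_cast hn
  field_simp
  ring

/-- A bounded open set lies in every half plane which contains its boundary. -/
lemma re_conj_mul_le_of_frontier {M : Set ℂ} (hM : IsOpen M) (hb : Bornology.IsBounded M) {u v : ℂ}
    (hu : u ≠ 0) (h : ∀ z ∈ frontier M, (conj u * (z - v)).re ≤ 0) {z : ℂ} (hz : z ∈ M) :
    (conj u * (z - v)).re ≤ 0 := by
  by_contra! hpos
  have hre : ∀ t : ℝ, (conj u * (z + t * u - v)).re =
      (conj u * (z - v)).re + t * Complex.normSq u := fun t => by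
    rw [show conj u * (z + t * u - v) = conj u * (z - v) + t * (u * conj u) by ring,
      Complex.mul_conj, Complex.add_re, ← Complex.ofReal_mul, Complex.ofReal_re]
  -- From a point of `M` beyond the line, the ray in direction `u` moves further away and never
  -- meets `∂M`, so it would stay in the bounded set `M`.
  have hray : IsPreconnected ((fun t : ℝ => z + t * u) '' Ici 0) :=
    isPreconnected_Ici.image _ (by fun_prop)
  have hnf : ∀ x ∈ (fun t : ℝ => z + t * u) '' Ici 0, x ∉ frontier M := by
    rintro _ ⟨t, ht, rfl⟩ hf
    have h1 := h _ hf
    rw [hre] at h1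
    have : 0 ≤ t * Complex.normSq u := mul_nonneg ht (Complex.normSq_nonneg u)
    linarith
  have hz0 : z ∈ (fun t : ℝ => z + t * u) '' Ici 0 := ⟨0, self_mem_Ici, by simp⟩
  rcases hray.subset_or_disjoint_of_frontier hM hnf with h1 | h1
  · obtain ⟨R, hR⟩ := hb.exists_norm_le
    have hu' : 0 < ‖u‖ := norm_pos_iff.2 hu
    have hR0 : 0 ≤ R := (norm_nonneg z).trans (hR z hz)
    have h2 := hR _ (h1 ⟨(2 * R + 1) / ‖u‖, mem_Ici.2 (by positivity), rfl⟩)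
    have h3 : ‖(((2 * R + 1) / ‖u‖ : ℝ) : ℂ) * u‖ = 2 * R + 1 := by
      rw [norm_mul, Complex.norm_real, Real.norm_of_nonneg (by positivity)]
      field_simp
    have h4 := norm_sub_le (z + (((2 * R + 1) / ‖u‖ : ℝ) : ℂ) * u) z
    rw [add_sub_cancel_left, h3] at h4
    linarith [hR z hz]
  · exact disjoint_left.1 h1 hz0 hz

/-- Near a corner which is extremal in some direction, a bounded open set is the convex sector
bounded by the two edges. -/
lemma sector_subset {M : Set ℂ} (hM : IsOpen M) (hb : Bornology.IsBounded M) {u v d₁ d₂ : ℂ}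
    (hd₁ : ‖d₁‖ = 1) (hd₂ : ‖d₂‖ = 1) (hd : (conj d₁ * d₂).im ≠ 0) {r : ℝ} (hr : 0 < r)
    (hfr : ∀ z ∈ Metric.ball v r, z ∈ frontier M ↔
      (∃ a : ℝ, 0 ≤ a ∧ z = v + a * d₁) ∨ ∃ b : ℝ, 0 ≤ b ∧ z = v + b * d₂)
    (hu : u ≠ 0) (hu₁ : (conj u * d₁).re ≤ 0) (hu₂ : (conj u * d₂).re ≤ 0)
    (hhalf : ∀ z ∈ frontier M, (conj u * (z - v)).re ≤ 0) {a b : ℝ} (ha : 0 < a) (hb' : 0 < b)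
    (hab : a + b < r) : v + a * d₁ + b * d₂ ∈ M := by
  set F : ℂ → ℝ × ℝ := fun z => (coordEquiv d₁ d₂ hd).symm (z - v) with hF
  have hFc : ∀ z, z = v + (F z).1 * d₁ + (F z).2 * d₂ := fun z => by
    have := coordEquiv_apply hd (F z)
    rw [hF, ContinuousLinearEquiv.apply_symm_apply] at this
    rw [add_assoc, ← this]; ring
  have hFv : ∀ x y : ℝ, F (v + x * d₁ + y * d₂) = (x, y) := fun x y => by
    rw [hF]
    simp only
    rw [ContinuousLinearEquiv.symm_apply_eq, coordEquiv_apply]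
    ring
  have hF0 : ∀ x : ℝ, F (v + x * d₁) = (x, 0) := fun x => by
    rw [← hFv]; simp
  have hF1 : ∀ x : ℝ, F (v + x * d₂) = (0, x) := fun x => by
    rw [← hFv]; simp
  have hnot : ∀ z ∈ Metric.ball v r, z ∈ frontier M →
      0 ≤ (F z).1 ∧ 0 ≤ (F z).2 ∧ ((F z).1 = 0 ∨ (F z).2 = 0) := by
    intro z hz hzf
    rcases (hfr z hz).1 hzf with ⟨x, hx, rfl⟩ | ⟨x, hx, rfl⟩
    · rw [hF0]; exact ⟨hx, le_rfl, Or.inr rfl⟩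
    · rw [hF1]; exact ⟨le_rfl, hx, Or.inl rfl⟩
  have hconv : ∀ (s : Set (ℝ × ℝ)), Convex ℝ s → Convex ℝ (Metric.ball v r ∩ F ⁻¹' s) := by
    intro s hs
    refine (convex_ball v r).inter ?_
    intro x hx y hy α β hα hβ hαβ
    have : F (α • x + β • y) = α • F x + β • F y := by
      simp only [hF]
      rw [← map_smul, ← map_smul, ← map_add]
      congr 1
      have hαβ' : (α : ℂ) + β = 1 := by exact_mod_cast hαβ
      simp only [Complex.real_smul]
      linear_combination v * hαβ'
    change F _ ∈ s
    rw [this]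
    exact hs hx hy hα hβ hαβ
  have hlin1 : IsLinearMap ℝ (Prod.fst : ℝ × ℝ → ℝ) := (LinearMap.fst ℝ ℝ ℝ).isLinear
  have hlin2 : IsLinearMap ℝ (Prod.snd : ℝ × ℝ → ℝ) := (LinearMap.snd ℝ ℝ ℝ).isLinear
  have hc1 := hconv _ (convex_halfSpace_lt hlin1 0)
  have hc2 := hconv _ (convex_halfSpace_lt hlin2 0)
  have hc3 := hconv _ ((convex_halfSpace_gt hlin1 0).inter (convex_halfSpace_gt hlin2 0))
  have hball : ∀ x y : ℝ, |x| + |y| < r → v + x * d₁ + y * d₂ ∈ Metric.ball v r := by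
    intro x y hxy
    rw [mem_ball_iff_norm, show v + x * d₁ + y * d₂ - v = x * d₁ + y * d₂ by ring]
    refine (norm_add_le _ _).trans_lt ?_
    rwa [norm_mul, norm_mul, hd₁, hd₂, mul_one, mul_one, Complex.norm_real, Complex.norm_real,
      Real.norm_eq_abs, Real.norm_eq_abs]
  -- In the coordinates `F`, the part of the ball outside the closed quadrant is a union of two
  -- convex sets with a common point. It is connected and contains no boundary point.
  have hO : IsPreconnected ((Metric.ball v r ∩ F ⁻¹' {q | q.1 < 0}) ∪
      (Metric.ball v r ∩ F ⁻¹' {q | q.2 < 0})) := by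
    have hp : v + ((-(r / 4) : ℝ) : ℂ) * d₁ + ((-(r / 4) : ℝ) : ℂ) * d₂ ∈ Metric.ball v r := by
      refine hball _ _ ?_
      rw [abs_neg, abs_of_pos (by positivity)]; linarith
    refine IsPreconnected.union (v + ((-(r / 4) : ℝ) : ℂ) * d₁ + ((-(r / 4) : ℝ) : ℂ) * d₂)
      ⟨hp, ?_⟩ ⟨hp, ?_⟩ hc1.isPreconnected hc2.isPreconnected
    · change (F _).1 < 0
      rw [hFv]; change -(r / 4) < 0; linarith
    · change (F _).2 < 0
      rw [hFv]; change -(r / 4) < 0; linarith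
  have hOd : Disjoint ((Metric.ball v r ∩ F ⁻¹' {q | q.1 < 0}) ∪
      (Metric.ball v r ∩ F ⁻¹' {q | q.2 < 0})) M := by
    refine (hO.subset_or_disjoint_of_frontier hM ?_).resolve_left ?_
    · rintro x (⟨hx, hx'⟩ | ⟨hx, hx'⟩) hxf
      · exact absurd (hnot x hx hxf).1 (not_le.2 hx')
      · exact absurd (hnot x hx hxf).2.1 (not_le.2 hx')
    · intro hsub
      -- The point `v + t * u` lies strictly beyond the supporting line, hence in the outer region
      -- but not in `M`.
      have hu' : 0 < ‖u‖ := norm_pos_iff.2 hu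
      set t : ℝ := r / (2 * ‖u‖) with ht
      have ht0 : 0 < t := by positivity
      set z : ℂ := v + t * u with hz
      have hzb : z ∈ Metric.ball v r := by
        rw [mem_ball_iff_norm, hz, add_sub_cancel_left, norm_mul, Complex.norm_real,
          Real.norm_of_nonneg ht0.le, ht]
        field_simp
        linarith
      have hzre : 0 < (conj u * (z - v)).re := by
        rw [hz, show conj u * (v + t * u - v) = t * (u * conj u) by ring, Complex.mul_conj,
          ← Complex.ofReal_mul, Complex.ofReal_re]
        exact mul_pos ht0 (Complex.normSq_pos.2 hu)
      have hzO : z ∈ (Metric.ball v r ∩ F ⁻¹' {q | q.1 < 0}) ∪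
          (Metric.ball v r ∩ F ⁻¹' {q | q.2 < 0}) := by
        by_contra hno
        simp only [mem_union, mem_inter_iff, hzb, true_and, mem_preimage, mem_ofPred_eq, not_or,
          not_lt] at hno
        have h1 : conj u * (z - v) = (F z).1 * (conj u * d₁) + (F z).2 * (conj u * d₂) := by
          conv_lhs => rw [hFc z]
          ring
        rw [h1, Complex.add_re, Complex.re_ofReal_mul, Complex.re_ofReal_mul] at hzre
        have h2 := mul_nonpos_of_nonneg_of_nonpos hno.1 hu₁
        have h3 := mul_nonpos_of_nonneg_of_nonpos hno.2 hu₂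
        linarith
      exact absurd (re_conj_mul_le_of_frontier hM hb hu hhalf (hsub hzO)) (not_le.2 hzre)
  have hmem : v + a * d₁ + b * d₂ ∈ Metric.ball v r ∩
      F ⁻¹' ({q | 0 < q.1} ∩ {q | 0 < q.2}) := by
    refine ⟨hball a b (by rwa [abs_of_pos ha, abs_of_pos hb']), ?_⟩
    rw [mem_preimage, hFv]
    exact ⟨ha, hb'⟩
  refine ((hc3.isPreconnected.subset_or_disjoint_of_frontier hM ?_).resolve_right ?_) hmem
  · rintro x ⟨hx, hx1, hx2⟩ hxf
    rcases (hnot x hx hxf).2.2 with h | h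
    · exact absurd h (ne_of_gt hx1)
    · exact absurd h (ne_of_gt hx2)
  · intro hdis
    -- The corner is a limit of points of `M`. If `M` missed the open sector as well as the outer
    -- region, such points would lie on the two rays, that is on `∂M`.
    have hv : v ∈ frontier M :=
      (hfr v (Metric.mem_ball_self hr)).2 (Or.inl ⟨0, le_rfl, by simp⟩)
    obtain ⟨y, hyb, hyM⟩ := mem_closure_iff.1 (frontier_subset_closure hv) _ Metric.isOpen_ball
      (Metric.mem_ball_self hr)
    have hyf : y ∉ frontier M := fun hf => (hM.frontier_eq ▸ hf).2 hyM
    have hnO := disjoint_right.1 hOd hyM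
    have hnI := disjoint_right.1 hdis hyM
    simp only [mem_union, mem_inter_iff, hyb, true_and, mem_preimage, mem_ofPred_eq, not_or,
      not_lt] at hnO hnI
    refine hyf ((hfr y hyb).2 ?_)
    rcases hnO.1.eq_or_lt with h0 | h0
    · right
      refine ⟨(F y).2, hnO.2, ?_⟩
      conv_lhs => rw [hFc y, ← h0]
      simp
    · left
      refine ⟨(F y).1, hnO.1, ?_⟩
      have h1 : (F y).2 = 0 := le_antisymm (not_lt.1 fun h => hnI ⟨h0, h⟩) hnO.2
      conv_lhs => rw [hFc y, h1]
      simp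

/-! ### Self-similar trapezoids at a corner -/

/-- The open trapezoid cut out of the first quadrant by two lines of slope `-1`. -/
def quadrantStrip (s t : ℝ) : Set (ℝ × ℝ) :=
  {q | 0 < q.1 ∧ 0 < q.2 ∧ s < q.1 + q.2 ∧ q.1 + q.2 < t}

lemma isOpen_quadrantStrip (s t : ℝ) : IsOpen (quadrantStrip s t) :=
  (isOpen_lt continuous_const continuous_fst).inter
    ((isOpen_lt continuous_const continuous_snd).inter
      ((isOpen_lt continuous_const (continuous_fst.add continuous_snd)).inter
        (isOpen_lt (continuous_fst.add continuous_snd) continuous_const)))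

lemma closure_quadrantStrip {s t : ℝ} (hs : 0 < s) (hst : s < t) :
    closure (quadrantStrip s t) = {q | 0 ≤ q.1 ∧ 0 ≤ q.2 ∧ s ≤ q.1 + q.2 ∧ q.1 + q.2 ≤ t} := by
  apply Subset.antisymm
  · refine closure_minimal (fun q hq => ⟨hq.1.le, hq.2.1.le, hq.2.2.1.le, hq.2.2.2.le⟩) ?_
    exact (isClosed_le continuous_const continuous_fst).inter
      ((isClosed_le continuous_const continuous_snd).inter
        ((isClosed_le continuous_const (continuous_fst.add continuous_snd)).inter
          (isClosed_le (continuous_fst.add continuous_snd) continuous_const)))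
  · rintro q ⟨h1, h2, h3, h4⟩
    -- Moving towards the interior point with equal coordinates and sum `(s + t) / 2` makes all four
    -- inequalities strict.
    have hq : q ∈ closure (openSegment ℝ ((s + t) / 4, (s + t) / 4) q) := by
      rw [closure_openSegment]
      exact right_mem_segment ℝ _ _
    refine closure_mono ?_ hq
    rintro _ ⟨α, β, hα, hβ, hαβ, rfl⟩
    simp only [quadrantStrip, mem_ofPred_eq, Prod.fst_add, Prod.snd_add, Prod.smul_fst,
      Prod.smul_snd, smul_eq_mul]
    have h5 : β = 1 - α := by linarith
    have h6 := mul_nonneg hβ.le h1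
    have h7 := mul_nonneg hβ.le h2
    have h8 := mul_le_mul_of_nonneg_left h3 hβ.le
    have h9 := mul_le_mul_of_nonneg_left h4 hβ.le
    have h10 : 0 < α * ((s + t) / 4) := mul_pos hα (by linarith)
    have h11 : 0 < α * (t - s) := mul_pos hα (by linarith)
    subst h5
    refine ⟨by linarith, by linarith, ?_, ?_⟩ <;> linarith

/-- Starting points of the four sides of `quadrantStrip s t`. -/
def stripCorner (s t : ℝ) : Fin 4 → ℝ × ℝ := ![(s, 0), (0, s), (s, 0), (t, 0)]

/-- Direction vectors of the four sides of `quadrantStrip s t`. -/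
def stripSide (s t : ℝ) : Fin 4 → ℝ × ℝ := ![(t - s, 0), (0, t - s), (-s, s), (-t, t)]

lemma mem_frontier_quadrantStrip {s t : ℝ} (hs : 0 < s) (hst : s < t) {q : ℝ × ℝ} :
    q ∈ frontier (quadrantStrip s t) ↔
      ∃ i, ∃ x ∈ Icc (0 : ℝ) 1, stripCorner s t i + x • stripSide s t i = q := by
  have ht : 0 < t := hs.trans hst
  have hts : 0 < t - s := sub_pos.2 hst
  obtain ⟨a, b⟩ := q
  rw [(isOpen_quadrantStrip s t).frontier_eq, closure_quadrantStrip hs hst]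
  simp only [quadrantStrip, Set.mem_sdiff, mem_ofPred_eq, Fin.exists_fin_succ, stripCorner, stripSide]
  simp only [Matrix.cons_val_zero, Matrix.cons_val_succ, Prod.smul_mk, Prod.mk_add_mk,
    smul_eq_mul, Prod.mk.injEq, IsEmpty.exists_iff, or_false]
  constructor
  · rintro ⟨⟨h1, h2, h3, h4⟩, h5⟩
    by_cases hb : b = 0
    · subst hb
      refine Or.inl ⟨(a - s) / (t - s), ⟨div_nonneg (by linarith) hts.le, ?_⟩, ?_, by ring⟩
      · rw [div_le_one hts]; linarith
      · rw [div_mul_cancel₀ _ hts.ne']; ring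
    by_cases ha : a = 0
    · subst ha
      refine Or.inr (Or.inl ⟨(b - s) / (t - s), ⟨div_nonneg (by linarith) hts.le, ?_⟩, by ring, ?_⟩)
      · rw [div_le_one hts]; linarith
      · rw [div_mul_cancel₀ _ hts.ne']; ring
    have ha' : 0 < a := lt_of_le_of_ne h1 (Ne.symm ha)
    have hb' : 0 < b := lt_of_le_of_ne h2 (Ne.symm hb)
    rcases h3.eq_or_lt with h6 | h6
    · refine Or.inr (Or.inr (Or.inl ⟨b / s, ⟨by positivity, ?_⟩, ?_, ?_⟩))
      · rw [div_le_one hs]; linarith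
      · field_simp; linarith
      · field_simp; linarith
    · have h7 : a + b = t := le_antisymm h4 (not_lt.1 fun h7 => h5 ⟨ha', hb', h6, h7⟩)
      refine Or.inr (Or.inr (Or.inr ⟨b / t, ⟨by positivity, ?_⟩, ?_, ?_⟩))
      · rw [div_le_one ht]; linarith
      · field_simp; linarith
      · field_simp; linarith
  · rintro (⟨x, ⟨h1, h2⟩, rfl, rfl⟩ | ⟨x, ⟨h1, h2⟩, rfl, rfl⟩ | ⟨x, ⟨h1, h2⟩, rfl, rfl⟩ |
      ⟨x, ⟨h1, h2⟩, rfl, rfl⟩)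
    · have h3 := mul_nonneg h1 hts.le
      have h4 := mul_le_mul_of_nonneg_right h2 hts.le
      exact ⟨⟨by linarith, by linarith, by linarith, by linarith⟩, fun h => by linarith [h.2.1]⟩
    · have h3 := mul_nonneg h1 hts.le
      have h4 := mul_le_mul_of_nonneg_right h2 hts.le
      exact ⟨⟨by linarith, by linarith, by linarith, by linarith⟩, fun h => by linarith [h.1]⟩
    · have h3 := mul_nonneg h1 hs.le
      have h4 := mul_le_mul_of_nonneg_right h2 hs.le
      exact ⟨⟨by linarith, by linarith, by linarith, by linarith⟩, fun h => by linarith [h.2.2.1]⟩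
    · have h3 := mul_nonneg h1 ht.le
      have h4 := mul_le_mul_of_nonneg_right h2 ht.le
      exact ⟨⟨by linarith, by linarith, by linarith, by linarith⟩, fun h => by linarith [h.2.2.2]⟩

lemma stripSide_ne_zero {s t : ℝ} (hs : 0 < s) (hst : s < t) (i : Fin 4) :
    stripSide s t i ≠ 0 := by
  have ht : 0 < t := hs.trans hst
  have hts : t - s ≠ 0 := (sub_pos.2 hst).ne'
  fin_cases i <;> simp [stripSide, Prod.ext_iff, hts, hs.ne', ht.ne']

lemma stripSide_meet {s t : ℝ} (hs : 0 < s) (hst : s < t) {i j : Fin 4} {x y : ℝ}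
    (hx : x ∈ Icc (0 : ℝ) 1) (hy : y ∈ Icc (0 : ℝ) 1)
    (h : stripCorner s t i + x • stripSide s t i = stripCorner s t j + y • stripSide s t j) :
    (i = j ∧ x = y) ∨ ((x = 0 ∨ x = 1) ∧ (y = 0 ∨ y = 1)) := by
  have ht : 0 < t := hs.trans hst
  have hts : 0 < t - s := sub_pos.2 hst
  have hx1 := mul_nonneg hx.1 hts.le
  have hy1 := mul_nonneg hy.1 hts.le
  fin_cases i <;> fin_cases j <;>
    simp [stripCorner, stripSide, Prod.ext_iff, hs.ne', ht.ne', hts.ne'] at h ⊢ <;>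
    first | exact Or.inl h | (exfalso; linarith [h.1, h.2]) | grind

/-- The affine isomorphism `(a, b) ↦ v + a d₁ + b d₂`. -/
noncomputable def cornerMap (v : ℂ) {d₁ d₂ : ℂ} (hd : (conj d₁ * d₂).im ≠ 0) : ℝ × ℝ ≃ₜ ℂ :=
  (coordEquiv d₁ d₂ hd).toHomeomorph.trans (Homeomorph.addLeft v)

lemma cornerMap_apply (v : ℂ) {d₁ d₂ : ℂ} (hd : (conj d₁ * d₂).im ≠ 0) (q : ℝ × ℝ) :
    cornerMap v hd q = v + (q.1 * d₁ + q.2 * d₂) :=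
  congrArg (v + ·) (coordEquiv_apply hd q)

lemma cornerMap_line (v : ℂ) {d₁ d₂ : ℂ} (hd : (conj d₁ * d₂).im ≠ 0) (p w : ℝ × ℝ) (x : ℝ) :
    cornerMap v hd (p + x • w) = cornerMap v hd p + x • coordEquiv d₁ d₂ hd w := by
  simp only [cornerMap_apply, coordEquiv_apply, Prod.fst_add, Prod.snd_add, Prod.smul_fst,
    Prod.smul_snd, smul_eq_mul, Complex.real_smul]
  push_cast
  ring

lemma hausdorffMeasure_image_line (A B : ℂ) :
    μH[1] ((fun x : ℝ => A + x • B) '' Icc 0 1) = ENNReal.ofReal ‖B‖ := by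
  have h := segment_eq_image' ℝ A (A + B)
  rw [add_sub_cancel_left] at h
  rw [← h, MeasureTheory.hausdorffMeasure_segment, edist_dist, dist_eq_norm, ← norm_neg]
  congr 2
  ring

lemma frontier_cornerMap_quadrantStrip (v : ℂ) {d₁ d₂ : ℂ} (hd : (conj d₁ * d₂).im ≠ 0) {s t : ℝ}
    (hs : 0 < s) (hst : s < t) :
    frontier (cornerMap v hd '' quadrantStrip s t) = ⋃ i, (fun x : ℝ =>
      cornerMap v hd (stripCorner s t i) + x • coordEquiv d₁ d₂ hd (stripSide s t i)) ''
        Icc 0 1 := by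
  rw [← Homeomorph.image_frontier]
  ext z
  simp only [mem_image, mem_iUnion, mem_frontier_quadrantStrip hs hst, ← cornerMap_line]
  constructor
  · rintro ⟨_, ⟨i, x, hx, rfl⟩, rfl⟩
    exact ⟨i, x, hx, rfl⟩
  · rintro ⟨i, x, hx, rfl⟩
    exact ⟨_, ⟨i, x, hx, rfl⟩, rfl⟩

lemma cornerMap_quadrantStrip_mem_escobarSets {M : Set ℂ} {v d₁ d₂ : ℂ} (hd : (conj d₁ * d₂).im ≠ 0) {ρ : ℝ}
    (hI : ∀ a b : ℝ, 0 < a → 0 < b → a + b < ρ → v + a * d₁ + b * d₂ ∈ M) {s t : ℝ} (hs : 0 < s)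
    (hst : s < t) (ht : t ≤ ρ) : cornerMap v hd '' quadrantStrip s t ∈ escobarSets M := by
  refine ⟨?_, ?_, (cornerMap v hd).isOpenMap _ (isOpen_quadrantStrip s t), 4, _, ?_, ?_, ?_,
    frontier_cornerMap_quadrantStrip v hd hs hst⟩
  · rintro _ ⟨q, ⟨h1, h2, -, h3⟩, rfl⟩
    rw [cornerMap_apply, ← add_assoc]
    exact hI _ _ h1 h2 (h3.trans_le ht)
  · exact ⟨_, ((s + t) / 4, (s + t) / 4),
      ⟨by dsimp only; linarith, by dsimp only; linarith, by dsimp only; linarith,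
        by dsimp only; linarith⟩, rfl⟩
  · intro i
    fun_prop
  · intro i x hx
    have h1 : HasDerivAt (fun x : ℝ => cornerMap v hd (stripCorner s t i) +
        x • coordEquiv d₁ d₂ hd (stripSide s t i))
        ((1 : ℝ) • coordEquiv d₁ d₂ hd (stripSide s t i)) x :=
      ((hasDerivAt_id x).smul_const _).const_add _
    rw [h1.hasDerivWithinAt.derivWithin (uniqueDiffOn_Icc one_pos x hx), one_smul]
    exact (map_ne_zero_iff _ (coordEquiv d₁ d₂ hd).injective).2 (stripSide_ne_zero hs hst i)
  · intro i j x hx y hy h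
    simp only [← cornerMap_line] at h
    exact stripSide_meet hs hst hx hy ((cornerMap v hd).injective h)

/-- The legs, each of length `t - s`, lie on `∂M`. Only the parallel sides, of lengths `s * ‖d₁ -
d₂‖` and `t * ‖d₁ - d₂‖`, can run inside `M`. -/
lemma escobarRatio_cornerMap_le {M : Set ℂ} {v d₁ d₂ : ℂ} (hd : (conj d₁ * d₂).im ≠ 0)
    (hd₁ : ‖d₁‖ = 1) (hd₂ : ‖d₂‖ = 1) (hM : IsOpen M) {ρ : ℝ}
    (hR₁ : ∀ a : ℝ, 0 ≤ a → a < ρ → v + a * d₁ ∈ frontier M)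
    (hR₂ : ∀ b : ℝ, 0 ≤ b → b < ρ → v + b * d₂ ∈ frontier M) {s t : ℝ} (hs : 0 < s)
    (hst : s < t) (ht : t < ρ) :
    escobarRatio M (cornerMap v hd '' quadrantStrip s t) ≤
      ENNReal.ofReal ((s + t) / (t - s) * (‖d₁ - d₂‖ / 2)) := by
  have ht0 : 0 < t := hs.trans hst
  have hts : 0 < t - s := sub_pos.2 hst
  set γ : Fin 4 → ℝ → ℂ := fun i x =>
    cornerMap v hd (stripCorner s t i) + x • coordEquiv d₁ d₂ hd (stripSide s t i) with hγ
  have hfr : frontier (cornerMap v hd '' quadrantStrip s t) = ⋃ i, γ i '' Icc 0 1 :=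
    frontier_cornerMap_quadrantStrip v hd hs hst
  have hle : ∀ x ∈ Icc (0 : ℝ) 1, 0 ≤ s + x * (t - s) ∧ s + x * (t - s) < ρ := fun x hx => by
    have h1 := mul_nonneg hx.1 hts.le
    have h2 := mul_le_mul_of_nonneg_right hx.2 hts.le
    exact ⟨by linarith, by linarith⟩
  have h0 : γ 0 '' Icc 0 1 ⊆ frontier M := by
    rintro _ ⟨x, hx, rfl⟩
    have : γ 0 x = v + ((s + x * (t - s) : ℝ) : ℂ) * d₁ := by
      simp only [hγ, cornerMap_apply, coordEquiv_apply, stripCorner, stripSide,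
        Matrix.cons_val_zero, Complex.real_smul]
      push_cast; ring
    rw [this]
    exact hR₁ _ (hle x hx).1 (hle x hx).2
  have h1 : γ 1 '' Icc 0 1 ⊆ frontier M := by
    rintro _ ⟨x, hx, rfl⟩
    have : γ 1 x = v + ((s + x * (t - s) : ℝ) : ℂ) * d₂ := by
      simp only [hγ, cornerMap_apply, coordEquiv_apply, stripCorner, stripSide,
        Matrix.cons_val_one, Matrix.cons_val_zero, Complex.real_smul]
      push_cast; ring
    rw [this]
    exact hR₂ _ (hle x hx).1 (hle x hx).2
  have hext : γ 0 '' Icc 0 1 ∪ γ 1 '' Icc 0 1 ⊆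
      exteriorBoundary M (cornerMap v hd '' quadrantStrip s t) := by
    refine subset_inter (hfr ▸ union_subset ?_ ?_) (union_subset h0 h1)
    · exact subset_iUnion (fun i => γ i '' Icc 0 1) 0
    · exact subset_iUnion (fun i => γ i '' Icc 0 1) 1
  have hint : interiorBoundary M (cornerMap v hd '' quadrantStrip s t) ⊆
      γ 2 '' Icc 0 1 ∪ γ 3 '' Icc 0 1 := by
    rintro z ⟨hz, hzM⟩
    have hzf : z ∉ frontier M := fun h => (hM.frontier_eq ▸ h).2 hzM
    rw [hfr] at hz
    obtain ⟨i, hi⟩ := mem_iUnion.1 hz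
    fin_cases i
    · exact absurd (h0 hi) hzf
    · exact absurd (h1 hi) hzf
    · exact Or.inl hi
    · exact Or.inr hi
  have hγc : ∀ i, Continuous (γ i) := fun i => by fun_prop
  have hdisj : Disjoint (γ 0 '' Icc 0 1) (γ 1 '' Icc 0 1) := by
    rw [disjoint_left]
    rintro _ ⟨x, hx, rfl⟩ ⟨y, hy, h⟩
    simp only [hγ, ← cornerMap_line] at h
    have h2 := congrArg Prod.snd ((cornerMap v hd).injective h)
    simp [stripCorner, stripSide] at h2
    have := mul_nonneg hy.1 hts.le
    linarith
  have hnorm : ∀ i, μH[1] (γ i '' Icc 0 1) =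
      ENNReal.ofReal ‖coordEquiv d₁ d₂ hd (stripSide s t i)‖ := fun i =>
    hausdorffMeasure_image_line _ _
  have n0 : ‖coordEquiv d₁ d₂ hd (stripSide s t 0)‖ = t - s := by
    have : coordEquiv d₁ d₂ hd (stripSide s t 0) = ((t - s : ℝ) : ℂ) * d₁ := by
      simp [coordEquiv_apply, stripSide]
    rw [this, norm_mul, Complex.norm_real, Real.norm_of_nonneg hts.le, hd₁, mul_one]
  have n1 : ‖coordEquiv d₁ d₂ hd (stripSide s t 1)‖ = t - s := by
    have : coordEquiv d₁ d₂ hd (stripSide s t 1) = ((t - s : ℝ) : ℂ) * d₂ := by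
      simp [coordEquiv_apply, stripSide]
    rw [this, norm_mul, Complex.norm_real, Real.norm_of_nonneg hts.le, hd₂, mul_one]
  have n2 : ‖coordEquiv d₁ d₂ hd (stripSide s t 2)‖ = s * ‖d₁ - d₂‖ := by
    have : coordEquiv d₁ d₂ hd (stripSide s t 2) = ((-s : ℝ) : ℂ) * (d₁ - d₂) := by
      simp [coordEquiv_apply, stripSide]; ring
    rw [this, norm_mul, Complex.norm_real, norm_neg, Real.norm_of_nonneg hs.le]
  have n3 : ‖coordEquiv d₁ d₂ hd (stripSide s t 3)‖ = t * ‖d₁ - d₂‖ := by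
    have : coordEquiv d₁ d₂ hd (stripSide s t 3) = ((-t : ℝ) : ℂ) * (d₁ - d₂) := by
      simp [coordEquiv_apply, stripSide]; ring
    rw [this, norm_mul, Complex.norm_real, norm_neg, Real.norm_of_nonneg ht0.le]
  have hI : μH[1] (interiorBoundary M (cornerMap v hd '' quadrantStrip s t)) ≤
      ENNReal.ofReal ((s + t) * ‖d₁ - d₂‖) := by
    refine (measure_mono hint).trans ((measure_union_le _ _).trans ?_)
    rw [hnorm, hnorm, n2, n3, ← ENNReal.ofReal_add (by positivity) (by positivity), add_mul]
  have hE : ENNReal.ofReal (2 * (t - s)) ≤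
      μH[1] (exteriorBoundary M (cornerMap v hd '' quadrantStrip s t)) := by
    refine le_trans (le_of_eq ?_) (measure_mono hext)
    rw [measure_union hdisj (isCompact_Icc.image (hγc 1)).isClosed.measurableSet, hnorm, hnorm, n0,
      n1, ← ENNReal.ofReal_add hts.le hts.le, two_mul]
  have hne : exteriorBoundary M (cornerMap v hd '' quadrantStrip s t) ≠ ∅ :=
    (Nonempty.mono hext ⟨γ 0 0, Or.inl ⟨0, ⟨le_rfl, zero_le_one⟩, rfl⟩⟩).ne_empty
  rw [escobarRatio, if_neg hne]
  refine (ENNReal.div_le_div hI hE).trans (le_of_eq ?_)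
  rw [← ENNReal.ofReal_div_of_pos (by positivity)]
  congr 1
  field_simp

/-- Self-similar trapezoids at a convex corner bound all Escobar constants. -/
theorem escobarConstant_le_of_sector {M : Set ℂ} {v d₁ d₂ : ℂ} (hd : (conj d₁ * d₂).im ≠ 0)
    (hd₁ : ‖d₁‖ = 1) (hd₂ : ‖d₂‖ = 1) (hM : IsOpen M) {ρ : ℝ}
    (hρ : 0 < ρ) (hI : ∀ a b : ℝ, 0 < a → 0 < b → a + b < ρ → v + a * d₁ + b * d₂ ∈ M)
    (hR₁ : ∀ a : ℝ, 0 ≤ a → a < ρ → v + a * d₁ ∈ frontier M)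
    (hR₂ : ∀ b : ℝ, 0 ≤ b → b < ρ → v + b * d₂ ∈ frontier M) (k : ℕ) :
    escobarConstant k M ≤ ENNReal.ofReal (‖d₁ - d₂‖ / 2) := by
  have key : ∀ ε ∈ Ioo (0 : ℝ) 1, escobarConstant k M ≤
      ENNReal.ofReal ((ε + 1) / (1 - ε) * (‖d₁ - d₂‖ / 2)) := by
    rintro ε ⟨hε0, hε1⟩
    -- Geometric radii make all trapezoids similar, so the bound for the ratio depends on `ε` alone.
    -- The factor `1 / 2` keeps the largest radius strictly below `ρ`.
    have hpos : ∀ j : ℕ, 0 < ρ / 2 * ε ^ j := fun j => by positivity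
    have hlt : ∀ j : ℕ, ρ / 2 * ε ^ (j + 1) < ρ / 2 * ε ^ j := fun j =>
      mul_lt_mul_of_pos_left (pow_lt_pow_right_of_lt_one₀ hε0 hε1 j.lt_succ_self) (by positivity)
    have hanti : ∀ i j : ℕ, i ≤ j → ρ / 2 * ε ^ j ≤ ρ / 2 * ε ^ i := fun i j hij =>
      mul_le_mul_of_nonneg_left (pow_le_pow_of_le_one hε0.le hε1.le hij) (by positivity)
    have htop : ∀ j : ℕ, ρ / 2 * ε ^ j < ρ := fun j => by
      have := hanti 0 j (Nat.zero_le _)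
      rw [pow_zero, mul_one] at this
      linarith
    refine iInf₂_le_of_le
      (fun j : Fin k => cornerMap v hd '' quadrantStrip (ρ / 2 * ε ^ ((j : ℕ) + 1))
        (ρ / 2 * ε ^ (j : ℕ)))
      (fun j => cornerMap_quadrantStrip_mem_escobarSets hd hI (hpos _) (hlt _) (htop _).le)
      (iInf_le_of_le ?_ (iSup_le fun j => ?_))
    · have hwlog : ∀ i j : ℕ, i < j → Disjoint
          (cornerMap v hd '' quadrantStrip (ρ / 2 * ε ^ (i + 1)) (ρ / 2 * ε ^ i))
          (cornerMap v hd '' quadrantStrip (ρ / 2 * ε ^ (j + 1)) (ρ / 2 * ε ^ j)) := by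
        intro i j hij
        rw [disjoint_image_iff (cornerMap v hd).injective, disjoint_left]
        intro q hq hq'
        exact absurd (hq.2.2.1.trans hq'.2.2.2) (not_lt.2 (hanti _ _ hij))
      intro i j hij
      rcases lt_or_gt_of_ne (Fin.val_ne_of_ne hij) with h | h
      · exact hwlog _ _ h
      · exact (hwlog _ _ h).symm
    · refine (escobarRatio_cornerMap_le hd hd₁ hd₂ hM hR₁ hR₂ (hpos _) (hlt _) (htop _)).trans
        (le_of_eq ?_)
      congr 2
      have h1 : 1 - ε ≠ 0 := by linarith
      have h2 := (hpos (j : ℕ)).ne'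
      have h3 : ρ / 2 * ε ^ (j : ℕ) - ρ / 2 * ε ^ ((j : ℕ) + 1) =
          ρ / 2 * ε ^ (j : ℕ) * (1 - ε) := by ring
      have h4 : ρ / 2 * ε ^ ((j : ℕ) + 1) + ρ / 2 * ε ^ (j : ℕ) =
          ρ / 2 * ε ^ (j : ℕ) * (ε + 1) := by ring
      rw [h3, h4, mul_div_mul_left _ _ h2]
  have hlim : Tendsto (fun ε : ℝ => ENNReal.ofReal ((ε + 1) / (1 - ε) * (‖d₁ - d₂‖ / 2)))
      (𝓝[>] 0) (𝓝 (ENNReal.ofReal (‖d₁ - d₂‖ / 2))) := by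
    have hc : ContinuousAt (fun ε : ℝ => (ε + 1) / (1 - ε) * (‖d₁ - d₂‖ / 2)) 0 := by
      refine ContinuousAt.mul (ContinuousAt.div ?_ ?_ (by norm_num)) continuousAt_const <;> fun_prop
    have h1 : Tendsto (fun ε : ℝ => (ε + 1) / (1 - ε) * (‖d₁ - d₂‖ / 2)) (𝓝 0)
        (𝓝 (‖d₁ - d₂‖ / 2)) := by
      have := hc.tendsto
      simpa using this
    exact ENNReal.tendsto_ofReal (h1.mono_left nhdsWithin_le_nhds)
  refine ge_of_tendsto hlim ?_
  filter_upwards [Ioo_mem_nhdsGT one_pos] with ε hε using key ε hε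

/-! ### The upper bound for polygons and the conclusion -/

lemma im_conj_mul_ne_zero {d₁ d₂ : ℂ} (hd₁ : ‖d₁‖ = 1) (hd₂ : ‖d₂‖ = 1) (h1 : d₁ ≠ d₂)
    (h2 : d₁ ≠ -d₂) : (conj d₁ * d₂).im ≠ 0 := by
  intro h
  have h3 : d₁ * conj d₁ = 1 := by
    rw [Complex.mul_conj, Complex.normSq_eq_norm_sq, hd₁]; norm_num
  have h4 : ‖conj d₁ * d₂‖ = 1 := by rw [norm_mul, RCLike.norm_conj, hd₁, hd₂, one_mul]
  have h5 : conj d₁ * d₂ = ((conj d₁ * d₂).re : ℂ) := by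
    apply Complex.ext
    · rw [Complex.ofReal_re]
    · rw [h, Complex.ofReal_im]
  have h6 : d₂ = d₁ * ((conj d₁ * d₂).re : ℂ) := by rw [← h5, ← mul_assoc, h3, one_mul]
  rw [h5, Complex.norm_real, Real.norm_eq_abs] at h4
  rcases eq_or_eq_neg_of_abs_eq h4 with h7 | h7
  · rw [h7, Complex.ofReal_one, mul_one] at h6
    exact h1 h6.symm
  · rw [h7] at h6
    apply h2
    rw [h6]; simp

lemma mem_segment_of_direction {v w : ℂ} (hvw : w ≠ v) {z : ℂ} :
    z ∈ affineSegment ℝ v w ↔ ∃ a : ℝ, 0 ≤ a ∧ a ≤ ‖w - v‖ ∧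
      z = v + a * ((w - v) / (‖w - v‖ : ℝ)) := by
  have h0 : 0 < ‖w - v‖ := norm_pos_iff.2 (sub_ne_zero.2 hvw)
  have h0' : (‖w - v‖ : ℂ) ≠ 0 := by exact_mod_cast h0.ne'
  rw [affineSegment]
  constructor
  · rintro ⟨x, hx, rfl⟩
    refine ⟨x * ‖w - v‖, mul_nonneg hx.1 h0.le, mul_le_of_le_one_left h0.le hx.2, ?_⟩
    rw [AffineMap.lineMap_apply, vsub_eq_sub, vadd_eq_add, Complex.real_smul]
    push_cast
    field_simp
    ring
  · rintro ⟨a, ha, ha', rfl⟩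
    refine ⟨a / ‖w - v‖, ⟨by positivity, (div_le_one h0).2 ha'⟩, ?_⟩
    rw [AffineMap.lineMap_apply, vsub_eq_sub, vadd_eq_add, Complex.real_smul]
    push_cast
    field_simp
    ring

/-- The Escobar constants of an `n`-gon are at most `cos (π / n)`. -/
theorem escobarConstant_le_cos {n : ℕ} (hn : 3 ≤ n) {M : Set ℂ} (hM : IsEuclideanNGon n M)
    (k : ℕ) : escobarConstant k M ≤ ENNReal.ofReal (Real.cos (Real.pi / n)) := by
  obtain ⟨hMo, -, hMb, P, ⟨hinj, hmeet⟩, hfr⟩ := hM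
  obtain ⟨i, hi⟩ := exists_normalCone (by omega : n ≠ 0) fun j => P j
  have hn0 : (0 : ℝ) < n := by positivity
  have hζ : 0 < Real.pi / n := div_pos Real.pi_pos hn0
  have hrot : ∀ j : Fin n, finRotate n j ≠ j := by
    obtain ⟨m, rfl⟩ : ∃ m, n = m + 2 := ⟨n - 2, by omega⟩
    intro j hj
    have h1 : j ∈ (finRotate (m + 2)).support := by rw [support_finRotate]; exact Finset.mem_univ j
    exact Equiv.Perm.mem_support.1 h1 hj
  set i' : Fin n := (finRotate n).symm i with hi'
  have hroti' : finRotate n i' = i := Equiv.apply_symm_apply _ _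
  have hii' : i ≠ i' := fun h => hrot i' (hroti'.trans h)
  set v := P i with hv
  set w₁ := P (finRotate n i) with hw₁
  set w₂ := P i' with hw₂
  have hw₁v : w₁ ≠ v := fun h => hrot i (hinj h)
  have hw₂v : w₂ ≠ v := fun h => hii' (hinj h).symm
  have hℓ₁ : 0 < ‖w₁ - v‖ := norm_pos_iff.2 (sub_ne_zero.2 hw₁v)
  have hℓ₂ : 0 < ‖w₂ - v‖ := norm_pos_iff.2 (sub_ne_zero.2 hw₂v)
  set d₁ := (w₁ - v) / (‖w₁ - v‖ : ℝ) with hd₁e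
  set d₂ := (w₂ - v) / (‖w₂ - v‖ : ℝ) with hd₂e
  have hd₁ : ‖d₁‖ = 1 := by
    rw [hd₁e, norm_div, Complex.norm_real, norm_norm, div_self hℓ₁.ne']
  have hd₂ : ‖d₂‖ = 1 := by
    rw [hd₂e, norm_div, Complex.norm_real, norm_norm, div_self hℓ₂.ne']
  have hedge₁ : ∀ z, z ∈ P.edgeSet ℝ i ↔ ∃ a : ℝ, 0 ≤ a ∧ a ≤ ‖w₁ - v‖ ∧ z = v + a * d₁ :=
    fun z => mem_segment_of_direction hw₁v
  have hedge₂ : ∀ z, z ∈ P.edgeSet ℝ i' ↔ ∃ a : ℝ, 0 ≤ a ∧ a ≤ ‖w₂ - v‖ ∧ z = v + a * d₂ := by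
    intro z
    rw [Polygon.edgeSet, hroti', affineSegment_comm]
    exact mem_segment_of_direction hw₂v
  have hdir : ∀ {u : ℂ} (j : Fin n) (ℓ : ℝ), 0 < ℓ → (conj u * (P j - v)).re ≤ 0 →
      (conj u * ((P j - v) / (ℓ : ℝ))).re ≤ 0 := by
    intro u j ℓ hℓ h
    rw [← mul_div_assoc, Complex.div_ofReal_re]
    exact div_nonpos_of_nonpos_of_nonneg h hℓ.le
  -- A direction in which `v` is extremal points away from both edges at `v`.
  have hdist : ‖d₁ - d₂‖ ≤ 2 * Real.cos (Real.pi / n) := by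
    refine norm_sub_le_of_directions hd₁ hd₂ hζ (hi.trans (measure_mono ?_))
    refine inter_subset_inter_left _ fun θ hθ => ⟨hdir _ _ hℓ₁ (hθ _), hdir _ _ hℓ₂ (hθ _)⟩
  have hne : d₁ ≠ d₂ := by
    intro h
    -- If the edges had the same direction, they would share this point, which is an end point of
    -- neither.
    set a := min ‖w₁ - v‖ ‖w₂ - v‖ / 2 with ha
    have ha0 : 0 < a := half_pos (lt_min hℓ₁ hℓ₂)
    have ha1 : a < ‖w₁ - v‖ := (half_lt_self (lt_min hℓ₁ hℓ₂)).trans_le (min_le_left _ _)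
    have ha2 : a < ‖w₂ - v‖ := (half_lt_self (lt_min hℓ₁ hℓ₂)).trans_le (min_le_right _ _)
    have hna : ‖v + a * d₁ - v‖ = a := by
      rw [add_sub_cancel_left, norm_mul, hd₁, mul_one, Complex.norm_real,
        Real.norm_of_nonneg ha0.le]
    rcases (hmeet i i' hii' (v + a * d₁) ((hedge₁ _).2 ⟨a, ha0.le, ha1.le, rfl⟩)
      ((hedge₂ _).2 ⟨a, ha0.le, ha2.le, by rw [h]⟩)).1 with h1 | h1
    · rw [h1, sub_self, norm_zero] at hna
      exact ha0.ne hna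
    · rw [h1] at hna
      exact ha1.ne' hna
  -- A straight angle would give distance `2`, more than `2 * cos (π / n)`.
  have hne' : d₁ ≠ -d₂ := by
    intro h
    have h1 : ‖d₁ - d₂‖ = 2 := by
      rw [h, ← neg_add', norm_neg, ← two_mul, norm_mul, hd₂]; norm_num
    have h2 : Real.cos (Real.pi / n) < 1 := by
      rw [← Real.cos_zero]
      exact Real.cos_lt_cos_of_nonneg_of_le_pi_div_two le_rfl (pi_div_lt hn).le hζ
    linarith
  have hd := im_conj_mul_ne_zero hd₁ hd₂ hne hne'
  -- By simplicity no other edge contains `v`, so in a small ball `∂M` consists of the two edges at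
  -- `v` alone.
  have hfar : IsClosed (⋃ j ∈ ({i, i'}ᶜ : Set (Fin n)), P.edgeSet ℝ j) := by
    refine (toFinite _).isClosed_biUnion fun j _ => ?_
    exact (isCompact_Icc.image (AffineMap.lineMap_continuous)).isClosed
  have hvfar : v ∉ ⋃ j ∈ ({i, i'}ᶜ : Set (Fin n)), P.edgeSet ℝ j := by
    simp only [mem_iUnion, not_exists]
    intro j hj hvj
    have hj1 : j ≠ i := fun h => hj (Or.inl h)
    have hj2 : j ≠ i' := fun h => hj (Or.inr h)
    rcases (hmeet i j hj1.symm v ((hedge₁ _).2 ⟨0, le_rfl, hℓ₁.le, by simp⟩) hvj).2 with h | h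
    · exact hj1 (hinj h).symm
    · exact hj2 ((finRotate n).injective ((hinj h).symm.trans hroti'.symm))
  obtain ⟨r₀, hr₀, hr₀'⟩ := Metric.isOpen_iff.1 hfar.isOpen_compl v hvfar
  obtain ⟨r, hr, hrr₀, hr₁, hr₂⟩ : ∃ r : ℝ, 0 < r ∧ r ≤ r₀ ∧ r ≤ ‖w₁ - v‖ ∧ r ≤ ‖w₂ - v‖ :=
    ⟨min r₀ (min ‖w₁ - v‖ ‖w₂ - v‖), lt_min hr₀ (lt_min hℓ₁ hℓ₂), min_le_left _ _,
      (min_le_right _ _).trans (min_le_left _ _), (min_le_right _ _).trans (min_le_right _ _)⟩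
  have hsub : ∀ j, P.edgeSet ℝ j ⊆ frontier M := fun j => by
    rw [hfr]; exact subset_iUnion (fun j => P.edgeSet ℝ j) j
  have hR₁ : ∀ a : ℝ, 0 ≤ a → a < r → v + a * d₁ ∈ frontier M := fun a ha har =>
    hsub i ((hedge₁ _).2 ⟨a, ha, har.le.trans hr₁, rfl⟩)
  have hR₂ : ∀ b : ℝ, 0 ≤ b → b < r → v + b * d₂ ∈ frontier M := fun a ha har =>
    hsub i' ((hedge₂ _).2 ⟨a, ha, har.le.trans hr₂, rfl⟩)
  have hnorm : ∀ (a : ℝ) (d : ℂ), 0 ≤ a → ‖d‖ = 1 → v + a * d ∈ Metric.ball v r → a < r := by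
    intro a d ha hd h
    rwa [mem_ball_iff_norm, add_sub_cancel_left, norm_mul, hd, mul_one, Complex.norm_real,
      Real.norm_of_nonneg ha] at h
  have hlocal : ∀ z ∈ Metric.ball v r, z ∈ frontier M ↔
      (∃ a : ℝ, 0 ≤ a ∧ z = v + a * d₁) ∨ ∃ b : ℝ, 0 ≤ b ∧ z = v + b * d₂ := by
    intro z hz
    constructor
    · intro hzf
      rw [hfr] at hzf
      obtain ⟨j, hj⟩ := mem_iUnion.1 hzf
      by_cases hji : j ∈ ({i, i'} : Set (Fin n))
      · rcases hji with rfl | rfl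
        · obtain ⟨a, ha, -, rfl⟩ := (hedge₁ z).1 hj
          exact Or.inl ⟨a, ha, rfl⟩
        · obtain ⟨a, ha, -, rfl⟩ := (hedge₂ z).1 hj
          exact Or.inr ⟨a, ha, rfl⟩
      · exact absurd (mem_biUnion (t := fun j => P.edgeSet ℝ j) hji hj)
          (hr₀' (Metric.ball_subset_ball hrr₀ hz))
    · rintro (⟨a, ha, rfl⟩ | ⟨a, ha, rfl⟩)
      · exact hR₁ a ha (hnorm a d₁ ha hd₁ hz)
      · exact hR₂ a ha (hnorm a d₂ ha hd₂ hz)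
  -- Positive measure provides an actual supporting direction at `v`; the supporting half plane then
  -- contains all edges by convexity.
  obtain ⟨θ, hθ⟩ : ∃ θ : ℝ, ∀ j, (conj (Complex.exp (θ * Complex.I)) * (P j - P i)).re ≤ 0 := by
    have hpos := (ENNReal.ofReal_pos.2 (by positivity : 0 < 2 * (Real.pi / n))).trans_le hi
    obtain ⟨θ, hθ⟩ := nonempty_of_measure_ne_zero hpos.ne'
    exact ⟨θ, hθ.1⟩
  have hhalf : ∀ z ∈ frontier M, (conj (Complex.exp (θ * Complex.I)) * (z - v)).re ≤ 0 := by
    intro z hz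
    rw [hfr] at hz
    obtain ⟨j, x, hx, rfl⟩ := mem_iUnion.1 hz
    set u := conj (Complex.exp (θ * Complex.I))
    have h1 : u * (AffineMap.lineMap (P j) (P (finRotate n j)) x - v) =
        (1 - x : ℝ) * (u * (P j - v)) + (x : ℝ) * (u * (P (finRotate n j) - v)) := by
      rw [AffineMap.lineMap_apply, vsub_eq_sub, vadd_eq_add, Complex.real_smul]
      push_cast
      ring
    rw [h1, Complex.add_re, Complex.re_ofReal_mul, Complex.re_ofReal_mul]
    have h2 := mul_nonpos_of_nonneg_of_nonpos (sub_nonneg.2 hx.2) (hθ j)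
    have h3 := mul_nonpos_of_nonneg_of_nonpos hx.1 (hθ (finRotate n j))
    linarith
  refine (escobarConstant_le_of_sector hd hd₁ hd₂ hMo hr (fun a b ha hb hab => ?_) hR₁ hR₂
    k).trans (ENNReal.ofReal_le_ofReal (by linarith))
  exact sector_subset hMo hMb hd₁ hd₂ hd hr hlocal (Complex.exp_ne_zero _)
    (hdir _ _ hℓ₁ (hθ _)) (hdir _ _ hℓ₂ (hθ _)) hhalf ha hb hab

theorem corollary3p1 (n : ℕ) (hn : 3 ≤ n) (M : Set ℂ) (hM : IsEuclideanNGon n M)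
    (k : ℕ) (hk : n ≤ k) :
    escobarConstant k M ≤ escobarConstant k (regularNGon n) ∧
      escobarConstant k (regularNGon n) ≤ escobarConstant k unitDisk :=
  ⟨(escobarConstant_le_cos hn hM k).trans (cos_le_escobarConstant_regularNGon hn hk),
    (escobarConstant_le_cos hn (isEuclideanNGon_regularNGon hn) k).trans
      (cos_le_escobarConstant_unitDisk hn hk)⟩
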